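/- Let $F$ be a nonarchimedean local field with normalized discrete valuation $val$ and absolute value $|a|=q^{-val(a)}$, where $q$ is the order of the residue field; for a square matrix $g$ write $|g|=|\det g|$. Let $m\ge 0$, $n=2m+1$, $G_k=GL_k(F)$, and let $(\Pi,V)$ be an admissible complex representation of $G_n$ of finite length. (Example: the Whittaker model of an irreducible admissible generic representation of $G_n$, or more generally the Whittaker model of an induced representation of Langlands type.) Let $P_n\subset G_n$ be the mirabolic subgroup (last row $(0,\dots,0,1)$), let $$S_n=\left\{\begin{pmatrix} g&z&y\\&g&\\&x&1\end{pmatrix}\right\},\qquad g\in G_m,\ z\in M_m(F),\ y\in F^m \text{ (column)},\ x\in F^m \text{ (row)},$$ and for a nontrivial continuous additive character $\theta$ of $F$ let $\Theta$ be the character of $P_n\cap S_n$ given by $$\Theta\left(\begin{pmatrix} I_m&z&\\&I_m&\\&&1\end{pmatrix}\begin{pmatrix} g&&\\&g&\\&&1\end{pmatrix}\begin{pmatrix} I_m&&y\\&I_m&\\&&1\end{pmatrix}\right)=\theta(\mathrm{Tr}\,z).$$ For $L\in Hom_{P_n\cap S_n}(\Pi,\Theta)$ and $v\in V$ put $S_{L,v}(g)=L(\Pi(g)v)$,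 $g\in G_n$. For $a\in(F^\times)^m$ put $m(a)=diag(b_1,\dots,b_m,I_{m+1})$ with $b_i=a_i a_{i+1}\cdots a_m$. For $1\le i\le m$ let $U'_i$ be the unipotent radical of the standard parabolic subgroup of type $(i,n-i)$, and let $\Pi_{U'_i}=V/\langle \Pi(u)w-w : u\in U'_i,\ w\in V\rangle$ be the (unnormalized) Jacquet module, a representation of $G_i\times G_{n-i}$. Let $X_{\Pi,i}$ be the set of characters $\chi$ of $F^\times$ such that $diag(tI_i,I_{n-i})$ acts by $\chi(t)$, for all $t\in F^\times$, on some irreducible subquotient of $\Pi_{U'_i}$; if $\Pi_{U'_i}=0$, put instead $X_{\Pi,i}=\{1\}$. Then: 1. Each set $X_{\Pi,i}$ is finite. 2. For every nontrivial $\theta$, every $L\in Hom_{P_n\cap S_n}(\Pi,\Theta)$ and every $v\in V$, there is a finite sum of functions of the form $$a\mapsto \Big(\prod_{i=1}^m\chi_i(a_i)\,val(a_i)^{m_i}\Big)\varphi(a),\qquad \chi_i\in X_{\Pi,i},\ m_i\in\mathbb Z_{\ge 0},$$ with $\varphi$ a Schwartz function on $F^m$ (locally constant with compact support), that equals $S_{L,v}(m(a))$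 for all $a\in(F^\times)^m$ with $|a_i|\le 1$ for $1\le i\le m-1$. 3. There is a real number $r_\Pi$ such that for all such $\theta$, $L$, $v$ and all $s\in\mathbb C$ with $\mathrm{Re}(s)>r_\Pi$ the integral $$I(S_{L,v},s)=\int_{G_m}S_{L,v}(diag(g,I_{m+1}))\,|g|^s\,dg$$ with respect to a Haar measure $dg$ on $G_m$ is absolutely convergent. -/

import Mathlib

open Matrix MeasureTheory
open scoped ValuativeRel MonoidAlgebra

noncomputable section

namespace ShalikaPeriod

/-! ### Local fields -/

section LocalField

variable {F : Type*} [Field F] [ValuativeRel F] [TopologicalSpace F]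
  [IsNonarchimedeanLocalField F]

/-- The normalized discrete valuation of `F`: it is `1` on uniformizers (junk value `0` at `0`). -/
def val (a : F) : ℤ :=
  -WithZero.log
    (IsNonarchimedeanLocalField.valueGroupWithZeroIsoInt F (ValuativeRel.valuation F a))

open Classical in
/-- The normalized absolute value `|a| = q ^ (-val a)`, with `q` the order of the residue field. -/
def nabs (a : F) : ℝ :=
  if a = 0 then 0 else (Nat.card 𝓀[F] : ℝ) ^ (-val a)

/-- Schwartz functions on `F ^ m`: locally constant with compact support. -/
def IsSchwartz {m : ℕ} (φ : (Fin m → F) → ℂ) : Prop :=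
  IsLocallyConstant φ ∧ HasCompactSupport φ

end LocalField

/-! ### Representations -/

section Representation

/-- Admissible representations of a topological group: every vector has an open stabilizer, and
the fixed vectors of every compact open subgroup form a finite dimensional space. -/
structure IsAdmissible {G V : Type*} [Group G] [TopologicalSpace G] [AddCommGroup V] [Module ℂ V]
    (ρ : Representation ℂ G V) : Prop where
  smooth : ∀ v : V, IsOpen {g : G | ρ g v = v}
  finite_fixed : ∀ K : Subgroup G, IsOpen (K : Set G) → IsCompact (K : Set G) →
    FiniteDimensional ℂ (Representation.invariants (ρ.comp K.subtype))

/-- The representation on the subquotient `C / (B ∩ C)` attached to two subrepresentations. -/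
def subquotient {G V : Type*} [Group G] [AddCommGroup V] [Module ℂ V]
    {σ : Representation ℂ G V} (B C : Subrepresentation σ) :
    Representation ℂ G (C.toSubmodule ⧸ B.toSubmodule.comap C.toSubmodule.subtype) :=
  C.toRepresentation.quotient (B.toSubmodule.comap C.toSubmodule.subtype)
    (fun g _ hw => B.apply_mem_toSubmodule g hw)

end Representation

/-! ### Maximal parabolic subgroups and Jacquet modules -/

section Jacquet

variable {ι : Type*} [Fintype ι] [DecidableEq ι] {F : Type*} [Field F]

/-- The maximal parabolic subgroup stabilizing the span of the basis vectors indexed by `A`. -/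
def parabolic (F : Type*) [Field F] (A : Set ι) : Subgroup (GL ι F) where
  carrier := {g | ∀ j ∉ A, ∀ k ∈ A, (g : Matrix ι ι F) j k = 0}
  one_mem' := by
    intro j hj k hk
    have : j ≠ k := fun h => hj (h ▸ hk)
    simp [this]
  mul_mem' := by
    intro g h hg hh j hj k hk
    rw [Units.val_mul, Matrix.mul_apply]
    refine Finset.sum_eq_zero fun p _ => ?_
    by_cases hp : p ∈ A
    · rw [hg j hj p hp, zero_mul]
    · rw [hh p hp k hk, mul_zero]
  inv_mem' := by
    classical
    intro g hg j hj k hk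
    let b : ι → ℕ := fun i => if i ∈ A then 0 else 1
    have hb : Matrix.BlockTriangular (g : Matrix ι ι F) b := by
      intro p r hpr
      by_cases hp : p ∈ A
      · simp [b, hp] at hpr
      · by_cases hr : r ∈ A
        · exact hg p hp r hr
        · simp [b, hp, hr] at hpr
    haveI : Invertible (g : Matrix ι ι F) := Units.invertible g
    have hinv := Matrix.blockTriangular_inv_of_blockTriangular hb
    have : ((g⁻¹ : GL ι F) : Matrix ι ι F) j k = 0 := by
      rw [Matrix.coe_units_inv]
      exact hinv (by simp [b, hj, hk])
    exact this

/-- Its Levi subgroup of block diagonal matrices. -/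
def levi (F : Type*) [Field F] (A : Set ι) : Subgroup (GL ι F) :=
  parabolic F A ⊓ parabolic F Aᶜ

/-- Its unipotent radical: the only nonzero entries of `u - 1` are in rows indexed by `A` and
columns indexed by the complement of `A`. -/
def unipotentRadical (F : Type*) [Field F] (A : Set ι) : Subgroup (GL ι F) where
  carrier := {u | ∀ j k, ¬(j ∈ A ∧ k ∉ A) → (u : Matrix ι ι F) j k = (1 : Matrix ι ι F) j k}
  one_mem' := fun _ _ _ => rfl
  mul_mem' := by
    intro u w hu hw j k hjk
    rw [Units.val_mul, Matrix.mul_apply]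
    by_cases hj : j ∈ A
    · have hk : k ∈ A := by
        by_contra hk
        exact hjk ⟨hj, hk⟩
      have hw' : ∀ p, (w : Matrix ι ι F) p k = (1 : Matrix ι ι F) p k :=
        fun p => hw p k (fun h => h.2 hk)
      simp only [hw', Matrix.one_apply, mul_ite, mul_one, mul_zero, Finset.sum_ite_eq',
        Finset.mem_univ, if_true]
      simpa [Matrix.one_apply] using hu j k hjk
    · have hu' : ∀ p, (u : Matrix ι ι F) j p = (1 : Matrix ι ι F) j p :=
        fun p => hu j p (fun h => hj h.1)
      simp only [hu', Matrix.one_apply, ite_mul, one_mul, zero_mul, Finset.sum_ite_eq,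
        Finset.mem_univ, if_true]
      simpa [Matrix.one_apply] using hw j k hjk
  inv_mem' := by
    intro u hu
    have h1 : ((u : Matrix ι ι F) - 1) * ((u : Matrix ι ι F) - 1) = 0 := by
      ext j k
      rw [Matrix.mul_apply]
      refine Finset.sum_eq_zero fun p _ => ?_
      by_cases hp : p ∈ A
      · rw [Matrix.sub_apply, hu j p (fun h => h.2 hp), sub_self, zero_mul]
      · rw [Matrix.sub_apply (u : Matrix ι ι F) 1 p k, hu p k (fun h => hp h.1), sub_self,
          mul_zero]
    have h2 : ((u⁻¹ : GL ι F) : Matrix ι ι F) = 1 - ((u : Matrix ι ι F) - 1) := by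
      rw [← Units.mul_eq_one_iff_inv_eq]
      calc (u : Matrix ι ι F) * (1 - ((u : Matrix ι ι F) - 1))
          = 1 - ((u : Matrix ι ι F) - 1) * ((u : Matrix ι ι F) - 1) := by noncomm_ring
        _ = 1 := by rw [h1, sub_zero]
    intro j k hjk
    rw [h2, Matrix.sub_apply, Matrix.sub_apply, hu j k hjk, sub_self, sub_zero]

theorem conj_mem_unipotentRadical {A : Set ι} {g u : GL ι F} (hg : g ∈ parabolic F A)
    (hu : u ∈ unipotentRadical F A) : g * u * g⁻¹ ∈ unipotentRadical F A := by
  have hg' : g⁻¹ ∈ parabolic F A := inv_mem hg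
  have key : ((g * u * g⁻¹ : GL ι F) : Matrix ι ι F) =
      1 + (g : Matrix ι ι F) * ((u : Matrix ι ι F) - 1) * ((g⁻¹ : GL ι F) : Matrix ι ι F) := by
    have : (g : Matrix ι ι F) * ((g⁻¹ : GL ι F) : Matrix ι ι F) = 1 := Units.mul_inv g
    rw [mul_sub, sub_mul, mul_one, this, Units.val_mul, Units.val_mul]
    abel
  intro j k hjk
  rw [key, Matrix.add_apply, add_eq_left, Matrix.mul_apply]
  refine Finset.sum_eq_zero fun q _ => ?_
  by_cases hq : q ∉ A ∧ k ∈ A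
  · rw [hg' q hq.1 k hq.2, mul_zero]
  rw [Matrix.mul_apply, Finset.sum_mul]
  refine Finset.sum_eq_zero fun p _ => ?_
  by_cases hpq : p ∈ A ∧ q ∉ A
  · have hj : j ∉ A := fun hj => hjk ⟨hj, fun hk => hq ⟨hpq.2, hk⟩⟩
    rw [hg j hj p hpq.1, zero_mul, zero_mul]
  · rw [Matrix.sub_apply, hu p q hpq, sub_self, mul_zero, zero_mul]

variable {V : Type*} [AddCommGroup V] [Module ℂ V]

/-- The subspace `V(U)` spanned by the vectors `ρ(u) v - v` with `u` in the unipotent radical. -/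
def jacquetKer (ρ : Representation ℂ (GL ι F) V) (A : Set ι) : Submodule ℂ V :=
  Submodule.span ℂ {w | ∃ u ∈ unipotentRadical F A, ∃ v : V, w = ρ u v - v}

/-- The (unnormalized) Jacquet module `V / V(U)`. -/
abbrev JacquetModule (ρ : Representation ℂ (GL ι F) V) (A : Set ι) : Type _ :=
  V ⧸ jacquetKer ρ A

theorem jacquetKer_le_comap (ρ : Representation ℂ (GL ι F) V) (A : Set ι) (g : levi F A) :
    jacquetKer ρ A ≤ (jacquetKer ρ A).comap (ρ.comp (levi F A).subtype g) := by
  refine Submodule.span_le.2 ?_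
  rintro _ ⟨u, hu, v, rfl⟩
  refine Submodule.subset_span ⟨g * u * (g : GL ι F)⁻¹,
    conj_mem_unipotentRadical g.2.1 hu, ρ g v, ?_⟩
  simp [← Module.End.mul_apply, ← map_mul]

/-- The action of the Levi subgroup on the Jacquet module. -/
def jacquetRep (ρ : Representation ℂ (GL ι F) V) (A : Set ι) :
    Representation ℂ (levi F A) (JacquetModule ρ A) :=
  Representation.quotient (ρ.comp (levi F A).subtype) (jacquetKer ρ A) (jacquetKer_le_comap ρ A)

/-- Invertible diagonal matrices. -/
def diagGL (d : ι → Fˣ) : GL ι F where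
  val := Matrix.diagonal fun i => (d i : F)
  inv := Matrix.diagonal fun i => ((d i)⁻¹ : Fˣ)
  val_inv := by simp [Matrix.diagonal_mul_diagonal]
  inv_val := by simp [Matrix.diagonal_mul_diagonal]

open Classical in
/-- The central element of the Levi subgroup with diagonal entries `t` on `A` and `1` off `A`. -/
def leviCentral (A : Set ι) (t : Fˣ) : levi F A :=
  ⟨diagGL fun i => if i ∈ A then t else 1, by
    refine ⟨fun j hj k hk => ?_, fun j hj k hk => ?_⟩
    · exact Matrix.diagonal_apply_ne _ (fun h => hj (h ▸ hk))
    · exact Matrix.diagonal_apply_ne _ (fun h => hj (h ▸ hk))⟩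

/-- The characters `χ` of `Fˣ` such that, on some irreducible subquotient of the Jacquet module
(as a representation of the Levi subgroup), every central element `leviCentral A t` acts
by `χ t`. -/
def centralExponents (ρ : Representation ℂ (GL ι F) V) (A : Set ι) : Set (Fˣ →* ℂˣ) :=
  {χ | ∃ B C : Subrepresentation (jacquetRep ρ A),
    (subquotient B C).IsIrreducible ∧
    ∀ (t : Fˣ) w, subquotient B C (leviCentral A t) w = (χ t : ℂ) • w}

end Jacquet

/-! ### The groups `P_n` and `S_n` for `n = 2m+1` -/

section Shalika

/-- The ordered index set of the `2m+1` basis vectors, cut into blocks of sizes `m`, `m`, `1`. -/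
abbrev Idx (m : ℕ) : Type := Fin m ⊕ (Fin m ⊕ Fin 1)

variable {m : ℕ} {F : Type*} [Field F]

/-- The mirabolic subgroup: last row `(0, …, 0, 1)`. -/
def mirabolic (m : ℕ) (F : Type*) [Field F] : Set (GL (Idx m) F) :=
  {h | ∀ k, (h : Matrix (Idx m) (Idx m) F) (.inr (.inr 0)) k =
    (1 : Matrix (Idx m) (Idx m) F) (.inr (.inr 0)) k}

/-- The Shalika subgroup of matrices `(g z y; 0 g 0; 0 x 1)`. -/
def shalika (m : ℕ) (F : Type*) [Field F] : Set (GL (Idx m) F) :=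
  {h | ∃ (g : GL (Fin m) F) (x : Matrix (Fin 1) (Fin m) F) (y : Matrix (Fin m) (Fin 1) F)
      (z : Matrix (Fin m) (Fin m) F),
    (h : Matrix (Idx m) (Idx m) F) =
      fromBlocks (g : Matrix (Fin m) (Fin m) F) (fromCols z y) 0
        (fromBlocks (g : Matrix (Fin m) (Fin m) F) 0 x 1)}

/-- The block diagonal matrix `diag(g, I_{m+1})`. -/
def diagOne (g : GL (Fin m) F) : GL (Idx m) F where
  val := fromBlocks (g : Matrix (Fin m) (Fin m) F) 0 0 1
  inv := fromBlocks ((g⁻¹ : GL (Fin m) F) : Matrix (Fin m) (Fin m) F) 0 0 1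
  val_inv := by rw [fromBlocks_multiply]; simp [-Matrix.coe_units_inv]
  inv_val := by rw [fromBlocks_multiply]; simp [-Matrix.coe_units_inv]

/-- The block diagonal matrix `diag(g, g, 1)`. -/
def diagTwo (g : GL (Fin m) F) : GL (Idx m) F where
  val := fromBlocks (g : Matrix (Fin m) (Fin m) F) 0 0
    (fromBlocks (g : Matrix (Fin m) (Fin m) F) 0 0 1)
  inv := fromBlocks ((g⁻¹ : GL (Fin m) F) : Matrix (Fin m) (Fin m) F) 0 0
    (fromBlocks ((g⁻¹ : GL (Fin m) F) : Matrix (Fin m) (Fin m) F) 0 0 1)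
  val_inv := by simp [fromBlocks_multiply, -Matrix.coe_units_inv]
  inv_val := by simp [fromBlocks_multiply, -Matrix.coe_units_inv]

/-- The unipotent matrix `(1 z y; 0 1 0; 0 0 1)`. -/
def unip (z : Matrix (Fin m) (Fin m) F) (y : Matrix (Fin m) (Fin 1) F) : GL (Idx m) F where
  val := fromBlocks 1 (fromCols z y) 0 1
  inv := fromBlocks 1 (-fromCols z y) 0 1
  val_inv := by
    rw [fromBlocks_multiply]
    simp only [Matrix.one_mul, Matrix.mul_one, Matrix.mul_zero, Matrix.zero_mul, add_zero,
      zero_add, neg_add_cancel, fromBlocks_one]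
  inv_val := by
    rw [fromBlocks_multiply]
    simp only [Matrix.one_mul, Matrix.mul_one, Matrix.mul_zero, Matrix.zero_mul, add_zero,
      zero_add, add_neg_cancel, fromBlocks_one]

/-- The elements of `P_n ∩ S_n` are exactly the products on which `Θ` is defined. -/
theorem mem_mirabolic_inter_shalika {h : GL (Idx m) F} :
    h ∈ mirabolic m F ∩ shalika m F ↔ ∃ (z : Matrix (Fin m) (Fin m) F) (g : GL (Fin m) F)
      (y : Matrix (Fin m) (Fin 1) F), h = unip z 0 * diagTwo g * unip 0 y := by
  have key : ∀ (z : Matrix (Fin m) (Fin m) F) (g : GL (Fin m) F) (y : Matrix (Fin m) (Fin 1) F),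
      ((unip z 0 * diagTwo g * unip 0 y : GL (Idx m) F) : Matrix (Idx m) (Idx m) F) =
        fromBlocks (g : Matrix (Fin m) (Fin m) F)
            (fromCols (z * (g : Matrix (Fin m) (Fin m) F)) ((g : Matrix (Fin m) (Fin m) F) * y)) 0
          (fromBlocks (g : Matrix (Fin m) (Fin m) F) 0 0 1) := by
    intro z g y
    simp only [Units.val_mul, unip, diagTwo, fromBlocks_multiply]
    simp only [Matrix.mul_fromCols, Matrix.fromCols_mul_fromBlocks, Matrix.one_mul,
      Matrix.mul_one, Matrix.mul_zero, Matrix.zero_mul, add_zero, zero_add]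
    congr 1
    ext i (j | j) <;> simp
  constructor
  · rintro ⟨hP, g, x, y, z, hS⟩
    have hx : x = 0 := by
      ext i j
      have := hP (.inr (.inl j))
      rw [hS] at this
      fin_cases i
      simpa using this
    subst hx
    refine ⟨z * ((g⁻¹ : GL (Fin m) F) : Matrix (Fin m) (Fin m) F), g,
      ((g⁻¹ : GL (Fin m) F) : Matrix (Fin m) (Fin m) F) * y, ?_⟩
    refine Units.ext ?_
    have h1 : ((g⁻¹ : GL (Fin m) F) : Matrix (Fin m) (Fin m) F) * (g : Matrix _ _ F) = 1 :=
      Units.inv_mul g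
    have h2 : (g : Matrix (Fin m) (Fin m) F) * ((g⁻¹ : GL (Fin m) F) : Matrix _ _ F) = 1 :=
      Units.mul_inv g
    rw [key, hS, Matrix.mul_assoc, h1, ← Matrix.mul_assoc, h2, Matrix.mul_one, Matrix.one_mul]
  · rintro ⟨z, g, y, rfl⟩
    refine ⟨fun k => ?_, g, 0, (g : Matrix (Fin m) (Fin m) F) * y,
      z * (g : Matrix (Fin m) (Fin m) F), key z g y⟩
    rw [key]
    rcases k with k | k | k
    · simp
    · simp
    · obtain rfl : k = 0 := Subsingleton.elim _ _
      simp

variable {V : Type*} [AddCommGroup V] [Module ℂ V]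

/-- The space `Hom_{P_n ∩ S_n}(ρ, Θ)` of linear forms `L` with `L (ρ h v) = Θ h * L v` for
`h ∈ P_n ∩ S_n`, where `Θ` is the character with
`Θ ((1 z 0; 0 1 0; 0 0 1) * diag(g, g, 1) * (1 0 y; 0 1 0; 0 0 1)) = θ (Tr z)`. -/
def shalikaHom (ρ : Representation ℂ (GL (Idx m) F) V)
    (θ : AddChar F Circle) : Submodule ℂ (Module.Dual ℂ V) where
  carrier := {L | ∀ z g y v, L (ρ (unip z 0 * diagTwo g * unip 0 y) v) =
    (θ (Matrix.trace z) : ℂ) * L v}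
  zero_mem' := by intro z g y v; simp
  add_mem' := by
    intro L M hL hM z g y v
    rw [LinearMap.add_apply, LinearMap.add_apply, hL, hM, mul_add]
  smul_mem' := by
    intro c L hL z g y v
    rw [LinearMap.smul_apply, LinearMap.smul_apply, hL, smul_eq_mul, smul_eq_mul, mul_left_comm]

/-- The function `S_{L,v}(g) = L (ρ g v)`. -/
def shalikaFun (ρ : Representation ℂ (GL (Idx m) F) V) (L : Module.Dual ℂ V) (v : V)
    (g : GL (Idx m) F) : ℂ :=
  L (ρ g v)

/-- The matrix `m(a) = diag(b_1, …, b_m, I_{m+1})` with `b_i = a_i ⋯ a_m`. -/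
def mMat (a : Fin m → Fˣ) : GL (Idx m) F :=
  diagOne (diagGL fun i => ∏ j ∈ Finset.Ici i, a j)

/-- The indices of the first `i + 1` basis vectors (`i` counted from `0`): the parabolic subgroup
attached to this set is the standard one of type `(i + 1, n - (i + 1))`. -/
def firstIdx (i : Fin m) : Set (Idx m) :=
  {k | ∃ j : Fin m, j ≤ i ∧ k = .inl j}

end Shalika

end ShalikaPeriod

end

/-!
Put `f v a = L (ρ (m(a)) v)`. Three facts govern this function of `a`.

* Its support is bounded: a vector `v` is fixed by a small unipotent matrix `unip z 0`, and moving
  this matrix to the left through `diag(g, I_{m+1})` produces the factor `θ (Tr (g z))`, which is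
  not always `1` unless the entries of `g` are bounded (`exists_support_bound`).
* If `v` lies in the kernel `jacquetKer ρ (firstIdx i)` of the projection to a Jacquet module, then
  `f v a` vanishes for small `a i`, uniformly in the other bounded variables (`exists_vanishing`):
  for `u` in the unipotent radical the conjugate of `u` by `m(a)` is a matrix `unip z y`, on which
  `L` transforms by `θ (Tr z) = 1`, times `diag(h, I_{m+1})` with `h` close to `1`, and the left
  equivariance of `L` turns the latter into an element that fixes the vector
  (`shalika_diagOne_mul`).
* The vectors of a Jacquet module fixed by a congruence subgroup of the Levi subgroup form a finite
  dimensional space (`finiteDimensional_jacquetFixed`). Such a space is stable under the central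
  elements `leviCentral (firstIdx i) t` of the Levi subgroup, and decomposing it into generalized
  eigenspaces expresses its matrix coefficients through functions `χ(t) val(t)^k`, where `χ` has an
  eigenvector in the Jacquet module and is therefore a central exponent (`exists_matrixCoeff_eq`,
  `eigenCharacters_subset_centralExponents`).

Jacquet's lemma here needs only the Iwahori factorization of congruence subgroups: fixed vectors of
the Levi subgroup are moved by a contracting element of the torus until they are also fixed by the
opposite unipotent radical, and averaging over a compact open subgroup then produces vectors in a
space that is finite dimensional by admissibility. As the Jacquet module is generated over the Levi
subgroup by one of these spaces (Iwasawa decomposition), it is the sum of finitely many generalized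
eigenspaces of the central torus, and there are finitely many central exponents
(`finite_centralExponents`).

The second and third fact show that, for small `a i`, the dependence of `f v a` on `a i` is given by
a matrix coefficient of a fixed finite dimensional representation (`exists_torus_matrixCoeff`). So
all slices of `f v` in the `i`-th variable lie in one finite dimensional space of functions with the
required form, and a function of several variables with this property is a combination of products
of functions of one variable (`mem_span_prod_of_slices`). This is the expansion
(`exists_shalika_expansion`).

For the integral, the Cartan decomposition `g = k₁ m(a) k₂` (`exists_cartan`) and the equivariance
of `L` reduce the growth of `L (ρ (diag(g, I_{m+1})) v)` to finitely many functions `f w`; the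
expansion bounds them by `C Q ^ val(det g)`, where `Q` depends only on the finitely many central
exponents (`exists_shalika_bound`). The matrices with bounded entries and determinant of given
valuation `d` are covered by at most exponentially many (in `d`) cosets of a fixed compact open
subgroup (`exists_measure_integralLevel_le`), so that a geometric series dominates the integral
when the real part of `s` is large (`exists_integrable_of_bound`).
-/

namespace ShalikaPeriod

/-! ### The normalized absolute value -/

section LocalFieldFacts

variable (F : Type*) [Field F] [ValuativeRel F] [TopologicalSpace F]
  [IsNonarchimedeanLocalField F]

/-- The order `q` of the residue field, as a real number. -/
noncomputable def resCard : ℝ := (Nat.card 𝓀[F] : ℝ)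

theorem one_lt_resCard : 1 < resCard F := by
  have : 1 < Nat.card 𝓀[F] := Finite.one_lt_card
  unfold resCard
  exact_mod_cast this

theorem resCard_pos : 0 < resCard F := zero_lt_one.trans (one_lt_resCard F)

variable {F}

theorem val_mul {a b : F} (ha : a ≠ 0) (hb : b ≠ 0) : val (a * b) = val a + val b := by
  unfold val
  rw [map_mul, map_mul, WithZero.log_mul (by simpa using ha) (by simpa using hb)]
  ring

@[simp] theorem val_one : val (1 : F) = 0 := by simp [val]

theorem nabs_of_ne_zero {a : F} (ha : a ≠ 0) : nabs a = resCard F ^ (-val a) := by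
  rw [nabs, if_neg ha]; rfl

@[simp] theorem nabs_zero : nabs (0 : F) = 0 := by simp [nabs]

theorem nabs_units (a : Fˣ) : nabs (a : F) = resCard F ^ (-val (a : F)) :=
  nabs_of_ne_zero a.ne_zero

theorem nabs_pos {a : F} (ha : a ≠ 0) : 0 < nabs a := by
  rw [nabs_of_ne_zero ha]; exact zpow_pos (resCard_pos F) _

theorem nabs_units_pos (a : Fˣ) : 0 < nabs (a : F) := nabs_pos a.ne_zero

theorem nabs_nonneg (a : F) : 0 ≤ nabs a := by
  by_cases ha : a = 0
  · simp [ha]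
  · exact (nabs_pos ha).le

@[simp] theorem nabs_eq_zero {a : F} : nabs a = 0 ↔ a = 0 :=
  ⟨fun h => by_contra fun ha => (nabs_pos ha).ne' h, fun h => by simp [h]⟩

@[simp] theorem nabs_one : nabs (1 : F) = 1 := by
  rw [nabs_of_ne_zero one_ne_zero]; simp

@[simp] theorem nabs_mul (a b : F) : nabs (a * b) = nabs a * nabs b := by
  by_cases ha : a = 0
  · simp [ha]
  by_cases hb : b = 0
  · simp [hb]
  rw [nabs_of_ne_zero ha, nabs_of_ne_zero hb, nabs_of_ne_zero (mul_ne_zero ha hb), val_mul ha hb,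
    ← zpow_add₀ (resCard_pos F).ne']
  congr 1; ring

/-- The normalized absolute value as a homomorphism of monoids with zero. -/
noncomputable def nabsHom : F →*₀ ℝ where
  toFun := nabs
  map_zero' := nabs_zero
  map_one' := nabs_one
  map_mul' := nabs_mul

@[simp] theorem nabs_inv (a : F) : nabs a⁻¹ = (nabs a)⁻¹ := map_inv₀ nabsHom a

@[simp] theorem nabs_div (a b : F) : nabs (a / b) = nabs a / nabs b := map_div₀ nabsHom a b

theorem nabs_prod {α : Type*} (s : Finset α) (f : α → F) :
    nabs (∏ i ∈ s, f i) = ∏ i ∈ s, nabs (f i) := map_prod nabsHom f s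

theorem nabs_le_nabs {a b : F} :
    nabs a ≤ nabs b ↔ ValuativeRel.valuation F a ≤ ValuativeRel.valuation F b := by
  by_cases ha : a = 0
  · simp [ha, nabs_nonneg]
  by_cases hb : b = 0
  · simp only [hb, nabs_zero, map_zero, le_zero_iff, map_eq_zero]
    exact ⟨fun h => nabs_eq_zero.1 (le_antisymm h (nabs_nonneg a)), fun h => by simp [h]⟩
  rw [nabs_of_ne_zero ha, nabs_of_ne_zero hb, zpow_le_zpow_iff_right₀ (one_lt_resCard F)]
  unfold val
  rw [neg_neg, neg_neg, WithZero.log_le_log (by simpa using ha) (by simpa using hb)]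
  exact map_le_map_iff (IsNonarchimedeanLocalField.valueGroupWithZeroIsoInt F)

@[simp] theorem nabs_neg (a : F) : nabs (-a) = nabs a :=
  le_antisymm (nabs_le_nabs.2 (by rw [Valuation.map_neg]))
    (nabs_le_nabs.2 (by rw [Valuation.map_neg]))

theorem nabs_add_le {a b : F} {c : ℝ} (ha : nabs a ≤ c) (hb : nabs b ≤ c) : nabs (a + b) ≤ c := by
  rcases le_total (nabs a) (nabs b) with h | h
  · refine le_trans (nabs_le_nabs.2 ?_) hb
    exact Valuation.map_add_le _ (nabs_le_nabs.1 h) le_rfl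
  · refine le_trans (nabs_le_nabs.2 ?_) ha
    exact Valuation.map_add_le _ le_rfl (nabs_le_nabs.1 h)

theorem nabs_sub_le {a b : F} {c : ℝ} (ha : nabs a ≤ c) (hb : nabs b ≤ c) : nabs (a - b) ≤ c := by
  rw [sub_eq_add_neg]; exact nabs_add_le ha (by rwa [nabs_neg])

theorem nabs_sum_le {α : Type*} (s : Finset α) (f : α → F) {c : ℝ} (hc : 0 ≤ c)
    (h : ∀ i ∈ s, nabs (f i) ≤ c) : nabs (∑ i ∈ s, f i) ≤ c := by
  classical
  induction s using Finset.induction_on with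
  | empty => simpa using hc
  | insert a s ha ih =>
    rw [Finset.sum_insert ha]
    exact nabs_add_le (h a (by simp)) (ih fun i hi => h i (by simp [hi]))

theorem nabs_eq_one_of_sub_lt {a : F} (h : nabs (a - 1) < 1) : nabs a = 1 := by
  apply le_antisymm
  · have := nabs_add_le h.le (le_of_eq (nabs_one (F := F)))
    simpa using this
  · by_contra hlt
    push Not at hlt
    have h1 : nabs ((1 : F)) ≤ max (nabs a) (nabs (a - 1)) := by
      have := nabs_sub_le (le_max_left (nabs a) (nabs (a - 1)))
        (le_max_right (nabs a) (nabs (a - 1)))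
      simpa using this
    rw [nabs_one] at h1
    exact absurd h1 (not_le.2 (max_lt hlt h))

variable (F) in
theorem exists_uniformizer : ∃ ϖ : Fˣ, val (ϖ : F) = 1 := by
  obtain ⟨x, hx⟩ := ValuativeRel.valuation_surjective
    ((IsNonarchimedeanLocalField.valueGroupWithZeroIsoInt F).symm (WithZero.exp (-1 : ℤ)))
  have h0 : x ≠ 0 := by
    rintro rfl
    rw [map_zero] at hx
    have := congrArg (IsNonarchimedeanLocalField.valueGroupWithZeroIsoInt F) hx
    simp [-WithZero.exp_neg] at this
    exact WithZero.coe_ne_zero this.symm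
  refine ⟨Units.mk0 x h0, ?_⟩
  simp [val, hx]

variable (F) in
/-- A uniformizer of `F`. -/
noncomputable def unif : Fˣ := (exists_uniformizer F).choose

@[simp] theorem val_unif : val (unif F : F) = 1 := (exists_uniformizer F).choose_spec

theorem val_units_mul (a b : Fˣ) : val ((a * b : Fˣ) : F) = val (a : F) + val (b : F) := by
  rw [Units.val_mul, val_mul a.ne_zero b.ne_zero]

variable (F) in
/-- The valuation as a homomorphism on the multiplicative group. -/
noncomputable def valHom : Fˣ →* Multiplicative ℤ where
  toFun a := Multiplicative.ofAdd (val (a : F))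
  map_one' := by simp
  map_mul' a b := by rw [val_units_mul]; rfl

@[simp] theorem val_unif_zpow (n : ℤ) : val ((unif F ^ n : Fˣ) : F) = n := by
  have := map_zpow (valHom F) (unif F) n
  have h := congrArg Multiplicative.toAdd this
  simpa [valHom] using h

theorem val_units_inv (a : Fˣ) : val ((a⁻¹ : Fˣ) : F) = -val (a : F) := by
  have := val_units_mul a a⁻¹
  simp only [mul_inv_cancel, Units.val_one, val_one] at this
  linarith

theorem val_units_div (a b : Fˣ) : val ((a / b : Fˣ) : F) = val (a : F) - val (b : F) := by
  rw [div_eq_mul_inv, val_units_mul, val_units_inv]; ring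

theorem nabs_unif_zpow (n : ℤ) : nabs ((unif F ^ n : Fˣ) : F) = resCard F ^ (-n) := by
  rw [nabs_units, val_unif_zpow]

theorem nabs_unif : nabs (unif F : F) = (resCard F)⁻¹ := by
  have := nabs_unif_zpow (F := F) 1
  simpa using this

theorem nabs_unif_lt_one : nabs (unif F : F) < 1 := by
  rw [nabs_unif]; exact inv_lt_one_of_one_lt₀ (one_lt_resCard F)

theorem nabs_units_le_iff {a : Fˣ} {n : ℤ} :
    nabs (a : F) ≤ resCard F ^ (-n) ↔ n ≤ val (a : F) := by
  rw [nabs_units, zpow_le_zpow_iff_right₀ (one_lt_resCard F), neg_le_neg_iff]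

theorem nabs_units_le_one_iff {a : Fˣ} : nabs (a : F) ≤ 1 ↔ 0 ≤ val (a : F) := by
  have := nabs_units_le_iff (a := a) (n := 0)
  simpa using this

theorem nabs_units_eq_one_iff {a : Fˣ} : nabs (a : F) = 1 ↔ val (a : F) = 0 := by
  rw [nabs_units, zpow_eq_one_iff_right₀ (resCard_pos F).le (one_lt_resCard F).ne', neg_eq_zero]

variable (F) in
theorem exists_resCard_zpow_le {ε : ℝ} (hε : 0 < ε) :
    ∃ k : ℕ, 1 ≤ k ∧ resCard F ^ (-(k : ℤ)) ≤ ε := by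
  obtain ⟨n, hn⟩ := exists_pow_lt_of_lt_one hε (inv_lt_one_of_one_lt₀ (one_lt_resCard F))
  refine ⟨n + 1, by omega, ?_⟩
  rw [_root_.zpow_neg, zpow_natCast, ← inv_pow]
  exact (pow_le_pow_of_le_one (inv_nonneg.2 (resCard_pos F).le)
    (inv_lt_one_of_one_lt₀ (one_lt_resCard F)).le (Nat.le_succ n)).trans hn.le

variable (F) in
theorem exists_le_resCard_zpow (C : ℝ) : ∃ k : ℕ, C ≤ resCard F ^ (k : ℤ) := by
  obtain ⟨n, hn⟩ := pow_unbounded_of_one_lt C (one_lt_resCard F)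
  exact ⟨n, by rw [zpow_natCast]; exact hn.le⟩

theorem isCompact_nabs_le (k : ℤ) : IsCompact {x : F | nabs x ≤ resCard F ^ k} := by
  have := IsNonarchimedeanLocalField.isCompact_closedBall F
    (ValuativeRel.valuation F ((unif F ^ (-k) : Fˣ) : F))
  convert! this using 2
  ext x
  rw [← nabs_le_nabs, nabs_unif_zpow, neg_neg]

theorem nabs_ball_mem_nhds {ε : ℝ} (hε : 0 < ε) : {x : F | nabs x ≤ ε} ∈ nhds (0 : F) := by
  obtain ⟨k, -, hk⟩ := exists_resCard_zpow_le F hε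
  refine (IsValuativeTopology.hasBasis_nhds_zero' F).mem_iff.2
    ⟨ValuativeRel.valuation F ((unif F ^ (k : ℤ) : Fˣ) : F), by simp, fun x hx => ?_⟩
  refine le_trans (nabs_le_nabs.2 (le_of_lt hx)) ?_
  rwa [nabs_unif_zpow]

theorem exists_nabs_ball_subset {U : Set F} (hU : U ∈ nhds (0 : F)) :
    ∃ k : ℕ, 1 ≤ k ∧ {x : F | nabs x ≤ resCard F ^ (-(k : ℤ))} ⊆ U := by
  obtain ⟨γ, hγ, h⟩ := (IsValuativeTopology.hasBasis_nhds_zero' F).mem_iff.1 hU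
  obtain ⟨y, rfl⟩ := ValuativeRel.valuation_surjective γ
  have hy : y ≠ 0 := by simpa using hγ
  have hy' := nabs_pos hy
  obtain ⟨k, h1, hk⟩ := exists_resCard_zpow_le F (half_pos hy')
  refine ⟨k, h1, fun x hx => h ?_⟩
  have hlt : nabs x < nabs y := (le_trans hx hk).trans_lt (half_lt_self hy')
  exact lt_of_not_ge fun hle => absurd (nabs_le_nabs.2 hle) (not_le.2 hlt)

theorem isOpen_nabs_sub_le (a : F) {ε : ℝ} (hε : 0 < ε) : IsOpen {x : F | nabs (x - a) ≤ ε} := by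
  rw [isOpen_iff_mem_nhds]
  intro x hx
  have : Filter.Tendsto (fun y : F => y - x) (nhds x) (nhds 0) := by
    have h : Continuous fun y : F => y - x := by fun_prop
    simpa using h.tendsto x
  filter_upwards [this (nabs_ball_mem_nhds hε)] with y hy
  have := nabs_add_le (c := ε) hy hx
  simpa using this

end LocalFieldFacts

/-! ### Congruence subgroups of the general linear group -/

section Congruence

variable {F : Type*} [Field F] [ValuativeRel F] [TopologicalSpace F]
  [IsNonarchimedeanLocalField F] {ι : Type*} [Fintype ι] [DecidableEq ι]

variable (F) in
/-- The radius `q ^ (-k)` of the ball of elements of valuation at least `k`. -/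
noncomputable def radius (k : ℕ) : ℝ := resCard F ^ (-(k : ℤ))

variable (F) in
theorem radius_pos (k : ℕ) : 0 < radius F k := zpow_pos (resCard_pos F) _

variable (F) in
theorem radius_anti {k l : ℕ} (h : k ≤ l) : radius F l ≤ radius F k :=
  zpow_le_zpow_right₀ (one_lt_resCard F).le (by omega)

@[simp] theorem radius_zero : radius F 0 = 1 := by simp [radius]

variable (F) in
theorem radius_le_one (k : ℕ) : radius F k ≤ 1 := by
  simpa using radius_anti F (Nat.zero_le k)

variable (F) in
theorem radius_lt_one {k : ℕ} (h : 1 ≤ k) : radius F k < 1 := by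
  rw [radius]
  exact zpow_lt_one_of_neg₀ (one_lt_resCard F) (by omega)

theorem nabs_eq_of_sub_lt {x y : F} (h : nabs (y - x) < nabs x) : nabs y = nabs x := by
  have hx : x ≠ 0 := by
    rintro rfl
    exact absurd h (by simpa using nabs_nonneg y)
  have h1 : nabs (y / x - 1) < 1 := by
    rw [div_sub_one hx, nabs_div, div_lt_one (nabs_pos hx)]; exact h
  have := nabs_eq_one_of_sub_lt h1
  rwa [nabs_div, div_eq_one_iff_eq (nabs_pos hx).ne'] at this

theorem isOpen_nabs_eq {c : ℝ} (hc : c ≠ 0) : IsOpen {x : F | nabs x = c} := by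
  rw [isOpen_iff_mem_nhds]
  intro x hx
  have hx' : nabs x = c := hx
  have hpos : 0 < c := lt_of_le_of_ne (hx' ▸ nabs_nonneg x) hc.symm
  filter_upwards [(isOpen_nabs_sub_le x (half_pos hpos)).mem_nhds
    (by simpa using (half_pos hpos).le)] with y hy
  exact (nabs_eq_of_sub_lt (by rw [hx']; exact lt_of_le_of_lt hy (half_lt_self hpos))).trans hx'

instance : T2Space F := by
  refine ⟨fun x y hxy => ?_⟩
  have hpos : 0 < nabs (x - y) := nabs_pos (sub_ne_zero.2 hxy)
  refine ⟨_, _, isOpen_nabs_sub_le x (half_pos hpos), isOpen_nabs_sub_le y (half_pos hpos),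
    by simpa using (half_pos hpos).le, by simpa using (half_pos hpos).le, ?_⟩
  rw [Set.disjoint_left]
  intro z hx hy
  have := nabs_sub_le (c := nabs (x - y) / 2) hy hx
  rw [sub_sub_sub_cancel_left] at this
  linarith

theorem nabs_prod_sub_prod_le {α : Type*} (s : Finset α) {a b : α → F} {r : ℝ} (hr : 0 ≤ r)
    (ha : ∀ i ∈ s, nabs (a i) ≤ 1) (hb : ∀ i ∈ s, nabs (b i) ≤ 1)
    (hab : ∀ i ∈ s, nabs (a i - b i) ≤ r) : nabs (∏ i ∈ s, a i - ∏ i ∈ s, b i) ≤ r := by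
  classical
  induction s using Finset.induction_on with
  | empty => simpa using hr
  | insert c s hc ih =>
    have ih' := ih (fun i hi => ha i (by simp [hi])) (fun i hi => hb i (by simp [hi]))
      (fun i hi => hab i (by simp [hi]))
    have hp : nabs (∏ i ∈ s, b i) ≤ 1 := by
      rw [nabs_prod]
      exact Finset.prod_le_one (fun i _ => nabs_nonneg _) fun i hi => hb i (by simp [hi])
    rw [Finset.prod_insert hc, Finset.prod_insert hc]
    have : a c * ∏ i ∈ s, a i - b c * ∏ i ∈ s, b i =
        a c * (∏ i ∈ s, a i - ∏ i ∈ s, b i) + (a c - b c) * ∏ i ∈ s, b i := by ring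
    rw [this]
    refine nabs_add_le ?_ ?_
    · rw [nabs_mul]
      exact (mul_le_mul (ha c (by simp)) ih' (nabs_nonneg _) zero_le_one).trans (by simp)
    · rw [nabs_mul]
      exact (mul_le_mul (hab c (by simp)) hp (nabs_nonneg _) hr).trans (by simp)

theorem nabs_sign (σ : Equiv.Perm ι) (x : F) : nabs (Equiv.Perm.sign σ • x) = nabs x := by
  rcases Int.units_eq_one_or (Equiv.Perm.sign σ) with h | h <;> simp [h]

theorem nabs_det_le_one {A : Matrix ι ι F} (hA : ∀ i j, nabs (A i j) ≤ 1) : nabs A.det ≤ 1 := by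
  rw [Matrix.det_apply]
  refine nabs_sum_le _ _ zero_le_one fun σ _ => ?_
  rw [nabs_sign, nabs_prod]
  exact Finset.prod_le_one (fun i _ => nabs_nonneg _) fun i _ => hA _ _

theorem nabs_det_sub_det_le {A B : Matrix ι ι F} {r : ℝ} (hr : 0 ≤ r)
    (hA : ∀ i j, nabs (A i j) ≤ 1) (hB : ∀ i j, nabs (B i j) ≤ 1)
    (hAB : ∀ i j, nabs (A i j - B i j) ≤ r) : nabs (A.det - B.det) ≤ r := by
  rw [Matrix.det_apply, Matrix.det_apply, ← Finset.sum_sub_distrib]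
  refine nabs_sum_le _ _ hr fun σ _ => ?_
  rw [← smul_sub, nabs_sign]
  exact nabs_prod_sub_prod_le _ hr (fun i _ => hA _ _) (fun i _ => hB _ _) fun i _ => hAB _ _

theorem nabs_mul_apply_le {κ l o : Type*} [Fintype l] {A : Matrix κ l F} {B : Matrix l o F}
    {r s : ℝ} (hr : 0 ≤ r) (hs : 0 ≤ s)
    (hA : ∀ i j, nabs (A i j) ≤ r) (hB : ∀ i j, nabs (B i j) ≤ s) (i : κ) (j : o) :
    nabs ((A * B) i j) ≤ r * s := by
  rw [Matrix.mul_apply]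
  refine nabs_sum_le _ _ (mul_nonneg hr hs) fun l _ => ?_
  rw [nabs_mul]
  exact mul_le_mul (hA _ _) (hB _ _) (nabs_nonneg _) hr

omit [Fintype ι] in
theorem nabs_one_apply_le (i j : ι) : nabs ((1 : Matrix ι ι F) i j) ≤ 1 := by
  rw [Matrix.one_apply]; split_ifs <;> simp

/-- A matrix with integral entries and unit determinant has an inverse with integral entries. -/
theorem nabs_inv_apply_le_one {g : GL ι F} (hd : nabs (g : Matrix ι ι F).det = 1)
    (h : ∀ i j, nabs ((g : Matrix ι ι F) i j) ≤ 1) (i j : ι) :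
    nabs (((g⁻¹ : GL ι F) : Matrix ι ι F) i j) ≤ 1 := by
  rw [Matrix.coe_units_inv, Matrix.inv_def, Matrix.smul_apply, smul_eq_mul, nabs_mul,
    Ring.inverse_eq_inv', nabs_inv, hd, inv_one, one_mul, Matrix.adjugate_apply]
  refine nabs_det_le_one fun a b => ?_
  by_cases hb : a = j
  · subst hb
    rw [Matrix.updateRow_self, Pi.single_apply]
    split_ifs <;> simp
  · rw [Matrix.updateRow_ne hb]; exact h _ _

variable (F ι) in
/-- The congruence subgroup of level `k`: the integral matrices with unit determinant that are
congruent to `1` modulo the `k`-th power of the maximal ideal. For `k = 0` it is the group of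
points over the ring of integers. -/
noncomputable def congrSubgroup (k : ℕ) : Subgroup (GL ι F) where
  carrier := {g | nabs (g : Matrix ι ι F).det = 1 ∧
    ∀ i j, nabs ((g : Matrix ι ι F) i j - (1 : Matrix ι ι F) i j) ≤ radius F k}
  one_mem' := by simp [(radius_pos F k).le]
  mul_mem' := by
    rintro g h ⟨hg1, hg2⟩ ⟨hh1, hh2⟩
    refine ⟨by rw [Units.val_mul, det_mul, nabs_mul, hg1, hh1, one_mul], fun i j => ?_⟩
    have hint : ∀ i j, nabs ((h : Matrix ι ι F) i j) ≤ 1 := fun i j => by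
      have := nabs_add_le ((hh2 i j).trans (radius_le_one F k)) (nabs_one_apply_le i j)
      simpa using this
    have : (g * h : GL ι F).val - 1 = ((g : Matrix ι ι F) - 1) * h + (h - 1) := by
      rw [Units.val_mul]; noncomm_ring
    rw [← Matrix.sub_apply, this, Matrix.add_apply]
    refine nabs_add_le ?_ (hh2 i j)
    have := nabs_mul_apply_le (radius_pos F k).le zero_le_one
      (A := (g : Matrix ι ι F) - 1) (B := (h : Matrix ι ι F)) hg2 hint i j
    simpa using this
  inv_mem' := by
    rintro g ⟨hg1, hg2⟩
    have hint : ∀ i j, nabs ((g : Matrix ι ι F) i j) ≤ 1 := fun i j => by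
      have := nabs_add_le ((hg2 i j).trans (radius_le_one F k)) (nabs_one_apply_le i j)
      simpa using this
    have hinv := nabs_inv_apply_le_one hg1 hint
    have hmul : ((g⁻¹ : GL ι F) : Matrix ι ι F) * (g : Matrix ι ι F) = 1 := Units.inv_mul g
    refine ⟨?_, fun i j => ?_⟩
    · have := congrArg (fun A => nabs A.det) hmul
      simp only [det_mul, nabs_mul, det_one, nabs_one] at this
      rwa [hg1, mul_one] at this
    · have : ((g⁻¹ : GL ι F) : Matrix ι ι F) - 1 =
          -(((g⁻¹ : GL ι F) : Matrix ι ι F) * ((g : Matrix ι ι F) - 1)) := by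
        rw [mul_sub, hmul]; noncomm_ring
      rw [← Matrix.sub_apply, this, Matrix.neg_apply, nabs_neg]
      have := nabs_mul_apply_le zero_le_one (radius_pos F k).le
        (A := ((g⁻¹ : GL ι F) : Matrix ι ι F)) (B := (g : Matrix ι ι F) - 1) hinv hg2 i j
      simpa using this

theorem mem_congrSubgroup {k : ℕ} {g : GL ι F} :
    g ∈ congrSubgroup F ι k ↔ nabs (g : Matrix ι ι F).det = 1 ∧
      ∀ i j, nabs ((g : Matrix ι ι F) i j - (1 : Matrix ι ι F) i j) ≤ radius F k := Iff.rfl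

theorem mem_congrSubgroup_zero {g : GL ι F} :
    g ∈ congrSubgroup F ι 0 ↔ nabs (g : Matrix ι ι F).det = 1 ∧
      ∀ i j, nabs ((g : Matrix ι ι F) i j) ≤ 1 := by
  rw [mem_congrSubgroup, radius_zero]
  refine and_congr_right fun _ => forall₂_congr fun i j => ⟨fun h => ?_, fun h => ?_⟩
  · simpa using nabs_add_le h (nabs_one_apply_le i j)
  · exact nabs_sub_le h (nabs_one_apply_le i j)

theorem congrSubgroup_anti {k l : ℕ} (h : k ≤ l) : congrSubgroup F ι l ≤ congrSubgroup F ι k :=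
  fun _ hg => ⟨hg.1, fun i j => (hg.2 i j).trans (radius_anti F h)⟩

theorem nabs_apply_le_one_of_mem {k : ℕ} {g : GL ι F} (hg : g ∈ congrSubgroup F ι k) (i j : ι) :
    nabs ((g : Matrix ι ι F) i j) ≤ 1 :=
  (mem_congrSubgroup_zero.1 (congrSubgroup_anti (Nat.zero_le k) hg)).2 i j

theorem nabs_det_eq_one {k : ℕ} (hk : 1 ≤ k) {A : Matrix ι ι F}
    (hA : ∀ i j, nabs (A i j - (1 : Matrix ι ι F) i j) ≤ radius F k) : nabs A.det = 1 := by
  have hint : ∀ i j, nabs (A i j) ≤ 1 := fun i j => by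
    have := nabs_add_le ((hA i j).trans (radius_le_one F k)) (nabs_one_apply_le i j)
    simpa using this
  have := nabs_det_sub_det_le (radius_pos F k).le hint nabs_one_apply_le hA
  rw [det_one] at this
  exact nabs_eq_one_of_sub_lt (this.trans_lt (radius_lt_one F hk))

/-- For positive level the congruence alone describes the congruence subgroup. -/
theorem mem_congrSubgroup_of_one_le {k : ℕ} (hk : 1 ≤ k) {g : GL ι F}
    (hg : ∀ i j, nabs ((g : Matrix ι ι F) i j - (1 : Matrix ι ι F) i j) ≤ radius F k) :
    g ∈ congrSubgroup F ι k := ⟨nabs_det_eq_one hk hg, hg⟩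

/-- A matrix congruent to `1` to positive level is invertible. -/
theorem exists_congrSubgroup_val_eq {k : ℕ} (hk : 1 ≤ k) {A : Matrix ι ι F}
    (hA : ∀ i j, nabs (A i j - (1 : Matrix ι ι F) i j) ≤ radius F k) :
    ∃ g ∈ congrSubgroup F ι k, (g : Matrix ι ι F) = A := by
  have h := nabs_det_eq_one hk hA
  have hd : A.det ≠ 0 := by
    intro h0; rw [h0] at h; simp at h
  exact ⟨GeneralLinearGroup.mkOfDetNeZero A hd, ⟨h, hA⟩, rfl⟩

theorem isOpen_congrSubgroup (k : ℕ) : IsOpen (congrSubgroup F ι k : Set (GL ι F)) := by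
  have h1 : Continuous fun g : GL ι F => (g : Matrix ι ι F).det :=
    Continuous.matrix_det Units.continuous_val
  have h2 : ∀ i j, Continuous fun g : GL ι F => (g : Matrix ι ι F) i j :=
    fun i j => Continuous.matrix_elem Units.continuous_val i j
  have : (congrSubgroup F ι k : Set (GL ι F)) =
      {g : GL ι F | nabs (g : Matrix ι ι F).det = 1} ∩ ⋂ i, ⋂ j,
        {g : GL ι F | nabs ((g : Matrix ι ι F) i j - (1 : Matrix ι ι F) i j) ≤ radius F k} := by
    ext g
    simp [mem_congrSubgroup]
  rw [this]
  refine ((isOpen_nabs_eq one_ne_zero).preimage h1).inter ?_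
  exact isOpen_iInter_of_finite fun i => isOpen_iInter_of_finite fun j =>
    (isOpen_nabs_sub_le _ (radius_pos F k)).preimage (h2 i j)

theorem isCompact_matrix_nabs_le (k : ℤ) {κ l : Type*} :
    IsCompact {A : Matrix κ l F | ∀ i j, nabs (A i j) ≤ resCard F ^ k} := by
  have h := isCompact_univ_pi fun _ : κ => isCompact_univ_pi fun _ : l =>
    isCompact_nabs_le (F := F) k
  convert! h using 1
  ext A
  exact ⟨fun h i _ j _ => h i j, fun h i j => h i trivial j trivial⟩

/-- Congruence subgroups are compact. The units carry the topology induced by `g ↦ (g, g⁻¹)`, and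
the image of the congruence subgroup of level `0` is a closed subset of a product of two compact
sets of integral matrices. -/
theorem isCompact_congrSubgroup (k : ℕ) : IsCompact (congrSubgroup F ι k : Set (GL ι F)) := by
  have h0 : IsCompact (congrSubgroup F ι 0 : Set (GL ι F)) := by
    rw [Units.isEmbedding_embedProduct.isCompact_iff]
    have hM := isCompact_matrix_nabs_le (F := F) 0 (κ := ι) (l := ι)
    have hM' := hM.image (MulOpposite.continuous_op)
    refine (hM.prod hM').of_isClosed_subset ?_ ?_
    · have : Units.embedProduct (Matrix ι ι F) '' (congrSubgroup F ι 0 : Set (GL ι F)) =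
          ({p : Matrix ι ι F × (Matrix ι ι F)ᵐᵒᵖ | p.1 * p.2.unop = 1} ∩
          {p : Matrix ι ι F × (Matrix ι ι F)ᵐᵒᵖ | p.2.unop * p.1 = 1}) ∩
          ({A : Matrix ι ι F | ∀ i j, nabs (A i j) ≤ resCard F ^ (0 : ℤ)} ×ˢ
          (MulOpposite.op '' {A : Matrix ι ι F | ∀ i j, nabs (A i j) ≤ resCard F ^ (0 : ℤ)})) := by
        ext p
        constructor
        · rintro ⟨g, hg, rfl⟩
          refine ⟨⟨Units.mul_inv g, Units.inv_mul g⟩, ?_, ⟨_, ?_, rfl⟩⟩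
          · intro i j
            simpa using nabs_apply_le_one_of_mem hg i j
          · intro i j
            simpa using nabs_apply_le_one_of_mem (inv_mem hg) i j
        · rintro ⟨⟨h1, h2⟩, h3, B, h4, h5⟩
          obtain ⟨A, C⟩ := p
          obtain rfl : MulOpposite.op B = C := h5
          refine ⟨⟨A, B, h1, h2⟩, mem_congrSubgroup_zero.2 ⟨?_, fun i j => by simpa using h3 i j⟩,
            rfl⟩
          have hA : nabs A.det ≤ 1 := nabs_det_le_one fun i j => by simpa using h3 i j
          have hB : nabs B.det ≤ 1 := nabs_det_le_one fun i j => by simpa using h4 i j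
          have hAB : nabs A.det * nabs B.det = 1 := by
            rw [← nabs_mul, ← det_mul]
            have : A * B = 1 := h1
            rw [this, det_one, nabs_one]
          refine le_antisymm hA ?_
          nlinarith [nabs_nonneg A.det, nabs_nonneg B.det]
      rw [this]
      have c1 : Continuous fun p : Matrix ι ι F × (Matrix ι ι F)ᵐᵒᵖ => p.1 * p.2.unop := by
        fun_prop
      have c2 : Continuous fun p : Matrix ι ι F × (Matrix ι ι F)ᵐᵒᵖ => p.2.unop * p.1 := by
        fun_prop
      exact ((isClosed_singleton.preimage c1).inter (isClosed_singleton.preimage c2)).inter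
        (hM.isClosed.prod hM'.isClosed)
    · rintro _ ⟨g, hg, rfl⟩
      refine ⟨?_, ⟨_, ?_, rfl⟩⟩
      · intro i j
        simpa using nabs_apply_le_one_of_mem hg i j
      · intro i j
        simpa using nabs_apply_le_one_of_mem (inv_mem hg) i j
  exact h0.of_isClosed_subset (Subgroup.isClosed_of_isOpen _ (isOpen_congrSubgroup k))
    (congrSubgroup_anti (Nat.zero_le k))

theorem exists_matrix_ball_subset {U : Set (Matrix ι ι F)} (hU : U ∈ nhds (1 : Matrix ι ι F)) :
    ∃ k : ℕ,
      {A : Matrix ι ι F | ∀ i j, nabs (A i j - (1 : Matrix ι ι F) i j) ≤ radius F k} ⊆ U := by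
  have hball : ∀ (a : F) (s : Set F), s ∈ nhds a →
      ∃ k : ℕ, {x | nabs (x - a) ≤ radius F k} ⊆ s := by
    intro a s hs
    have h1 : (fun x : F => x + a) ⁻¹' s ∈ nhds (0 : F) := by
      have hc : Continuous fun x : F => x + a := by fun_prop
      exact hc.continuousAt.preimage_mem_nhds (by simpa using hs)
    obtain ⟨k, -, hk⟩ := exists_nabs_ball_subset h1
    refine ⟨k, fun x hx => ?_⟩
    have := hk (show x - a ∈ _ from hx)
    simpa using this
  have key : ∀ (c : ι → ι → F) (s : Set (ι → ι → F)), s ∈ nhds c →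
      ∃ k : ℕ, {x : ι → ι → F | ∀ i j, nabs (x i j - c i j) ≤ radius F k} ⊆ s := by
    intro c s hs
    rw [nhds_pi, Filter.mem_pi'] at hs
    obtain ⟨I, t, ht, hI⟩ := hs
    have h2 : ∀ i, ∃ k : ℕ, {x : ι → F | ∀ j, nabs (x j - c i j) ≤ radius F k} ⊆ t i := by
      intro i
      have := ht i
      rw [nhds_pi, Filter.mem_pi'] at this
      obtain ⟨J, s, hs, hJ⟩ := this
      choose k hk using fun j => hball _ _ (hs j)
      refine ⟨Finset.univ.sup k, fun x hx => hJ fun j _ => hk j ?_⟩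
      exact (hx j).trans (radius_anti F (Finset.le_sup (Finset.mem_univ j)))
    choose k hk using h2
    refine ⟨Finset.univ.sup k, fun x hx => hI fun i _ => hk i fun j => ?_⟩
    exact (hx i j).trans (radius_anti F (Finset.le_sup (Finset.mem_univ i)))
  exact key _ U hU

/-- The congruence subgroups form a neighbourhood basis of `1`. -/
theorem exists_congrSubgroup_subset {U : Set (GL ι F)} (hU : U ∈ nhds (1 : GL ι F)) :
    ∃ k : ℕ, 1 ≤ k ∧ (congrSubgroup F ι k : Set (GL ι F)) ⊆ U := by
  rw [Units.isEmbedding_embedProduct.nhds_eq_comap, Filter.mem_comap, map_one] at hU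
  obtain ⟨t, ht, htU⟩ := hU
  rw [← Prod.mk_one_one, mem_nhds_prod_iff] at ht
  obtain ⟨u, hu, v, hv, huv⟩ := ht
  obtain ⟨k, hk⟩ := exists_matrix_ball_subset hu
  have hv' : MulOpposite.op ⁻¹' v ∈ nhds (1 : Matrix ι ι F) :=
    MulOpposite.continuous_op.continuousAt.preimage_mem_nhds (by simpa using hv)
  obtain ⟨l, hl⟩ := exists_matrix_ball_subset hv'
  refine ⟨max 1 (max k l), le_max_left _ _, fun g hg => htU (huv ⟨hk ?_, hl ?_⟩)⟩
  · exact (congrSubgroup_anti (by omega) hg).2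
  · exact (congrSubgroup_anti (l := max 1 (max k l)) (by omega) (inv_mem hg)).2

end Congruence

/-! ### Orbits of smooth vectors -/

section Orbits

variable {G V : Type*} [Group G] [AddCommGroup V] [Module ℂ V]

theorem finite_orbit_of_isCompact [TopologicalSpace G] [ContinuousMul G]
    (ρ : Representation ℂ G V) {v : V} (hv : IsOpen {g : G | ρ g v = v}) {K : Set G}
    (hK : IsCompact K) : ((fun g => ρ g v) '' K).Finite := by
  let : TopologicalSpace V := ⊥
  have : DiscreteTopology V := ⟨rfl⟩
  have hlc : IsLocallyConstant fun g => ρ g v := by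
    rw [IsLocallyConstant.iff_eventually_eq]
    intro g
    have hc : Continuous fun h : G => g⁻¹ * h := by fun_prop
    filter_upwards [(hv.preimage hc).mem_nhds (by simp)] with h hh
    have hh' : ρ (g⁻¹ * h) v = v := hh
    calc ρ h v = ρ g (ρ (g⁻¹ * h) v) := by
          rw [← Module.End.mul_apply, ← map_mul, mul_inv_cancel_left]
      _ = ρ g v := by rw [hh']
  exact (hK.image hlc.continuous).finite_of_discrete

/-- Averaging over a finite orbit: if the orbit of `v` under `H` is finite and contained in
`v + N`, then `v + N` contains a vector fixed by `H`. -/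
theorem exists_fixed_of_finite_orbit (ρ : Representation ℂ G V) (H : Subgroup G) (v : V)
    (hfin : ((fun g => ρ g v) '' (H : Set G)).Finite) (N : Submodule ℂ V)
    (hN : ∀ g ∈ H, ρ g v - v ∈ N) : ∃ w, (∀ g ∈ H, ρ g w = w) ∧ w - v ∈ N := by
  classical
  set O := hfin.toFinset with hO
  have hmem : ∀ x, x ∈ O ↔ ∃ g ∈ H, ρ g v = x := fun x => by simp [hO]
  have hne : (O.card : ℂ) ≠ 0 := by
    have : O.Nonempty := ⟨v, (hmem v).2 ⟨1, one_mem H, by simp⟩⟩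
    exact_mod_cast this.card_ne_zero
  refine ⟨(O.card : ℂ)⁻¹ • ∑ x ∈ O, x, fun g hg => ?_, ?_⟩
  · rw [map_smul, map_sum]
    congr 1
    refine Finset.sum_bij (fun x _ => ρ g x) (fun x hx => ?_) (fun x _ y _ hxy => ?_)
      (fun y hy => ?_) (fun x _ => rfl)
    · obtain ⟨h, hh, rfl⟩ := (hmem x).1 hx
      exact (hmem _).2 ⟨g * h, mul_mem hg hh, by rw [map_mul, Module.End.mul_apply]⟩
    · have := congrArg (ρ g⁻¹) hxy
      simpa [← Module.End.mul_apply, ← map_mul] using this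
    · obtain ⟨h, hh, rfl⟩ := (hmem y).1 hy
      refine ⟨ρ (g⁻¹ * h) v, (hmem _).2 ⟨_, mul_mem (inv_mem hg) hh, rfl⟩, ?_⟩
      rw [← Module.End.mul_apply, ← map_mul, mul_inv_cancel_left]
  · have : (O.card : ℂ)⁻¹ • ∑ x ∈ O, x - v = (O.card : ℂ)⁻¹ • ∑ x ∈ O, (x - v) := by
      rw [Finset.sum_sub_distrib, Finset.sum_const, smul_sub, ← Nat.cast_smul_eq_nsmul ℂ,
        smul_smul, inv_mul_cancel₀ hne, one_smul]
    rw [this]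
    refine N.smul_mem _ (N.sum_mem fun x hx => ?_)
    obtain ⟨g, hg, rfl⟩ := (hmem x).1 hx
    exact hN g hg

end Orbits

section Smooth

variable {F : Type*} [Field F] [ValuativeRel F] [TopologicalSpace F]
  [IsNonarchimedeanLocalField F] {ι : Type*} [Fintype ι] [DecidableEq ι]
  {V : Type*} [AddCommGroup V] [Module ℂ V] {ρ : Representation ℂ (GL ι F) V}

theorem IsAdmissible.exists_fixed (hρ : IsAdmissible ρ) (v : V) :
    ∃ k : ℕ, 1 ≤ k ∧ ∀ g ∈ congrSubgroup F ι k, ρ g v = v :=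
  exists_congrSubgroup_subset ((hρ.smooth v).mem_nhds (by simp))

theorem IsAdmissible.exists_fixed_finset (hρ : IsAdmissible ρ) {α : Type*} (s : Finset α)
    (v : α → V) : ∃ k : ℕ, 1 ≤ k ∧ ∀ i ∈ s, ∀ g ∈ congrSubgroup F ι k, ρ g (v i) = v i := by
  choose k h1 hk using fun i => hρ.exists_fixed (v i)
  refine ⟨max 1 (s.sup k), le_max_left _ _, fun i hi g hg => hk i g ?_⟩
  exact congrSubgroup_anti ((Finset.le_sup hi).trans (le_max_right _ _)) hg

theorem IsAdmissible.finite_orbit (hρ : IsAdmissible ρ) (v : V) {H : Subgroup (GL ι F)} {k : ℕ}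
    (hH : H ≤ congrSubgroup F ι k) : ((fun g => ρ g v) '' (H : Set (GL ι F))).Finite :=
  (finite_orbit_of_isCompact ρ (hρ.smooth v) (isCompact_congrSubgroup k)).subset
    (Set.image_mono hH)

end Smooth

/-! ### The Iwasawa decomposition for maximal parabolic subgroups -/

section Iwasawa

variable {F : Type*} [Field F] [ValuativeRel F] [TopologicalSpace F]
  [IsNonarchimedeanLocalField F] {ι : Type*} [Fintype ι] [DecidableEq ι]

theorem mem_congrSubgroup_zero_of_inv {g : GL ι F} (h1 : ∀ i j, nabs ((g : Matrix ι ι F) i j) ≤ 1)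
    (h2 : ∀ i j, nabs (((g⁻¹ : GL ι F) : Matrix ι ι F) i j) ≤ 1) : g ∈ congrSubgroup F ι 0 := by
  refine mem_congrSubgroup_zero.2 ⟨?_, h1⟩
  have hA := nabs_det_le_one h1
  have hB := nabs_det_le_one h2
  have hAB : nabs (g : Matrix ι ι F).det * nabs ((g⁻¹ : GL ι F) : Matrix ι ι F).det = 1 := by
    rw [← nabs_mul, ← det_mul, Units.mul_inv, det_one, nabs_one]
  refine le_antisymm hA ?_
  nlinarith [nabs_nonneg (g : Matrix ι ι F).det, nabs_nonneg ((g⁻¹ : GL ι F) : Matrix ι ι F).det]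

/-- Permutation matrices are integral. -/
theorem exists_perm_matrix (σ : Equiv.Perm ι) :
    ∃ k ∈ congrSubgroup F ι 0, (k : Matrix ι ι F) = (1 : Matrix ι ι F).submatrix id σ := by
  have hd : ((1 : Matrix ι ι F).submatrix id σ).det = Equiv.Perm.sign σ := by
    rw [Matrix.det_permute', det_one, mul_one]
  have hn : nabs ((1 : Matrix ι ι F).submatrix id σ).det = 1 := by
    rw [hd]
    rcases Int.units_eq_one_or (Equiv.Perm.sign σ) with h | h <;> simp [h]
  refine ⟨GeneralLinearGroup.mkOfDetNeZero _ (fun h => by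
      have h' := congrArg nabs h
      rw [nabs_zero] at h'
      exact one_ne_zero (hn.symm.trans h')),
    mem_congrSubgroup_zero.2 ⟨hn, fun i j => ?_⟩, rfl⟩
  exact nabs_one_apply_le _ _

omit [DecidableEq ι] in
/-- A matrix with a right inverse has a nonvanishing maximal minor. -/
theorem exists_minor_ne_zero {K κ : Type*} [Field K] [Fintype κ] [DecidableEq κ]
    (R : Matrix κ ι K) (Q : Matrix ι κ K) (h : R * Q = 1) :
    ∃ s : κ → ι, (R.submatrix id s).det ≠ 0 := by
  have hspan : Submodule.span K (Set.range R.col) = ⊤ := by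
    rw [eq_top_iff]
    intro x _
    have hx : R *ᵥ (Q *ᵥ x) = x := by rw [mulVec_mulVec, h, one_mulVec]
    rw [← hx, ← Matrix.range_mulVecLin]
    exact ⟨_, rfl⟩
  obtain ⟨κ', a, -, hsp, hli⟩ := exists_linearIndependent' K R.col
  have hsp' : ⊤ ≤ Submodule.span K (Set.range (R.col ∘ a)) := by
    rw [hsp]; exact hspan.ge
  let b := Module.Basis.mk hli hsp'
  let e := b.indexEquiv (Pi.basisFun K κ)
  refine ⟨a ∘ e.symm, ?_⟩
  have hli' := hli.comp e.symm e.symm.injective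
  have : IsUnit (R.submatrix id (a ∘ e.symm)) := by
    rw [← Matrix.linearIndependent_cols_iff_isUnit]
    exact hli'
  exact ((Matrix.isUnit_iff_isUnit_det _).1 this).ne_zero

/-- The Iwasawa decomposition. Among the maximal minors of the rows of `g` off `A`, one of largest
absolute value is moved to the columns off `A` by a permutation; by Cramer's rule the remaining
columns are then integral combinations of these, and can be cleared by an integral matrix. -/
theorem exists_parabolic_mul_congrSubgroup (A : Set ι) (g : GL ι F) :
    ∃ p ∈ parabolic F A, ∃ k ∈ congrSubgroup F ι 0, g = p * k := by
  classical
  let c := {j : ι // j ∉ A}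
  let R : Matrix c ι F := (g : Matrix ι ι F).submatrix Subtype.val id
  have hRQ : R * (((g⁻¹ : GL ι F) : Matrix ι ι F).submatrix id (Subtype.val : c → ι)) = 1 := by
    rw [← Matrix.submatrix_mul _ _ _ _ _ Function.bijective_id, Units.mul_inv,
      Matrix.submatrix_one _ Subtype.val_injective]
  obtain ⟨s0, hs0⟩ := exists_minor_ne_zero R _ hRQ
  have : Nonempty (c → ι) := ⟨s0⟩
  obtain ⟨s, hs⟩ := Finite.exists_max fun s : c → ι => nabs (R.submatrix id s).det
  have hD : (R.submatrix id s).det ≠ 0 := by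
    intro h
    have := hs s0
    rw [h, nabs_zero] at this
    exact absurd this (not_le.2 (nabs_pos hs0))
  have hinj : Function.Injective s := by
    intro i j hij
    by_contra hne
    exact hD (Matrix.det_zero_of_column_eq hne fun k => by simp [hij])
  let σ : Equiv.Perm ι := (Equiv.ofInjective s hinj).extendSubtype
  have hσ : ∀ j : c, σ j = s j := fun j => by
    exact Equiv.extendSubtype_apply_of_mem (Equiv.ofInjective s hinj) (j : ι) j.2
  obtain ⟨P, hP, hPval⟩ := exists_perm_matrix (F := F) σ
  have hg' : ∀ i j, ((g * P : GL ι F) : Matrix ι ι F) i j = (g : Matrix ι ι F) i (σ j) := by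
    intro i j
    rw [Units.val_mul, hPval, Matrix.mul_apply]
    simp [Matrix.one_apply]
  set D : Matrix c c F := R.submatrix id s with hDdef
  let X : ι → c → F := fun l => D⁻¹ *ᵥ fun j : c => (g : Matrix ι ι F) j (σ l)
  have hX : ∀ l j, nabs (X l j) ≤ 1 := by
    intro l j
    have h1 : X l j = (D.det)⁻¹ * (R.submatrix id (Function.update s j (σ l))).det := by
      change (D⁻¹ *ᵥ _) j = _
      rw [Matrix.inv_def, Ring.inverse_eq_inv', Matrix.smul_mulVec, Pi.smul_apply, smul_eq_mul,
        ← Matrix.cramer_eq_adjugate_mulVec, Matrix.cramer_apply]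
      congr 2
      ext a b
      by_cases hb : b = j
      · subst hb; simp [R]
      · simp [R, hb, D]
    rw [h1, nabs_mul, nabs_inv, inv_mul_le_iff₀ (nabs_pos hD), mul_one]
    exact hs _
  let N : Matrix ι ι F := fun i l => if h : i ∉ A then (if l ∈ A then X l ⟨i, h⟩ else 0) else 0
  have hN1 : ∀ i l, i ∈ A → N i l = 0 := fun i l h => by simp [N, h]
  have hN2 : ∀ i l, l ∉ A → N i l = 0 := fun i l h => by simp [N, h]
  have hNN : N * N = 0 := by
    ext i l
    rw [Matrix.mul_apply]
    refine Finset.sum_eq_zero fun j _ => ?_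
    by_cases hj : j ∈ A
    · rw [hN1 j l hj, mul_zero]
    · rw [hN2 i j hj, zero_mul]
  have hNint : ∀ i l, nabs (N i l) ≤ 1 := by
    intro i l
    simp only [N]
    split_ifs
    · simp
    · exact hX _ _
    · simp
  let k : GL ι F := ⟨1 - N, 1 + N, by
    calc (1 - N) * (1 + N) = 1 - N * N := by noncomm_ring
      _ = 1 := by rw [hNN, sub_zero], by
    calc (1 + N) * (1 - N) = 1 - N * N := by noncomm_ring
      _ = 1 := by rw [hNN, sub_zero]⟩
  have hk : k ∈ congrSubgroup F ι 0 := mem_congrSubgroup_zero_of_inv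
    (fun i j => nabs_sub_le (nabs_one_apply_le i j) (hNint i j))
    (fun i j => nabs_add_le (nabs_one_apply_le i j) (hNint i j))
  refine ⟨g * P * k, fun j hj l hl => ?_, (P * k)⁻¹, inv_mem (mul_mem hP hk), by group⟩
  have hval : ((g * P * k : GL ι F) : Matrix ι ι F) =
      ((g * P : GL ι F) : Matrix ι ι F) - ((g * P : GL ι F) : Matrix ι ι F) * N := by
    change ((g * P : GL ι F) : Matrix ι ι F) * (1 - N) = _
    noncomm_ring
  rw [hval, Matrix.sub_apply, sub_eq_zero, Matrix.mul_apply,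
    ← Fintype.sum_subtype_add_sum_subtype (fun i => i ∈ A)]
  have hz : ∑ i : {i // i ∈ A}, ((g * P : GL ι F) : Matrix ι ι F) j i * N i l = 0 :=
    Finset.sum_eq_zero fun i _ => by rw [hN1 _ _ i.2, mul_zero]
  rw [hz, zero_add]
  have hDX : D *ᵥ X l = fun j : c => (g : Matrix ι ι F) j (σ l) := by
    simp only [X]
    rw [mulVec_mulVec, Matrix.mul_nonsing_inv _ (isUnit_iff_ne_zero.2 hD), one_mulVec]
  have := congrFun hDX ⟨j, hj⟩
  rw [hg', ← this, Matrix.mulVec, dotProduct]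
  refine Finset.sum_congr rfl fun i _ => ?_
  rw [hg', hσ i]
  simp [N, i.2, hl, D, R]

end Iwasawa

/-! ### Block decompositions attached to a maximal parabolic subgroup -/

section Blocks

variable {K : Type*} [Field K] {ι : Type*} [Fintype ι] [DecidableEq ι] {A : Set ι}

omit [Fintype ι] [DecidableEq ι] in
open Classical in
/-- The block diagonal part of a matrix with respect to the partition of the indices into `A` and
its complement. -/
noncomputable def blockDiag (A : Set ι) (X : Matrix ι ι K) : Matrix ι ι K :=
  fun i j => if (i ∈ A ↔ j ∈ A) then X i j else 0

omit [Fintype ι] [DecidableEq ι] in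
theorem blockDiag_of_iff {X : Matrix ι ι K} {i j : ι} (h : i ∈ A ↔ j ∈ A) :
    blockDiag A X i j = X i j := if_pos h

omit [Fintype ι] [DecidableEq ι] in
theorem blockDiag_of_not_iff {X : Matrix ι ι K} {i j : ι} (h : ¬(i ∈ A ↔ j ∈ A)) :
    blockDiag A X i j = 0 := if_neg h

theorem mem_levi_iff {g : GL ι K} :
    g ∈ levi K A ↔ ∀ i j, ¬(i ∈ A ↔ j ∈ A) → (g : Matrix ι ι K) i j = 0 := by
  constructor
  · intro hg i j h
    by_cases hi : i ∈ A
    · exact hg.2 i (fun h' => h' hi) j (fun hj => h ⟨fun _ => hj, fun _ => hi⟩)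
    · exact hg.1 i hi j (by_contra fun hj => h ⟨fun h' => absurd h' hi, fun h' => absurd h' hj⟩)
  · intro h
    exact ⟨fun i hi j hj => h i j fun hij => hi (hij.2 hj),
      fun i hi j hj => h i j fun hij => hj (hij.1 (not_not.1 hi))⟩

theorem mul_blockDiag_apply {p : GL ι K} (hp : p ∈ parabolic K A) {p' : GL ι K}
    (hp' : p' ∈ parabolic K A) {i j : ι} (h : ¬(i ∈ A ∧ j ∉ A)) :
    ((p : Matrix ι ι K) * blockDiag A (p' : Matrix ι ι K)) i j =
      ((p * p' : GL ι K) : Matrix ι ι K) i j := by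
  rw [Units.val_mul, Matrix.mul_apply, Matrix.mul_apply]
  refine Finset.sum_congr rfl fun l _ => ?_
  by_cases hl : l ∈ A ↔ j ∈ A
  · rw [blockDiag_of_iff hl]
  · rw [blockDiag_of_not_iff hl, mul_zero]
    by_cases hj : j ∈ A
    · rw [hp' l (fun h' => hl ⟨fun _ => hj, fun _ => h'⟩) j hj, mul_zero]
    · have hl' : l ∈ A := by
        by_contra h'
        exact hl ⟨fun h'' => absurd h'' h', fun h'' => absurd h'' hj⟩
      have hi : i ∉ A := fun hi => h ⟨hi, hj⟩
      rw [hp i hi l hl', zero_mul]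

/-- The Levi decomposition of a maximal parabolic subgroup. -/
theorem exists_unipotent_mul_levi {p : GL ι K} (hp : p ∈ parabolic K A) :
    ∃ u ∈ unipotentRadical K A, ∃ l ∈ levi K A, p = u * l := by
  have key : ∀ p p' : GL ι K, p ∈ parabolic K A → p' ∈ parabolic K A → p * p' = 1 →
      blockDiag A (p : Matrix ι ι K) * blockDiag A (p' : Matrix ι ι K) = 1 := by
    intro p p' hp hp' hpp
    ext i j
    by_cases hij : i ∈ A ↔ j ∈ A
    · rw [← Units.val_one, ← hpp, ← mul_blockDiag_apply hp hp' (fun h => h.2 (hij.1 h.1)),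
        Matrix.mul_apply, Matrix.mul_apply]
      refine Finset.sum_congr rfl fun l _ => ?_
      by_cases hl : l ∈ A ↔ j ∈ A
      · rw [blockDiag_of_iff (hij.trans hl.symm)]
      · rw [blockDiag_of_not_iff hl, mul_zero, mul_zero]
    · rw [Matrix.one_apply_ne (fun h => hij (by rw [h])), Matrix.mul_apply]
      refine Finset.sum_eq_zero fun l _ => ?_
      by_cases hl : i ∈ A ↔ l ∈ A
      · rw [blockDiag_of_not_iff (X := (p' : Matrix ι ι K)) (fun h => hij (hl.trans h)), mul_zero]
      · rw [blockDiag_of_not_iff hl, zero_mul]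
  have hp' : p⁻¹ ∈ parabolic K A := inv_mem hp
  let l : GL ι K := ⟨blockDiag A (p : Matrix ι ι K), blockDiag A ((p⁻¹ : GL ι K) : Matrix ι ι K),
    key _ _ hp hp' (mul_inv_cancel p), key _ _ hp' hp (inv_mul_cancel p)⟩
  refine ⟨p * l⁻¹, fun i j hij => ?_, l, mem_levi_iff.2 fun i j hij => blockDiag_of_not_iff hij,
    by group⟩
  have : ((p * l⁻¹ : GL ι K) : Matrix ι ι K) =
      (p : Matrix ι ι K) * blockDiag A ((p⁻¹ : GL ι K) : Matrix ι ι K) := rfl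
  rw [this, mul_blockDiag_apply hp hp' hij, mul_inv_cancel, Units.val_one]

theorem leviCentral_val (A : Set ι) (t : Kˣ) (i j : ι) [Decidable (i ∈ A)] :
    ((leviCentral A t : GL ι K) : Matrix ι ι K) i j =
      if i = j then (if i ∈ A then (t : K) else 1) else 0 := by
  change Matrix.diagonal _ i j = _
  rw [Matrix.diagonal_apply]
  by_cases hi : i ∈ A <;> simp [hi]

theorem leviCentral_mul (t s : Kˣ) :
    leviCentral A (t * s) = leviCentral A t * (leviCentral A s : levi K A) := by
  classical
  refine Subtype.ext (Units.ext ?_)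
  change Matrix.diagonal _ = Matrix.diagonal _ * Matrix.diagonal _
  rw [Matrix.diagonal_mul_diagonal]
  congr 1
  funext i
  by_cases hi : i ∈ A <;> simp [hi]

theorem leviCentral_one : leviCentral A 1 = (1 : levi K A) := by
  classical
  refine Subtype.ext (Units.ext ?_)
  change Matrix.diagonal _ = (1 : Matrix ι ι K)
  rw [← Matrix.diagonal_one]
  congr 1
  funext i
  by_cases hi : i ∈ A <;> simp [hi]

/-- The elements `leviCentral A t` are central in the Levi subgroup. -/
theorem leviCentral_comm (t : Kˣ) (l : levi K A) : leviCentral A t * l = l * leviCentral A t := by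
  classical
  refine Subtype.ext (Units.ext ?_)
  ext i j
  change (Matrix.diagonal _ * (l : GL ι K).val : Matrix ι ι K) i j =
    ((l : GL ι K).val * Matrix.diagonal _ : Matrix ι ι K) i j
  rw [Matrix.diagonal_mul, Matrix.mul_diagonal]
  by_cases h : i ∈ A ↔ j ∈ A
  · simp only [h]; ring
  · rw [mem_levi_iff.1 l.2 i j h]; ring

/-- The torus `leviCentral A` as a homomorphism. -/
noncomputable def leviCentralHom (K : Type*) [Field K] (A : Set ι) : Kˣ →* levi K A where
  toFun := leviCentral A
  map_one' := leviCentral_one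
  map_mul' := leviCentral_mul

end Blocks

/-! ### Finiteness of Jacquet modules -/

section JacquetFinite

variable {F : Type*} [Field F] [ValuativeRel F] [TopologicalSpace F]
  [IsNonarchimedeanLocalField F] {ι : Type*} [Fintype ι] [DecidableEq ι] {A : Set ι}

theorem leviCentral_mem_congrSubgroup {k : ℕ} (hk : 1 ≤ k) {t : Fˣ}
    (ht : nabs ((t : F) - 1) ≤ radius F k) :
    (leviCentral A t : GL ι F) ∈ congrSubgroup F ι k := by
  classical
  refine mem_congrSubgroup_of_one_le hk fun i j => ?_
  rw [leviCentral_val, Matrix.one_apply]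
  split_ifs
  · exact ht
  · simpa using (radius_pos F k).le
  · simpa using (radius_pos F k).le

theorem blockDiag_sub_one_le {k : ℕ} {g : GL ι F} (hg : g ∈ congrSubgroup F ι k) (i j : ι) :
    nabs (blockDiag A (g : Matrix ι ι F) i j - (1 : Matrix ι ι F) i j) ≤ radius F k := by
  by_cases h : i ∈ A ↔ j ∈ A
  · rw [blockDiag_of_iff h]; exact hg.2 i j
  · rw [blockDiag_of_not_iff h, Matrix.one_apply_ne (fun h' => h (by rw [h'])), sub_zero,
      nabs_zero]
    exact (radius_pos F k).le

/-- The factorization of a congruence subgroup of positive level into its parts in the unipotent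
radical and in the opposite parabolic subgroup. -/
theorem exists_unipotent_mul_opposite {k : ℕ} (hk : 1 ≤ k) {g : GL ι F}
    (hg : g ∈ congrSubgroup F ι k) :
    ∃ u ∈ unipotentRadical F A, ∃ p ∈ parabolic F Aᶜ, p ∈ congrSubgroup F ι k ∧ g = u * p := by
  classical
  -- the block `D` of `g` with rows and columns outside `A` is invertible; if `B` is the block with
  -- rows in `A` and columns outside `A`, then for `u = 1 + B D⁻¹` the corresponding block of
  -- `u⁻¹ g` is `B - B D⁻¹ D = 0`
  let D₀ : Matrix ι ι F := fun i j =>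
    if i ∉ A ∧ j ∉ A then (g : Matrix ι ι F) i j else (1 : Matrix ι ι F) i j
  obtain ⟨D, hD, hDval⟩ : ∃ D ∈ congrSubgroup F ι k, (D : Matrix ι ι F) = D₀ := by
    refine exists_congrSubgroup_val_eq hk fun i j => ?_
    simp only [D₀]
    split_ifs
    · exact hg.2 i j
    · simpa using (radius_pos F k).le
  have hDl : D ∈ levi F A := by
    refine mem_levi_iff.2 fun i j hij => ?_
    rw [hDval]
    simp only [D₀]
    rw [if_neg (fun h => hij ⟨fun h' => absurd h' h.1, fun h' => absurd h' h.2⟩),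
      Matrix.one_apply_ne (fun h' => hij (by rw [h']))]
  have hDl' : D⁻¹ ∈ levi F A := inv_mem hDl
  let B : Matrix ι ι F := fun i j => if i ∈ A ∧ j ∉ A then (g : Matrix ι ι F) i j else 0
  have hB : ∀ i j, nabs (B i j) ≤ radius F k := by
    intro i j
    simp only [B]
    split_ifs with h
    · have := hg.2 i j
      rwa [Matrix.one_apply_ne (fun h' => h.2 (by rw [← h']; exact h.1)), sub_zero] at this
    · simpa using (radius_pos F k).le
  set N : Matrix ι ι F := B * ((D⁻¹ : GL ι F) : Matrix ι ι F) with hN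
  have hND : N * (D : Matrix ι ι F) = B := by
    rw [hN, mul_assoc, Units.inv_mul, mul_one]
  have hNsupp : ∀ i j, ¬(i ∈ A ∧ j ∉ A) → N i j = 0 := by
    intro i j hij
    rw [hN, Matrix.mul_apply]
    refine Finset.sum_eq_zero fun l _ => ?_
    by_cases hl : i ∈ A ∧ l ∉ A
    · have hj : j ∈ A := by
        by_contra hj
        exact hij ⟨hl.1, hj⟩
      rw [hDl'.1 l hl.2 j hj, mul_zero]
    · simp only [B]
      rw [if_neg hl, zero_mul]
  have hNN : N * N = 0 := by
    ext i j
    rw [Matrix.mul_apply]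
    refine Finset.sum_eq_zero fun l _ => ?_
    by_cases hl : l ∈ A
    · rw [hNsupp i l (fun h => h.2 hl), zero_mul]
    · rw [hNsupp l j (fun h => hl h.1), mul_zero]
  have hNint : ∀ i j, nabs (N i j) ≤ radius F k := by
    intro i j
    have := nabs_mul_apply_le (radius_pos F k).le zero_le_one hB
      (nabs_apply_le_one_of_mem (inv_mem hD)) i j
    rwa [mul_one] at this
  let u : GL ι F := ⟨1 + N, 1 - N, by
    calc (1 + N) * (1 - N) = 1 - N * N := by noncomm_ring
      _ = 1 := by rw [hNN, sub_zero], by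
    calc (1 - N) * (1 + N) = 1 - N * N := by noncomm_ring
      _ = 1 := by rw [hNN, sub_zero]⟩
  have hu : u ∈ congrSubgroup F ι k := mem_congrSubgroup_of_one_le hk fun i j => by
    change nabs ((1 + N) i j - _) ≤ _
    rw [Matrix.add_apply, add_sub_cancel_left]
    exact hNint i j
  refine ⟨u, fun i j hij => ?_, u⁻¹ * g, fun i hi j hj => ?_, mul_mem (inv_mem hu) hg, by group⟩
  · change (1 + N) i j = _
    rw [Matrix.add_apply, hNsupp i j hij, add_zero]
  · have hval : ((u⁻¹ * g : GL ι F) : Matrix ι ι F) =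
        (g : Matrix ι ι F) - N * (g : Matrix ι ι F) := by
      change (1 - N) * (g : Matrix ι ι F) = _
      noncomm_ring
    have hiA : i ∈ A := not_not.1 hi
    rw [hval, Matrix.sub_apply, sub_eq_zero]
    have h1 : B i j = (g : Matrix ι ι F) i j := if_pos ⟨hiA, hj⟩
    rw [← h1, ← hND, Matrix.mul_apply, Matrix.mul_apply]
    refine Finset.sum_congr rfl fun l _ => ?_
    by_cases hl : l ∈ A
    · rw [hNsupp i l (fun h => h.2 hl), zero_mul, zero_mul]
    · rw [hDval]
      simp only [D₀]
      rw [if_pos ⟨hl, hj⟩]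

variable {V : Type*} [AddCommGroup V] [Module ℂ V] {ρ : Representation ℂ (GL ι F) V}

omit [ValuativeRel F] [TopologicalSpace F] [IsNonarchimedeanLocalField F] in
theorem mk_apply_unipotent {u : GL ι F} (hu : u ∈ unipotentRadical F A) (v : V) :
    (Submodule.Quotient.mk (ρ u v) : JacquetModule ρ A) = Submodule.Quotient.mk v :=
  (Submodule.Quotient.eq _).2 (Submodule.subset_span ⟨u, hu, v, rfl⟩)

omit [ValuativeRel F] [TopologicalSpace F] [IsNonarchimedeanLocalField F] in
theorem jacquetRep_mk (l : levi F A) (v : V) :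
    jacquetRep ρ A l (Submodule.Quotient.mk v) = Submodule.Quotient.mk (ρ (l : GL ι F) v) := rfl

/-- The vectors of the Jacquet module fixed by the congruence subgroup of level `k` of the Levi
subgroup. -/
noncomputable def jacquetFixed (ρ : Representation ℂ (GL ι F) V) (A : Set ι) (k : ℕ) :
    Submodule ℂ (JacquetModule ρ A) where
  carrier := {x | ∀ l : levi F A, (l : GL ι F) ∈ congrSubgroup F ι k → jacquetRep ρ A l x = x}
  zero_mem' := fun _ _ => map_zero _
  add_mem' := fun hx hy l hl => by rw [map_add, hx l hl, hy l hl]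
  smul_mem' := fun c x hx l hl => by rw [map_smul, hx l hl]

theorem mk_mem_jacquetFixed {k : ℕ} {v : V} (hv : ∀ g ∈ congrSubgroup F ι k, ρ g v = v) :
    (Submodule.Quotient.mk v : JacquetModule ρ A) ∈ jacquetFixed ρ A k := fun l hl => by
  rw [jacquetRep_mk, hv _ hl]

theorem jacquetRep_leviCentral_mem {k : ℕ} {x : JacquetModule ρ A} (hx : x ∈ jacquetFixed ρ A k)
    (t : Fˣ) : jacquetRep ρ A (leviCentral A t) x ∈ jacquetFixed ρ A k := fun l hl => by
  rw [← Module.End.mul_apply, ← map_mul, ← leviCentral_comm, map_mul, Module.End.mul_apply,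
    hx l hl]

theorem exists_fixed_lift (hρ : IsAdmissible ρ) {k : ℕ} {x : JacquetModule ρ A}
    (hx : x ∈ jacquetFixed ρ A k) :
    ∃ v : V, (Submodule.Quotient.mk v : JacquetModule ρ A) = x ∧
      ∀ g ∈ levi F A, g ∈ congrSubgroup F ι k → ρ g v = v := by
  obtain ⟨v, rfl⟩ := Submodule.Quotient.mk_surjective _ x
  obtain ⟨w, hw1, hw2⟩ := exists_fixed_of_finite_orbit ρ (levi F A ⊓ congrSubgroup F ι k) v
    (hρ.finite_orbit v inf_le_right) (jacquetKer ρ A) (fun g hg => by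
      rw [← Submodule.Quotient.eq]
      exact hx ⟨g, hg.1⟩ hg.2)
  exact ⟨w, (Submodule.Quotient.eq _).2 hw2, fun g h1 h2 => hw1 g ⟨h1, h2⟩⟩

/-- Contraction: if `v` is fixed by the Levi part of level `k` and by the whole congruence subgroup
of level `k'`, then translating `v` by a sufficiently small element of the central torus gives a
vector fixed by the opposite parabolic part of level `k`. -/
theorem apply_leviCentral_fixed {k k' : ℕ} (hk : 1 ≤ k) (hk' : 1 ≤ k') {v : V}
    (h1 : ∀ g ∈ levi F A, g ∈ congrSubgroup F ι k → ρ g v = v)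
    (h2 : ∀ g ∈ congrSubgroup F ι k', ρ g v = v) {t : Fˣ} (ht : nabs (t : F) ≤ radius F k')
    {p : GL ι F} (hp : p ∈ parabolic F Aᶜ) (hpk : p ∈ congrSubgroup F ι k) :
    ρ p (ρ (leviCentral A t : GL ι F) v) = ρ (leviCentral A t : GL ι F) v := by
  classical
  set τ : GL ι F := (leviCentral A t : GL ι F) with hτ
  obtain ⟨l, hl, hlval⟩ := exists_congrSubgroup_val_eq hk (blockDiag_sub_one_le (A := A) hpk)
  have hll : l ∈ levi F A := mem_levi_iff.2 fun i j hij => by rw [hlval, blockDiag_of_not_iff hij]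
  let E : Matrix ι ι F := fun i j => if i ∉ A ∧ j ∈ A then (p : Matrix ι ι F) i j * t else 0
  have hE : ∀ i j, nabs (E i j) ≤ radius F k' := by
    intro i j
    simp only [E]
    split_ifs
    · rw [nabs_mul]
      have := mul_le_mul (nabs_apply_le_one_of_mem hpk i j) ht (nabs_nonneg _) zero_le_one
      simpa using this
    · simpa using (radius_pos F k').le
  have hconj : (p : Matrix ι ι F) * (τ : Matrix ι ι F) =
      (τ : Matrix ι ι F) * ((l : Matrix ι ι F) + E) := by
    ext i j
    change ((p : Matrix ι ι F) * Matrix.diagonal _ : Matrix ι ι F) i j =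
      (Matrix.diagonal _ * _ : Matrix ι ι F) i j
    rw [Matrix.mul_diagonal, Matrix.diagonal_mul, Matrix.add_apply, hlval]
    simp only [E]
    by_cases hi : i ∈ A <;> by_cases hj : j ∈ A
    · rw [blockDiag_of_iff (by tauto)]; simp [hi, hj, mul_comm]
    · rw [blockDiag_of_not_iff (by tauto), hp i (by simpa using hi) j hj]; simp [hi]
    · rw [blockDiag_of_not_iff (by tauto)]; simp [hi, hj]
    · rw [blockDiag_of_iff (by tauto)]; simp [hi, hj]
  obtain ⟨g, hg, hgval⟩ : ∃ g ∈ congrSubgroup F ι k', (g : Matrix ι ι F) =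
      1 + ((l⁻¹ : GL ι F) : Matrix ι ι F) * E := by
    refine exists_congrSubgroup_val_eq hk' fun i j => ?_
    rw [Matrix.add_apply, add_sub_cancel_left]
    have := nabs_mul_apply_le zero_le_one (radius_pos F k').le
      (nabs_apply_le_one_of_mem (inv_mem hl)) hE i j
    simpa using this
  have hfac : p * τ = τ * l * g := by
    refine Units.ext ?_
    rw [Units.val_mul, hconj, Units.val_mul, Units.val_mul, hgval, mul_assoc, mul_add, mul_add,
      mul_one, ← mul_assoc (l : Matrix ι ι F), Units.mul_inv, one_mul, mul_add]
  rw [← Module.End.mul_apply, ← map_mul, hfac, map_mul, map_mul, Module.End.mul_apply,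
    Module.End.mul_apply, h2 g hg, h1 l hll hl]

/-- Jacquet's lemma: the spaces `jacquetFixed ρ A k` are finite dimensional. Linearly independent
vectors are lifted to `V`, translated far into the torus and averaged; the results are linearly
independent vectors fixed by the congruence subgroup of level `k`. -/
theorem finiteDimensional_jacquetFixed (hρ : IsAdmissible ρ) {k : ℕ} (hk : 1 ≤ k) :
    FiniteDimensional ℂ (jacquetFixed ρ A k) := by
  classical
  let I := Representation.invariants (ρ.comp (congrSubgroup F ι k).subtype)
  have hI : FiniteDimensional ℂ I :=
    hρ.finite_fixed _ (isOpen_congrSubgroup k) (isCompact_congrSubgroup k)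
  suffices h : ∀ s : Finset (jacquetFixed ρ A k),
      LinearIndependent ℂ (fun i : s => (i : jacquetFixed ρ A k)) → s.card ≤ Module.finrank ℂ I by
    have h2 : Module.rank ℂ (jacquetFixed ρ A k) ≤ Module.finrank ℂ I := rank_le h
    exact Module.rank_lt_aleph0_iff.1 (h2.trans_lt (Cardinal.natCast_lt_aleph0))
  intro s hs
  choose v hv1 hv2 using fun i : s => exists_fixed_lift hρ (i : jacquetFixed ρ A k).2
  obtain ⟨k', hk', hv3⟩ := hρ.exists_fixed_finset Finset.univ v
  set t : Fˣ := unif F ^ (k' : ℤ) with htdef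
  have ht : nabs (t : F) ≤ radius F k' := by rw [htdef, nabs_unif_zpow]; rfl
  have hfix : ∀ i : s, ∀ p ∈ parabolic F Aᶜ, p ∈ congrSubgroup F ι k →
      ρ p (ρ (leviCentral A t : GL ι F) (v i)) = ρ (leviCentral A t : GL ι F) (v i) :=
    fun i p hp hpk => apply_leviCentral_fixed hk hk' (hv2 i) (hv3 i (Finset.mem_univ i)) ht hp hpk
  have havg : ∀ i : s, ∃ w, (∀ g ∈ congrSubgroup F ι k, ρ g w = w) ∧
      w - ρ (leviCentral A t : GL ι F) (v i) ∈ jacquetKer ρ A := by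
    intro i
    refine exists_fixed_of_finite_orbit ρ _ _ (hρ.finite_orbit _ le_rfl) _ fun g hg => ?_
    obtain ⟨u, hu, p, hp, hpk, rfl⟩ := exists_unipotent_mul_opposite (A := A) hk hg
    rw [map_mul, Module.End.mul_apply, hfix i p hp hpk]
    exact Submodule.subset_span ⟨u, hu, _, rfl⟩
  choose w hw1 hw2 using havg
  let W : s → I := fun i => ⟨w i, fun g => hw1 i g g.2⟩
  have hWli : LinearIndependent ℂ W := by
    have hx : LinearIndependent ℂ (fun i : s => ((i : jacquetFixed ρ A k) : JacquetModule ρ A)) :=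
      hs.map' (Submodule.subtype _) (Submodule.ker_subtype _)
    have hinj : LinearMap.ker (jacquetRep ρ A (leviCentral A t)) = ⊥ := by
      rw [LinearMap.ker_eq_bot]
      intro x y hxy
      have := congrArg (jacquetRep ρ A (leviCentral A t)⁻¹) hxy
      simpa [← Module.End.mul_apply, ← map_mul] using this
    have hx' := hx.map' _ hinj
    refine LinearIndependent.of_comp ((jacquetKer ρ A).mkQ ∘ₗ I.subtype) ?_
    convert! hx' using 1
    funext i
    change (Submodule.Quotient.mk (w i) : JacquetModule ρ A) =
      jacquetRep ρ A (leviCentral A t) ((i : jacquetFixed ρ A k) : JacquetModule ρ A)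
    rw [← hv1 i, jacquetRep_mk]
    exact (Submodule.Quotient.eq _).2 (hw2 i)
  have := hWli.fintype_card_le_finrank
  simpa using this

/-- A representation of finite length is generated by finitely many vectors. -/
theorem exists_finset_span_orbit {G W : Type*} [Group G] [AddCommGroup W] [Module ℂ W]
    (σ : Representation ℂ G W) (hlen : IsFiniteLength ℂ[G] σ.asModule) :
    ∃ S : Finset W, Submodule.span ℂ {x | ∃ g, ∃ s ∈ S, x = σ g s} = ⊤ := by
  have hN : IsNoetherian ℂ[G] σ.asModule :=
    (isFiniteLength_iff_isNoetherian_isArtinian.1 hlen).1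
  obtain ⟨S, hS⟩ := hN.noetherian ⊤
  let S' : Finset W := S
  let T : Subrepresentation σ := {
    toSubmodule := Submodule.span ℂ {x | ∃ g, ∃ s ∈ S', x = σ g s}
    apply_mem_toSubmodule := fun g x hx => by
      have hle : Submodule.span ℂ {x | ∃ g, ∃ s ∈ S', x = σ g s} ≤
          (Submodule.span ℂ {x | ∃ g, ∃ s ∈ S', x = σ g s}).comap (σ g) := by
        refine Submodule.span_le.2 ?_
        rintro _ ⟨h, s, hs, rfl⟩
        refine Submodule.subset_span ⟨g * h, s, hs, ?_⟩
        rw [map_mul, Module.End.mul_apply]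
      exact hle hx }
  have hT : T.asSubmodule = ⊤ := by
    rw [eq_top_iff, ← hS, Submodule.span_le]
    intro s hs
    have hs' : (s : W) ∈ Submodule.span ℂ {x : W | ∃ g, ∃ s ∈ S', x = σ g s} :=
      Submodule.subset_span ⟨1, s, hs, by rw [map_one]; rfl⟩
    exact hs'
  refine ⟨S', ?_⟩
  rw [eq_top_iff]
  intro x _
  have : (x : σ.asModule) ∈ T.asSubmodule := by rw [hT]; trivial
  exact this

/-- The Jacquet module is generated over the Levi subgroup by one of the spaces
`jacquetFixed ρ A k`. -/
theorem exists_span_jacquetFixed (hρ : IsAdmissible ρ)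
    (hlen : IsFiniteLength ℂ[GL ι F] ρ.asModule) :
    ∃ k : ℕ, 1 ≤ k ∧ Submodule.span ℂ
      {y | ∃ l, ∃ x ∈ jacquetFixed ρ A k, y = jacquetRep ρ A l x} = ⊤ := by
  classical
  obtain ⟨S, hS⟩ := exists_finset_span_orbit ρ hlen
  have hfin : (⋃ s ∈ S, (fun g => ρ g s) '' (congrSubgroup F ι 0 : Set (GL ι F))).Finite :=
    S.finite_toSet.biUnion fun s _ => hρ.finite_orbit s le_rfl
  obtain ⟨k, hk, hfix⟩ := hρ.exists_fixed_finset hfin.toFinset id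
  refine ⟨k, hk, ?_⟩
  set T := Submodule.span ℂ {y | ∃ l, ∃ x ∈ jacquetFixed ρ A k, y = jacquetRep ρ A l x} with hT
  suffices h : (⊤ : Submodule ℂ V) ≤ T.comap (jacquetKer ρ A).mkQ by
    rw [eq_top_iff]
    intro x _
    obtain ⟨v, rfl⟩ := Submodule.Quotient.mk_surjective _ x
    exact h trivial
  rw [← hS, Submodule.span_le]
  rintro _ ⟨g, s, hs, rfl⟩
  obtain ⟨p, hp, κ, hκ, rfl⟩ := exists_parabolic_mul_congrSubgroup A g
  obtain ⟨u, hu, l, hl, rfl⟩ := exists_unipotent_mul_levi hp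
  change (Submodule.Quotient.mk _ : JacquetModule ρ A) ∈ T
  rw [mul_assoc, map_mul, Module.End.mul_apply, mk_apply_unipotent hu, map_mul,
    Module.End.mul_apply]
  refine Submodule.subset_span ⟨⟨l, hl⟩, Submodule.Quotient.mk (ρ κ s), ?_, rfl⟩
  refine mk_mem_jacquetFixed fun g hg => hfix _ ?_ g hg
  simp only [Set.Finite.mem_toFinset, Set.mem_iUnion]
  exact ⟨s, hs, κ, hκ, rfl⟩

end JacquetFinite

/-! ### Representations of commutative groups -/

section CommGroupRep

variable {T E : Type*} [CommGroup T] [AddCommGroup E] [Module ℂ E] (A : Representation ℂ T E)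

/-- The characters `χ` of the group such that `A` has a nonzero `χ`-eigenvector. -/
def eigenCharacters : Set (T →* ℂˣ) :=
  {χ | ∃ x : E, x ≠ 0 ∧ ∀ t, A t x = (χ t : ℂ) • x}

theorem commute_apply (s t : T) : Commute (A s) (A t) := by
  rw [Commute, SemiconjBy, ← map_mul, ← map_mul, mul_comm]

/-- The simultaneous generalized eigenspaces. -/
noncomputable def genEig (χ : T → ℂ) : Submodule ℂ E := ⨅ t, Module.End.maxGenEigenspace (A t) (χ t)

variable {A}

theorem exists_pow_apply_eq_zero {χ : T → ℂ} {x : E} (hx : x ∈ genEig A χ) (t : T) :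
    ∃ k : ℕ, ((A t - χ t • (1 : Module.End ℂ E)) ^ k) x = 0 :=
  (Module.End.mem_iInf_maxGenEigenspace_iff _ _ _).1 hx t

theorem apply_mem_genEig_of_commute {B : Module.End ℂ E} (hB : ∀ t, Commute (A t) B) {χ : T → ℂ}
    {x : E} (hx : x ∈ genEig A χ) : B x ∈ genEig A χ := by
  rw [genEig, Submodule.mem_iInf] at hx ⊢
  exact fun t => Module.End.mapsTo_maxGenEigenspace_of_comm (hB t) _ (hx t)

theorem apply_mem_genEig {χ : T → ℂ} {x : E} (hx : x ∈ genEig A χ) (s : T) :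
    A s x ∈ genEig A χ := apply_mem_genEig_of_commute (fun t => commute_apply A t s) hx

variable (A) in
theorem iSupIndep_genEig : iSupIndep (genEig A) :=
  Module.End.independent_iInf_maxGenEigenspace_of_forall_mapsTo _ fun _ _ _ =>
    Module.End.mapsTo_maxGenEigenspace_of_comm (commute_apply A _ _) _

variable (A) in
theorem iSup_genEig_eq_top [FiniteDimensional ℂ E] : ⨆ χ, genEig A χ = ⊤ :=
  Module.End.iSup_iInf_maxGenEigenspace_eq_top_of_forall_mapsTo _
    (fun _ _ _ => Module.End.mapsTo_maxGenEigenspace_of_comm (commute_apply A _ _) _)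
    fun t => Module.End.iSup_maxGenEigenspace_eq_top (A t)

theorem sub_pow_apply_of_eigen {B : Module.End ℂ E} {μ c : ℂ} {x : E} (hx : B x = μ • x) (k : ℕ) :
    ((B - c • (1 : Module.End ℂ E)) ^ k) x = (μ - c) ^ k • x := by
  induction k with
  | zero => simp
  | succ k ih =>
    rw [pow_succ, Module.End.mul_apply, LinearMap.sub_apply, hx, LinearMap.smul_apply,
      Module.End.one_apply, ← sub_smul, map_smul, ih, smul_smul, pow_succ, mul_comm]

/-- A nonzero stable finite dimensional subspace contains a simultaneous eigenvector: all operators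
are scalars on a nonzero stable subspace of minimal dimension. -/
theorem exists_eigenvector_mem [FiniteDimensional ℂ E] (N : Submodule ℂ E) (hN : N ≠ ⊥)
    (hstab : ∀ t, ∀ x ∈ N, A t x ∈ N) :
    ∃ χ : T →* ℂˣ, ∃ x ∈ N, x ≠ 0 ∧ ∀ t, A t x = (χ t : ℂ) • x := by
  let S : Set (Submodule ℂ E) := {N' | N' ≤ N ∧ N' ≠ ⊥ ∧ ∀ t, ∀ x ∈ N', A t x ∈ N'}
  obtain ⟨M, ⟨hMN, hM0, hMs⟩, hMmin⟩ :=
    WellFounded.has_min (wellFounded_lt : WellFounded ((· < ·) : Submodule ℂ E → _ → Prop)) S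
      ⟨N, le_rfl, hN, hstab⟩
  have hscalar : ∀ t, ∃ μ : ℂ, ∀ x ∈ M, A t x = μ • x := by
    intro t
    have : Nontrivial M := Submodule.nontrivial_iff_ne_bot.2 hM0
    obtain ⟨μ, hμ⟩ := Module.End.exists_eigenvalue ((A t).restrict (hMs t))
    obtain ⟨x, hx⟩ := hμ.exists_hasEigenvector
    refine ⟨μ, ?_⟩
    have hmem : M ⊓ Module.End.eigenspace (A t) μ ∈ S := by
      refine ⟨inf_le_left.trans hMN, ?_, fun s y hy => ⟨hMs s y hy.1, ?_⟩⟩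
      · rw [Submodule.ne_bot_iff]
        refine ⟨x, ⟨x.2, ?_⟩, fun h => hx.2 (Subtype.ext h)⟩
        rw [SetLike.mem_coe, Module.End.mem_eigenspace_iff]
        exact congrArg Subtype.val hx.apply_eq_smul
      · have hy2 := Module.End.mem_eigenspace_iff.1 hy.2
        rw [SetLike.mem_coe, Module.End.mem_eigenspace_iff, ← Module.End.mul_apply,
          (commute_apply A t s).eq, Module.End.mul_apply, hy2, map_smul]
    have hnot := hMmin _ hmem
    have heq : M ⊓ Module.End.eigenspace (A t) μ = M := by
      by_contra hne
      exact hnot (lt_of_le_of_ne inf_le_left hne)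
    intro y hy
    rw [← heq] at hy
    exact Module.End.mem_eigenspace_iff.1 hy.2
  choose μ hμ using hscalar
  obtain ⟨x, hxM, hx0⟩ := (Submodule.ne_bot_iff _).1 hM0
  have hinj : Function.Injective fun c : ℂ => c • x := smul_left_injective ℂ hx0
  have h1 : μ 1 = 1 := hinj (by
    change μ 1 • x = (1 : ℂ) • x
    rw [← hμ 1 x hxM]; simp)
  have hmul : ∀ s t, μ (s * t) = μ s * μ t := fun s t => hinj (by
    change μ (s * t) • x = (μ s * μ t) • x
    rw [← hμ _ x hxM, map_mul, Module.End.mul_apply, hμ t x hxM, map_smul, hμ s x hxM, smul_smul,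
      mul_comm])
  let χ₀ : T →* ℂ := { toFun := μ, map_one' := h1, map_mul' := hmul }
  exact ⟨χ₀.toHomUnits, x, hMN hxM, hx0, fun t => hμ t x hxM⟩

theorem exists_eigenCharacter_of_genEig_ne_bot [FiniteDimensional ℂ E] {χ : T → ℂ}
    (h : genEig A χ ≠ ⊥) : ∃ χ' ∈ eigenCharacters A, ∀ t, ((χ' t : ℂˣ) : ℂ) = χ t := by
  obtain ⟨χ', x, hx, hx0, hχ'⟩ := exists_eigenvector_mem (A := A) (genEig A χ) h
    fun t x hx => apply_mem_genEig hx t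
  refine ⟨χ', ⟨x, hx0, hχ'⟩, fun t => ?_⟩
  obtain ⟨k, hk⟩ := exists_pow_apply_eq_zero hx t
  rw [sub_pow_apply_of_eigen (hχ' t)] at hk
  have := (smul_eq_zero.1 hk).resolve_right hx0
  exact sub_eq_zero.1 (eq_zero_of_pow_eq_zero this)

/-- A character by which a commutative group acts on a nonzero quotient of a finite dimensional
representation has an eigenvector in the representation itself. -/
theorem mem_eigenCharacters_of_quotient [FiniteDimensional ℂ E] (B : Submodule ℂ E) (hB : B ≠ ⊤)
    (χ : T →* ℂˣ) (hact : ∀ t y, A t y - (χ t : ℂ) • y ∈ B) : χ ∈ eigenCharacters A := by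
  obtain ⟨ψ, hψ⟩ : ∃ ψ, ¬ genEig A ψ ≤ B := by
    by_contra hcon
    push Not at hcon
    have h1 : ⨆ ψ, genEig A ψ ≤ B := iSup_le hcon
    rw [iSup_genEig_eq_top] at h1
    exact hB (top_le_iff.1 h1)
  obtain ⟨y, hy, hyB⟩ := SetLike.not_le_iff_exists.1 hψ
  have hψχ : ∀ t, ψ t = χ t := by
    intro t
    obtain ⟨n, hn⟩ := exists_pow_apply_eq_zero hy t
    have hpow : ∀ n : ℕ, ((A t - ψ t • (1 : Module.End ℂ E)) ^ n) y -
        ((χ t : ℂ) - ψ t) ^ n • y ∈ B := by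
      intro n
      induction n with
      | zero => simp
      | succ n ih =>
        set z := ((A t - ψ t • (1 : Module.End ℂ E)) ^ n) y with hz
        have h2 : ((A t - ψ t • (1 : Module.End ℂ E)) ^ (n + 1)) y - ((χ t : ℂ) - ψ t) ^ (n + 1) • y
            = (A t z - (χ t : ℂ) • z) + ((χ t : ℂ) - ψ t) • (z - ((χ t : ℂ) - ψ t) ^ n • y) := by
          rw [pow_succ', Module.End.mul_apply, ← hz, LinearMap.sub_apply, LinearMap.smul_apply,
            Module.End.one_apply, smul_sub, smul_smul, pow_succ', sub_smul]
          abel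
        rw [h2]
        exact add_mem (hact t z) (B.smul_mem _ ih)
    have h1 := hpow n
    rw [hn, zero_sub, neg_mem_iff] at h1
    by_contra hne
    have hc : ((χ t : ℂ) - ψ t) ^ n ≠ 0 := pow_ne_zero _ (sub_ne_zero.2 (Ne.symm hne))
    exact hyB ((B.smul_mem_iff hc).1 h1)
  have hne : genEig A ψ ≠ ⊥ := by
    rw [Submodule.ne_bot_iff]
    refine ⟨y, hy, ?_⟩
    rintro rfl
    exact hyB (zero_mem _)
  obtain ⟨χ', hmem, hχ'⟩ := exists_eigenCharacter_of_genEig_ne_bot hne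
  have : χ' = χ := MonoidHom.ext fun t => Units.ext ((hχ' t).trans (hψχ t))
  rwa [← this]

end CommGroupRep

/-! ### Characters of the central torus on a Jacquet module -/

section Exponents

variable {G W : Type*} [Group G] [AddCommGroup W] [Module ℂ W] {σ : Representation ℂ G W}

/-- Every nonzero vector `x` has nonzero image in an irreducible subquotient of the
subrepresentation it generates. -/
theorem exists_irreducible_subquotient {x : W} (hx : x ≠ 0) :
    ∃ B C : Subrepresentation σ, (subquotient B C).IsIrreducible ∧
      C.toSubmodule = Submodule.span ℂ (Set.range fun g => σ g x) := by
  obtain ⟨B, -, hB⟩ := zorn_le_nonempty₀ {B : Subrepresentation σ | x ∉ B.toSubmodule} (by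
    intro c hc hchain y hy
    have hne : (Subrepresentation.toSubmodule '' c).Nonempty := ⟨_, y, hy, rfl⟩
    have hdir : DirectedOn (· ≤ ·) (Subrepresentation.toSubmodule '' c) := by
      refine IsChain.directedOn ?_
      rintro _ ⟨a, ha, rfl⟩ _ ⟨b, hb, rfl⟩ hab
      exact hchain ha hb fun h => hab (by rw [h])
    refine ⟨⟨sSup (Subrepresentation.toSubmodule '' c), fun g v hv => ?_⟩, ?_, fun z hz => ?_⟩
    · rw [Submodule.mem_sSup_of_directed hne hdir] at hv ⊢
      obtain ⟨_, ⟨a, ha, rfl⟩, hva⟩ := hv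
      exact ⟨_, ⟨a, ha, rfl⟩, a.apply_mem_toSubmodule g hva⟩
    · change x ∉ sSup (Subrepresentation.toSubmodule '' c)
      rw [Submodule.mem_sSup_of_directed hne hdir]
      rintro ⟨_, ⟨a, ha, rfl⟩, hxa⟩
      exact hc ha hxa
    · exact fun v hv => (Submodule.mem_sSup_of_directed hne hdir).2 ⟨_, ⟨z, hz, rfl⟩, hv⟩)
    ⟨⊥, fun g v hv => by simpa using congrArg (σ g) ((Submodule.mem_bot ℂ).1 hv)⟩
    (fun h => hx ((Submodule.mem_bot ℂ).1 h))
  let C : Subrepresentation σ := {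
    toSubmodule := Submodule.span ℂ (Set.range fun g => σ g x)
    apply_mem_toSubmodule := fun g v hv => by
      have hle : Submodule.span ℂ (Set.range fun g => σ g x) ≤
          (Submodule.span ℂ (Set.range fun g => σ g x)).comap (σ g) := by
        rw [Submodule.span_le]
        rintro _ ⟨h, rfl⟩
        refine Submodule.subset_span ⟨g * h, ?_⟩
        change σ (g * h) x = _
        rw [map_mul, Module.End.mul_apply]
      exact hle hv }
  have hxC : x ∈ C.toSubmodule := Submodule.subset_span ⟨1, by simp⟩
  have hCle : ∀ D : Subrepresentation σ, x ∈ D.toSubmodule → C.toSubmodule ≤ D.toSubmodule := by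
    intro D hD
    rw [Submodule.span_le]
    rintro _ ⟨g, rfl⟩
    exact D.apply_mem_toSubmodule g hD
  have hxB : x ∉ B.toSubmodule := hB.prop
  refine ⟨B, C, ?_, rfl⟩
  set τ := subquotient B C with hτ
  let π := (B.toSubmodule.comap C.toSubmodule.subtype).mkQ
  have hπ : ∀ y : C.toSubmodule, π y = 0 ↔ (y : W) ∈ B.toSubmodule := fun y =>
    (Submodule.Quotient.mk_eq_zero _).trans Iff.rfl
  have hτπ : ∀ g (y : C.toSubmodule), τ g (π y) = π (C.toRepresentation g y) := fun _ _ => rfl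
  refine { exists_pair_ne := ⟨⊥, ⊤, fun h => hxB ?_⟩, eq_bot_or_eq_top := fun D => ?_ }
  · have h1 : π ⟨x, hxC⟩ ∈ (⊤ : Subrepresentation τ).toSubmodule := Submodule.mem_top
    rw [← h] at h1
    exact (hπ ⟨x, hxC⟩).1 ((Submodule.mem_bot ℂ).1 h1)
  let D' : Subrepresentation σ := {
    toSubmodule := (D.toSubmodule.comap π).map C.toSubmodule.subtype
    apply_mem_toSubmodule := by
      rintro g _ ⟨y, hy, rfl⟩
      refine ⟨C.toRepresentation g y, ?_, rfl⟩
      change π _ ∈ D.toSubmodule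
      rw [← hτπ]
      exact D.apply_mem_toSubmodule g hy }
  have hD' : ∀ y : C.toSubmodule, (y : W) ∈ D'.toSubmodule → π y ∈ D.toSubmodule := by
    rintro y ⟨z, hz, hzy⟩
    obtain rfl : z = y := Subtype.ext hzy
    exact hz
  by_cases hxD : x ∈ D'.toSubmodule
  · right
    refine Subrepresentation.toSubmodule_injective (eq_top_iff.2 fun z _ => ?_)
    obtain ⟨y, rfl⟩ := Submodule.Quotient.mk_surjective _ z
    exact hD' y (hCle D' hxD y.2)
  · left
    have hnot : x ∉ (B ⊔ D').toSubmodule := by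
      rw [Subrepresentation.toSubmodule_sup, Submodule.mem_sup]
      rintro ⟨b, hb, _, ⟨d, hd, rfl⟩, hbd⟩
      have hbC : b ∈ C.toSubmodule := by
        rw [← eq_sub_iff_add_eq] at hbd
        rw [hbd]
        exact sub_mem hxC d.2
      have h1 : π ⟨x, hxC⟩ = π d := by
        have : (⟨x, hxC⟩ : C.toSubmodule) = ⟨b, hbC⟩ + d := Subtype.ext hbd.symm
        rw [this, map_add, (hπ ⟨b, hbC⟩).2 hb, zero_add]
      exact hxD ⟨⟨x, hxC⟩, by
        change π _ ∈ D.toSubmodule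
        rw [h1]; exact hd, rfl⟩
    have hle : B ⊔ D' ≤ B := hB.le_of_ge hnot le_sup_left
    refine Subrepresentation.toSubmodule_injective (eq_bot_iff.2 fun z hz => ?_)
    obtain ⟨y, rfl⟩ := Submodule.Quotient.mk_surjective _ z
    refine (Submodule.mem_bot ℂ).2 ((hπ y).2 ?_)
    have hyD : (y : W) ∈ D'.toSubmodule := ⟨y, hz, rfl⟩
    exact hle (Submodule.mem_sup_right (S := B.toSubmodule) hyD)

variable {F : Type*} [Field F] [ValuativeRel F] [TopologicalSpace F]
  [IsNonarchimedeanLocalField F] {ι : Type*} [Fintype ι] [DecidableEq ι] {A : Set ι}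
  {V : Type*} [AddCommGroup V] [Module ℂ V] {ρ : Representation ℂ (GL ι F) V}

/-- The action of the central torus on the Jacquet module. -/
noncomputable def torusRep (ρ : Representation ℂ (GL ι F) V) (A : Set ι) :
    Representation ℂ Fˣ (JacquetModule ρ A) :=
  (jacquetRep ρ A).comp (leviCentralHom F A)

omit [ValuativeRel F] [TopologicalSpace F] [IsNonarchimedeanLocalField F] in
theorem torusRep_apply (t : Fˣ) : torusRep ρ A t = jacquetRep ρ A (leviCentral A t) := rfl

omit [ValuativeRel F] [TopologicalSpace F] [IsNonarchimedeanLocalField F] in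
theorem commute_torusRep (t : Fˣ) (l : levi F A) : Commute (torusRep ρ A t) (jacquetRep ρ A l) := by
  rw [torusRep_apply, Commute, SemiconjBy, ← map_mul, ← map_mul, leviCentral_comm]

/-- The action of the central torus on the finite dimensional space `jacquetFixed ρ A k`. -/
noncomputable def torusFixed (ρ : Representation ℂ (GL ι F) V) (A : Set ι) (k : ℕ) :
    Representation ℂ Fˣ (jacquetFixed ρ A k) where
  toFun t := (torusRep ρ A t).restrict fun _ hx => jacquetRep_leviCentral_mem hx t
  map_one' := by ext; simp
  map_mul' s t := LinearMap.ext fun x => Subtype.ext (by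
    change torusRep ρ A (s * t) x = torusRep ρ A s (torusRep ρ A t x)
    rw [map_mul, Module.End.mul_apply])

theorem torusFixed_apply_eq {k : ℕ} (hk : 1 ≤ k) {t : Fˣ} (ht : nabs ((t : F) - 1) ≤ radius F k) :
    torusFixed ρ A k t = 1 := by
  ext x
  exact x.2 _ (leviCentral_mem_congrSubgroup hk ht)

theorem eigenCharacters_torusFixed_subset (k : ℕ) :
    eigenCharacters (torusFixed ρ A k) ⊆ eigenCharacters (torusRep ρ A) := by
  rintro χ ⟨x, hx0, hx⟩
  exact ⟨x, fun h => hx0 (Subtype.ext h), fun t => congrArg Subtype.val (hx t)⟩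

omit [ValuativeRel F] [TopologicalSpace F] [IsNonarchimedeanLocalField F] in
theorem eigenCharacters_subset_centralExponents :
    eigenCharacters (torusRep ρ A) ⊆ centralExponents ρ A := by
  rintro χ ⟨x, hx0, hx⟩
  obtain ⟨B, C, hirr, hC⟩ := exists_irreducible_subquotient (σ := jacquetRep ρ A) hx0
  refine ⟨B, C, hirr, fun t w => ?_⟩
  obtain ⟨y, rfl⟩ := Submodule.Quotient.mk_surjective _ w
  have hy : torusRep ρ A t (y : JacquetModule ρ A) = (χ t : ℂ) • (y : JacquetModule ρ A) := by
    have hle : C.toSubmodule ≤ Module.End.eigenspace (torusRep ρ A t) (χ t : ℂ) := by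
      rw [hC, Submodule.span_le]
      rintro _ ⟨l, rfl⟩
      rw [SetLike.mem_coe, Module.End.mem_eigenspace_iff]
      change torusRep ρ A t (jacquetRep ρ A l x) = _
      rw [← Module.End.mul_apply, (commute_torusRep t l).eq, Module.End.mul_apply, hx t, map_smul]
    exact Module.End.mem_eigenspace_iff.1 (hle y.2)
  have hy' : C.toRepresentation (leviCentral A t) y = (χ t : ℂ) • y := Subtype.ext hy
  change Submodule.Quotient.mk (C.toRepresentation (leviCentral A t) y) = _
  rw [hy', Submodule.Quotient.mk_smul]

/-- A central exponent has an eigenvector in the Jacquet module: a vector of `C` outside `B` lies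
in some `jacquetFixed ρ A k`, and one of its generalized eigencomponents is outside `B`. -/
theorem centralExponents_subset_eigenCharacters (hρ : IsAdmissible ρ) :
    centralExponents ρ A ⊆ eigenCharacters (torusRep ρ A) := by
  rintro χ ⟨B, C, hirr, hχ⟩
  let π := (B.toSubmodule.comap C.toSubmodule.subtype).mkQ
  have hπ : ∀ y : C.toSubmodule, π y = 0 ↔ (y : JacquetModule ρ A) ∈ B.toSubmodule := fun y =>
    (Submodule.Quotient.mk_eq_zero _).trans Iff.rfl
  obtain ⟨x, hxC, hxB⟩ : ∃ x ∈ C.toSubmodule, x ∉ B.toSubmodule := by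
    by_contra hcon
    push Not at hcon
    obtain ⟨D, D', hDD⟩ := hirr.exists_pair_ne
    have hsub : ∀ z : C.toSubmodule ⧸ B.toSubmodule.comap C.toSubmodule.subtype, z = 0 := by
      intro z
      obtain ⟨y, rfl⟩ := Submodule.Quotient.mk_surjective _ z
      exact (hπ y).2 (hcon y y.2)
    refine hDD (Subrepresentation.toSubmodule_injective (Submodule.ext fun z => ?_))
    rw [hsub z]
    exact ⟨fun _ => zero_mem _, fun _ => zero_mem _⟩
  have hact : ∀ t, ∀ y ∈ C.toSubmodule,
      torusRep ρ A t y - (χ t : ℂ) • y ∈ B.toSubmodule := by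
    intro t y hy
    have h1 := hχ t (π ⟨y, hy⟩)
    have h2 : π (C.toRepresentation (leviCentral A t) ⟨y, hy⟩ - (χ t : ℂ) • ⟨y, hy⟩) = 0 := by
      rw [map_sub, map_smul, sub_eq_zero]
      exact h1
    exact (hπ _).1 h2
  obtain ⟨v, rfl⟩ := Submodule.Quotient.mk_surjective _ x
  obtain ⟨k, hk, hfix⟩ := hρ.exists_fixed v
  have hfin := finiteDimensional_jacquetFixed (A := A) hρ hk
  let E := (C.toSubmodule).comap (jacquetFixed ρ A k).subtype
  let τ : Representation ℂ Fˣ E := {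
    toFun := fun t => (torusFixed ρ A k t).restrict fun y hy =>
      C.apply_mem_toSubmodule (leviCentral A t) hy
    map_one' := by ext; simp
    map_mul' := fun s t => LinearMap.ext fun x => Subtype.ext (by
      change torusFixed ρ A k (s * t) x = torusFixed ρ A k s (torusFixed ρ A k t x)
      rw [map_mul, Module.End.mul_apply]) }
  have hτ : ∀ t (y : E), ((τ t y : jacquetFixed ρ A k) : JacquetModule ρ A) =
      torusRep ρ A t (y : jacquetFixed ρ A k) := fun _ _ => rfl
  let x₀ : E := ⟨⟨Submodule.Quotient.mk v, mk_mem_jacquetFixed hfix⟩, hxC⟩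
  let BE : Submodule ℂ E := B.toSubmodule.comap ((jacquetFixed ρ A k).subtype ∘ₗ E.subtype)
  have hBE : BE ≠ ⊤ := by
    intro h
    have : x₀ ∈ BE := by rw [h]; trivial
    exact hxB this
  obtain ⟨z, hz0, hz⟩ := mem_eigenCharacters_of_quotient (A := τ) BE hBE χ
    fun t (y : E) => hact t _ y.2
  refine ⟨(z : jacquetFixed ρ A k), fun h => hz0 (Subtype.ext (Subtype.ext h)), fun t => ?_⟩
  rw [← hτ, hz t]
  rfl

/-- There are finitely many central exponents: the Jacquet module is the sum of its generalized
eigenspaces for the characters occurring in a finite dimensional generating subspace. -/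
theorem finite_centralExponents (hρ : IsAdmissible ρ)
    (hlen : IsFiniteLength ℂ[GL ι F] ρ.asModule) : (centralExponents ρ A).Finite := by
  obtain ⟨k, hk, hspan⟩ := exists_span_jacquetFixed (A := A) hρ hlen
  have hfin := finiteDimensional_jacquetFixed (A := A) hρ hk
  -- the characters occurring in a finite dimensional subspace that generates the Jacquet module
  let Ξ : Set (Fˣ → ℂ) := {χ | genEig (torusFixed ρ A k) χ ≠ ⊥}
  have hΞ : Ξ.Finite := WellFoundedGT.finite_ne_bot_of_iSupIndep (iSupIndep_genEig _)
  have hmap : ∀ χ, ∀ x ∈ genEig (torusFixed ρ A k) χ,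
      (x : JacquetModule ρ A) ∈ genEig (torusRep ρ A) χ := by
    intro χ x hx
    rw [genEig, Module.End.mem_iInf_maxGenEigenspace_iff] at hx ⊢
    intro t
    obtain ⟨n, hn⟩ := hx t
    refine ⟨n, ?_⟩
    have hcoe : ∀ n : ℕ,
        ((((torusFixed ρ A k t - χ t • (1 : Module.End ℂ (jacquetFixed ρ A k))) ^ n :
          Module.End ℂ (jacquetFixed ρ A k)) x : jacquetFixed ρ A k) : JacquetModule ρ A) =
        ((torusRep ρ A t - χ t • (1 : Module.End ℂ (JacquetModule ρ A))) ^ n :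
          Module.End ℂ (JacquetModule ρ A)) x := by
      intro n
      induction n with
      | zero => simp
      | succ n ih =>
        rw [pow_succ', pow_succ', Module.End.mul_apply, Module.End.mul_apply, ← ih]
        rfl
    have h1 := hcoe n
    rw [hn] at h1
    exact h1.symm
  have htop : ⨆ χ ∈ Ξ, genEig (torusRep ρ A) χ = ⊤ := by
    rw [eq_top_iff, ← hspan, Submodule.span_le]
    rintro _ ⟨l, x, hx, rfl⟩
    have hstab : (⨆ χ ∈ Ξ, genEig (torusRep ρ A) χ) ≤
        (⨆ χ ∈ Ξ, genEig (torusRep ρ A) χ).comap (jacquetRep ρ A l) := by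
      refine iSup₂_le fun χ hχ y hy => ?_
      exact Submodule.mem_iSup_of_mem χ (Submodule.mem_iSup_of_mem hχ
        (apply_mem_genEig_of_commute (fun t => commute_torusRep t l) hy))
    refine hstab ?_
    have h1 : ⨆ χ, genEig (torusFixed ρ A k) χ ≤
        (⨆ χ ∈ Ξ, genEig (torusRep ρ A) χ).comap (jacquetFixed ρ A k).subtype := by
      refine iSup_le fun χ y hy => ?_
      by_cases hχ : χ ∈ Ξ
      · exact Submodule.mem_iSup_of_mem χ (Submodule.mem_iSup_of_mem hχ (hmap χ y hy))
      · have hbot : genEig (torusFixed ρ A k) χ = ⊥ := not_not.1 hχ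
        rw [hbot, Submodule.mem_bot] at hy
        rw [hy]
        exact zero_mem _
    rw [iSup_genEig_eq_top] at h1
    exact h1 (Submodule.mem_top (x := ⟨x, hx⟩))
  refine Set.Finite.of_finite_image (f := fun χ : Fˣ →* ℂˣ => fun t => ((χ t : ℂˣ) : ℂ))
    (hΞ.subset ?_) fun χ _ χ' _ h => MonoidHom.ext fun t => Units.ext (congrFun h t)
  rintro _ ⟨χ, hχ, rfl⟩
  -- an eigenvector for another character would be independent of the whole module
  obtain ⟨x, hx0, hx⟩ := centralExponents_subset_eigenCharacters hρ hχ
  by_contra hnot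
  have hxmem : x ∈ genEig (torusRep ρ A) fun t => ((χ t : ℂˣ) : ℂ) := by
    rw [genEig, Module.End.mem_iInf_maxGenEigenspace_iff]
    intro t
    refine ⟨1, ?_⟩
    rw [sub_pow_apply_of_eigen (hx t), sub_self, pow_one, zero_smul]
  have hdisj := iSupIndep_genEig (torusRep ρ A) fun t => ((χ t : ℂˣ) : ℂ)
  have hle : ⨆ ψ ∈ Ξ, genEig (torusRep ρ A) ψ ≤
      ⨆ ψ, ⨆ (_ : ψ ≠ fun t => ((χ t : ℂˣ) : ℂ)), genEig (torusRep ρ A) ψ := by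
    refine iSup₂_le fun ψ hψ => le_iSup₂_of_le ψ ?_ le_rfl
    rintro rfl
    exact hnot hψ
  rw [htop, top_le_iff] at hle
  rw [hle, disjoint_top] at hdisj
  rw [hdisj, Submodule.mem_bot] at hxmem
  exact hx0 hxmem

end Exponents

/-! ### Matrix coefficients of finite dimensional representations of the multiplicative group -/

section Expansion

variable {F : Type*} [Field F] [ValuativeRel F] [TopologicalSpace F]
  [IsNonarchimedeanLocalField F]

theorem exists_finite_cover (k : ℕ) :
    ∃ S : Finset F, ∀ x : F, nabs x ≤ 1 → ∃ s ∈ S, nabs (x - s) ≤ radius F k := by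
  have hc := isCompact_nabs_le (F := F) 0
  obtain ⟨S, -, hS⟩ := hc.elim_nhds_subcover (fun s => {x | nabs (x - s) ≤ radius F k})
    fun s _ => (isOpen_nabs_sub_le s (radius_pos F k)).mem_nhds (by
      simpa using (radius_pos F k).le)
  refine ⟨S, fun x hx => ?_⟩
  have := hS (show x ∈ {x : F | nabs x ≤ resCard F ^ (0 : ℤ)} by simpa using hx)
  simpa using this

/-- Some positive power of a unit is congruent to `1` modulo a given power of the maximal ideal. -/
theorem exists_pow_sub_one_le {u : Fˣ} (hu : nabs (u : F) = 1) (k : ℕ) :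
    ∃ n : ℕ, 0 < n ∧ nabs (((u ^ n : Fˣ) : F) - 1) ≤ radius F k := by
  have hpow : ∀ n : ℕ, nabs ((u ^ n : Fˣ) : F) = 1 := fun n => by
    rw [Units.val_pow_eq_pow_val]
    have : nabs ((u : F) ^ n) = nabs (u : F) ^ n := map_pow nabsHom _ n
    rw [this, hu, one_pow]
  obtain ⟨S, hS⟩ := exists_finite_cover (F := F) k
  choose f hf hf' using fun n : ℕ => hS ((u ^ n : Fˣ) : F) (hpow n).le
  obtain ⟨i, j, hij, heq⟩ := Finite.exists_ne_map_eq_of_infinite fun n => (⟨f n, hf n⟩ : S)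
  wlog hlt : i < j generalizing i j
  · exact this j i hij.symm heq.symm (lt_of_le_of_ne (not_lt.1 hlt) hij.symm)
  refine ⟨j - i, by omega, ?_⟩
  have hfe : f i = f j := congrArg Subtype.val heq
  have h1 : nabs (((u ^ j : Fˣ) : F) - ((u ^ i : Fˣ) : F)) ≤ radius F k := by
    have := nabs_sub_le (hf' j) (hf' i)
    rwa [hfe, sub_sub_sub_cancel_right] at this
  have h2 : ((u ^ j : Fˣ) : F) - ((u ^ i : Fˣ) : F) =
      ((u ^ i : Fˣ) : F) * (((u ^ (j - i) : Fˣ) : F) - 1) := by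
    rw [mul_sub, mul_one, ← Units.val_mul, ← pow_add, Nat.add_sub_cancel' hlt.le]
  rwa [h2, nabs_mul, hpow i, one_mul] at h1

variable {E : Type*} [AddCommGroup E] [Module ℂ E] {A : Representation ℂ Fˣ E}

/-- Units act on generalized eigenspaces of a smooth representation by scalars, because they act
through operators of finite order. -/
theorem apply_unit_of_mem_genEig [FiniteDimensional ℂ E] {k : ℕ}
    (hk : ∀ t : Fˣ, nabs ((t : F) - 1) ≤ radius F k → A t = 1) {χ : Fˣ → ℂ} {w : E}
    (hw : w ∈ genEig A χ) {u : Fˣ} (hu : nabs (u : F) = 1) : A u w = χ u • w := by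
  obtain ⟨n, hn, hle⟩ := exists_pow_sub_one_le hu k
  have h1 : (A u) ^ n = 1 := by rw [← map_pow]; exact hk _ hle
  have hss : Module.End.IsSemisimple (A u) := by
    refine Module.End.isSemisimple_of_squarefree_aeval_eq_zero
      (p := Polynomial.X ^ n - Polynomial.C (1 : ℂ)) ?_ (by simpa using sub_eq_zero.2 h1)
    exact (Polynomial.separable_X_pow_sub_C (1 : ℂ) (by exact_mod_cast hn.ne')
      one_ne_zero).squarefree
  have hmem : w ∈ Module.End.maxGenEigenspace (A u) (χ u) := by
    rw [genEig, Submodule.mem_iInf] at hw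
    exact hw u
  rw [hss.isFinitelySemisimple.maxGenEigenspace_eq_eigenspace] at hmem
  exact Module.End.mem_eigenspace_iff.1 hmem

/-- The function `t ↦ χ t * (val t) ^ n`. -/
noncomputable def charValPow (χ : Fˣ →* ℂˣ) (n : ℕ) (t : Fˣ) : ℂ :=
  (χ t : ℂ) * (val (t : F) : ℂ) ^ n

/-- On the ring of integers, the matrix coefficients of a smooth finite dimensional representation
of the multiplicative group are combinations of the functions `charValPow χ n`, with `χ` running
over the characters that have an eigenvector. -/
theorem exists_matrixCoeff_eq [FiniteDimensional ℂ E] {k : ℕ}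
    (hk : ∀ t : Fˣ, nabs ((t : F) - 1) ≤ radius F k → A t = 1) (l : E →ₗ[ℂ] ℂ) (w : E) :
    ∃ f ∈ Submodule.span ℂ {h : Fˣ → ℂ | ∃ χ ∈ eigenCharacters A, ∃ n : ℕ, h = charValPow χ n},
      ∀ t : Fˣ, nabs (t : F) ≤ 1 → l (A t w) = f t := by
  have hw : w ∈ ⨆ χ, genEig A χ := by rw [iSup_genEig_eq_top]; trivial
  induction hw using Submodule.iSup_induction' with
  | zero => exact ⟨0, zero_mem _, fun t _ => by simp⟩
  | add x y _ _ hx hy =>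
    obtain ⟨f, hf, hf'⟩ := hx
    obtain ⟨g, hg, hg'⟩ := hy
    exact ⟨f + g, add_mem hf hg, fun t ht => by
      rw [map_add, map_add, hf' t ht, hg' t ht, Pi.add_apply]⟩
  | mem χ x hx =>
    by_cases hx0 : x = 0
    · exact ⟨0, zero_mem _, fun t _ => by simp [hx0]⟩
    have hne : genEig A χ ≠ ⊥ := (Submodule.ne_bot_iff _).2 ⟨x, hx, hx0⟩
    obtain ⟨χ', hχ', hχ⟩ := exists_eigenCharacter_of_genEig_ne_bot hne
    set μ : ℂ := χ (unif F) with hμ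
    have hμ0 : μ ≠ 0 := by rw [hμ, ← hχ]; exact Units.ne_zero _
    obtain ⟨d, hd⟩ := exists_pow_apply_eq_zero hx (unif F)
    set N : Module.End ℂ E := A (unif F) - μ • (1 : Module.End ℂ E) with hN
    have hNd : ∀ j, d ≤ j → (N ^ j) x = 0 := by
      intro j hj
      obtain ⟨e, rfl⟩ := Nat.exists_eq_add_of_le' hj
      rw [pow_add, Module.End.mul_apply, hd, map_zero]
    -- the binomial expansion of `A ϖ ^ n = (μ + N) ^ n`, truncated by nilpotence
    have hbin : ∀ n : ℕ, ((A (unif F)) ^ n) x =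
        ∑ j ∈ Finset.range d, (μ ^ n * ((n.choose j : ℂ) * (μ⁻¹) ^ j)) • (N ^ j) x := by
      intro n
      have hAN : A (unif F) = N + μ • (1 : Module.End ℂ E) := by rw [hN, sub_add_cancel]
      have hcomm : Commute N (μ • (1 : Module.End ℂ E)) := (Commute.one_right N).smul_right μ
      rw [hAN, hcomm.add_pow, LinearMap.sum_apply]
      have hterm : ∀ j ∈ Finset.range (n + 1),
          (N ^ j * (μ • (1 : Module.End ℂ E)) ^ (n - j) * ((n.choose j : ℕ) : Module.End ℂ E)) x =
          (μ ^ n * ((n.choose j : ℂ) * (μ⁻¹) ^ j)) • (N ^ j) x := by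
        intro j hj
        have hjn : j ≤ n := Nat.lt_succ_iff.1 (Finset.mem_range.1 hj)
        have hpow : μ ^ n * (μ⁻¹) ^ j = μ ^ (n - j) := by
          rw [inv_pow, ← div_eq_mul_inv, div_eq_iff (pow_ne_zero _ hμ0), ← pow_add,
            Nat.sub_add_cancel hjn]
        rw [Module.End.mul_apply, Module.End.mul_apply, Module.End.natCast_apply, smul_pow, one_pow,
          LinearMap.smul_apply, Module.End.one_apply, ← Nat.cast_smul_eq_nsmul ℂ, smul_smul,
          map_smul, mul_left_comm, hpow, mul_comm]
      rw [Finset.sum_congr rfl hterm]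
      have hsub1 : Finset.range (n + 1) ⊆ Finset.range (n + 1 + d) := by
        intro j hj; simp only [Finset.mem_range] at *; omega
      have hsub2 : Finset.range d ⊆ Finset.range (n + 1 + d) := by
        intro j hj; simp only [Finset.mem_range] at *; omega
      rw [Finset.sum_subset hsub1, Finset.sum_subset hsub2]
      · intro j _ hj
        rw [hNd j (by simpa using hj), smul_zero]
      · intro j _ hj
        rw [Nat.choose_eq_zero_of_lt (by simpa using hj)]
        simp
    let P : Polynomial ℂ := ∑ j ∈ Finset.range d,
      Polynomial.C (((j.factorial : ℂ))⁻¹ * (μ⁻¹) ^ j * l ((N ^ j) x)) * descPochhammer ℂ j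
    have hP : ∀ n : ℕ, l (((A (unif F)) ^ n) x) = μ ^ n * P.eval (n : ℂ) := by
      intro n
      rw [hbin n, map_sum, Polynomial.eval_finsetSum, Finset.mul_sum]
      refine Finset.sum_congr rfl fun j _ => ?_
      rw [map_smul, smul_eq_mul, Polynomial.eval_mul, Polynomial.eval_C,
        descPochhammer_eval_eq_descFactorial, Nat.descFactorial_eq_factorial_mul_choose]
      have : (j.factorial : ℂ) ≠ 0 := by exact_mod_cast j.factorial_ne_zero
      push_cast
      field_simp
    refine ⟨∑ i ∈ Finset.range (P.natDegree + 1), P.coeff i • charValPow χ' i,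
      Submodule.sum_mem _ fun i _ => Submodule.smul_mem _ _
        (Submodule.subset_span ⟨χ', hχ', i, rfl⟩), fun t ht => ?_⟩
    obtain ⟨n, hn⟩ := Int.eq_ofNat_of_zero_le (nabs_units_le_one_iff.1 ht)
    set u : Fˣ := t / unif F ^ (n : ℤ) with hu
    have hu1 : nabs (u : F) = 1 := by
      rw [nabs_units_eq_one_iff, hu, val_units_div, val_unif_zpow, hn]; simp
    have htu : t = unif F ^ n * u := by
      rw [hu, zpow_natCast]; simp
    have hχt : (χ' t : ℂ) = μ ^ n * χ u := by
      rw [htu, map_mul, map_pow, Units.val_mul, Units.val_pow_eq_pow_val, hχ, hχ]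
    rw [htu, map_mul, Module.End.mul_apply, apply_unit_of_mem_genEig hk hx hu1, map_smul, map_smul,
      map_pow, hP n, ← htu, Finset.sum_apply, Polynomial.eval_eq_sum_range, smul_eq_mul,
      Finset.mul_sum, Finset.mul_sum]
    refine Finset.sum_congr rfl fun i _ => ?_
    rw [Pi.smul_apply, charValPow, hχt, hn, smul_eq_mul]
    push_cast
    ring

end Expansion

/-! ### Functions with finite dimensional slices -/

section Slices

/-- On a finite dimensional space of functions the evaluations span the dual space, so that
functions can be interpolated from their values at finitely many points. -/
theorem exists_interpolation {T : Type*} (B : Submodule ℂ (T → ℂ)) [FiniteDimensional ℂ B] :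
    ∃ (n : ℕ) (p : Fin n → T) (h : Fin n → T → ℂ), (∀ k, h k ∈ B) ∧
      ∀ f ∈ B, ∀ t, f t = ∑ k, f (p k) * h k t := by
  let ev : T → Module.Dual ℂ B := fun t => (LinearMap.proj t : (T → ℂ) →ₗ[ℂ] ℂ) ∘ₗ B.subtype
  have hspan : Submodule.span ℂ (Set.range ev) = ⊤ := by
    by_contra hne
    obtain ⟨φ, hφ0, hφ⟩ := Submodule.exists_dual_map_eq_bot_of_lt_top
      (lt_top_iff_ne_top.2 hne) inferInstance
    obtain ⟨x, rfl⟩ := (Module.evalEquiv ℂ B).surjective φ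
    refine hφ0 ?_
    have hx : x = 0 := by
      refine Subtype.ext (funext fun t => ?_)
      have h1 : Module.evalEquiv ℂ B x (ev t) ∈
          (Submodule.span ℂ (Set.range ev)).map (Module.evalEquiv ℂ B x) :=
        ⟨ev t, Submodule.subset_span ⟨t, rfl⟩, rfl⟩
      rw [hφ, Submodule.mem_bot] at h1
      exact h1
    rw [hx, map_zero]
  obtain ⟨κ, a, -, hsp, hli⟩ := exists_linearIndependent' ℂ ev
  let b := Module.Basis.mk hli (by rw [hsp, hspan])
  have : Finite κ := Module.Finite.finite_basis b
  have : Fintype κ := Fintype.ofFinite κ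
  let e := Fintype.equivFin κ
  let b' := b.reindex e
  refine ⟨Fintype.card κ, fun k => a (e.symm k),
    fun k => ((Module.evalEquiv ℂ B).symm (b'.coord k) : B),
    fun k => Subtype.property _, fun f hf t => ?_⟩
  have hc : ∀ k (ψ : Module.Dual ℂ B),
      ψ ((Module.evalEquiv ℂ B).symm (b'.coord k)) = b'.repr ψ k := by
    intro k ψ
    have h1 : Module.evalEquiv ℂ B ((Module.evalEquiv ℂ B).symm (b'.coord k)) ψ = b'.coord k ψ := by
      rw [LinearEquiv.apply_symm_apply]
    exact h1
  have hrepr := b'.sum_repr (ev t)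
  have h2 := congrArg (fun ψ : Module.Dual ℂ B => ψ ⟨f, hf⟩) hrepr
  simp only [LinearMap.sum_apply, LinearMap.smul_apply] at h2
  change _ = f t at h2
  rw [← h2]
  refine Finset.sum_congr rfl fun k _ => ?_
  rw [← hc k (ev t), smul_eq_mul, mul_comm]
  congr 1
  simp [b', b, ev]

/-- A function of several variables whose slices in the `i`-th variable all lie in a finite
dimensional space `B i` is a combination of products of elements of the spaces `B i`. -/
theorem mem_span_prod_of_slices {T κ : Type*} [Fintype κ] [DecidableEq κ] (f : (κ → T) → ℂ)
    (B : κ → Submodule ℂ (T → ℂ)) [∀ i, FiniteDimensional ℂ (B i)]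
    (hf : ∀ a i, (fun t => f (Function.update a i t)) ∈ B i) :
    f ∈ Submodule.span ℂ {g : (κ → T) → ℂ | ∃ h : κ → T → ℂ, (∀ i, h i ∈ B i) ∧
      g = fun a => ∏ i, h i (a i)} := by
  -- interpolate in one variable after the other; the variables in `s` are already separated
  have key : ∀ s : Finset κ, f ∈ Submodule.span ℂ {g : (κ → T) → ℂ | ∃ h : κ → T → ℂ,
      (∀ i, h i ∈ B i) ∧ ∃ p : κ → T, g = fun a => (∏ i ∈ s, h i (a i)) * f (s.piecewise p a)} := by
    intro s
    induction s using Finset.induction_on with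
    | empty =>
      by_cases hT : Nonempty (κ → T)
      · obtain ⟨p⟩ := hT
        exact Submodule.subset_span ⟨0, fun i => zero_mem _, p, by simp⟩
      · have : f = 0 := funext fun a => absurd ⟨a⟩ hT
        rw [this]
        exact zero_mem _
    | insert i s hi ih =>
      refine Submodule.span_le.2 ?_ ih
      rintro _ ⟨h, hh, p, rfl⟩
      obtain ⟨n, q, e, he, hint⟩ := exists_interpolation (B i)
      have hsum : (fun a => (∏ j ∈ s, h j (a j)) * f (s.piecewise p a)) =
          ∑ k : Fin n, fun a => (∏ j ∈ insert i s, Function.update h i (e k) j (a j)) *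
            f ((insert i s).piecewise (Function.update p i (q k)) a) := by
        funext a
        have h1 := hint _ (hf (s.piecewise p a) i) (a i)
        have h2 : Function.update (s.piecewise p a) i (a i) = s.piecewise p a := by
          rw [Function.update_eq_self_iff, Finset.piecewise_eq_of_notMem _ _ _ hi]
        rw [h2] at h1
        rw [h1, Finset.sum_apply, Finset.mul_sum]
        refine Finset.sum_congr rfl fun k _ => ?_
        rw [Finset.prod_insert hi, Function.update_self, Finset.piecewise_insert,
          Function.update_self]
        have h3 : ∏ j ∈ s, Function.update h i (e k) j (a j) = ∏ j ∈ s, h j (a j) := by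
          refine Finset.prod_congr rfl fun j hj => ?_
          rw [Function.update_of_ne]
          rintro rfl
          exact hi hj
        have h4 : s.piecewise (Function.update p i (q k)) a = s.piecewise p a := by
          refine s.piecewise_congr (fun j hj => ?_) fun _ _ => rfl
          rw [Function.update_of_ne]
          rintro rfl
          exact hi hj
        rw [h3, h4]
        ring
      rw [hsum]
      refine Submodule.sum_mem _ fun k _ => Submodule.subset_span
        ⟨_, fun j => ?_, _, rfl⟩
      by_cases hj : j = i
      · subst hj; rw [Function.update_self]; exact he k
      · rw [Function.update_of_ne hj]; exact hh j
  refine Submodule.span_le.2 ?_ (key Finset.univ)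
  rintro _ ⟨h, hh, p, rfl⟩
  have : (fun a => (∏ i, h i (a i)) * f (Finset.univ.piecewise p a)) =
      f p • fun a : κ → T => ∏ i, h i (a i) := by
    funext a
    rw [Finset.piecewise_univ, Pi.smul_apply, smul_eq_mul, mul_comm]
  rw [this]
  exact Submodule.smul_mem _ _ (Submodule.subset_span ⟨h, hh, rfl⟩)

theorem prod_mem_span_prod {T κ : Type*} [Fintype κ] (S : κ → Set (T → ℂ)) (h : κ → T → ℂ)
    (hh : ∀ i, h i ∈ Submodule.span ℂ (S i)) :
    (fun a : κ → T => ∏ i, h i (a i)) ∈ Submodule.span ℂ {g : (κ → T) → ℂ | ∃ h : κ → T → ℂ,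
      (∀ i, h i ∈ S i) ∧ g = fun a => ∏ i, h i (a i)} := by
  let pull : κ → (T → ℂ) →ₗ[ℂ] ((κ → T) → ℂ) := fun i => LinearMap.funLeft ℂ ℂ fun a => a i
  have h1 : (fun a : κ → T => ∏ i, h i (a i)) = ∏ i, pull i (h i) := by
    funext a
    rw [Finset.prod_apply]
    rfl
  have h2 : ∏ i, pull i (h i) ∈ ∏ i, Submodule.span ℂ (pull i '' S i) := by
    have h3 : ∀ s : Finset κ, ∏ i ∈ s, pull i (h i) ∈
        ∏ i ∈ s, Submodule.span ℂ (pull i '' S i) := by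
      intro s
      classical
      induction s using Finset.induction_on with
      | empty => exact Submodule.one_le.1 le_rfl
      | insert i s hi ih =>
        rw [Finset.prod_insert hi, Finset.prod_insert hi]
        refine Submodule.mul_mem_mul ?_ ih
        rw [← Submodule.map_span]
        exact Submodule.mem_map_of_mem (hh i)
    exact h3 Finset.univ
  rw [h1]
  rw [Submodule.prod_span] at h2
  refine Submodule.span_mono ?_ h2
  intro g hg
  obtain ⟨g', hg', rfl⟩ := (Set.mem_finsetProd _ _ _).1 hg
  choose e he he' using fun i => hg' (Finset.mem_univ i)
  refine ⟨e, he, ?_⟩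
  funext a
  rw [Finset.prod_apply]
  exact Finset.prod_congr rfl fun i _ => by rw [← he' i]; rfl

end Slices

/-! ### Support and vanishing properties of Shalika functions -/

section AdditiveCharacter

/-- The circle has no small subgroups: squaring moves points near `1` away from `1`. -/
theorem circle_eq_one_of_pow_near {z : Circle} (h : ∀ n : ℕ, ‖((z ^ n : Circle) : ℂ) - 1‖ ≤ 1 / 2) :
    z = 1 := by
  by_contra hz
  have hpos : 0 < ‖(z : ℂ) - 1‖ := norm_pos_iff.2 (sub_ne_zero.2 fun h' => hz (by
    apply Circle.ext; simpa using h'))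
  have hgrow : ∀ n : ℕ, (3 / 2 : ℝ) ^ n * ‖(z : ℂ) - 1‖ ≤ ‖((z ^ (2 ^ n) : Circle) : ℂ) - 1‖ := by
    intro n
    induction n with
    | zero => simp
    | succ n ih =>
      set w : ℂ := ((z ^ (2 ^ n) : Circle) : ℂ) with hw
      have h1 : ((z ^ (2 ^ (n + 1)) : Circle) : ℂ) - 1 = (w - 1) * (w + 1) := by
        rw [pow_succ 2 n, pow_mul, Circle.coe_pow]; ring
      have h2 : ‖w - 1‖ ≤ 1 / 2 := h _
      have h3 : (3 / 2 : ℝ) ≤ ‖w + 1‖ := by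
        have h4 : ‖(2 : ℂ)‖ ≤ ‖w + 1‖ + ‖w - 1‖ := by
          have : (2 : ℂ) = (w + 1) - (w - 1) := by ring
          rw [this]; exact norm_sub_le _ _
        rw [Complex.norm_ofNat] at h4
        linarith
      rw [h1, norm_mul, pow_succ]
      calc (3 / 2 : ℝ) ^ n * (3 / 2) * ‖(z : ℂ) - 1‖
          = ((3 / 2 : ℝ) ^ n * ‖(z : ℂ) - 1‖) * (3 / 2) := by ring
        _ ≤ ‖w - 1‖ * ‖w + 1‖ := mul_le_mul ih h3 (by norm_num) (norm_nonneg _)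
  obtain ⟨n, hn⟩ := pow_unbounded_of_one_lt (1 / ‖(z : ℂ) - 1‖) (by norm_num : (1 : ℝ) < 3 / 2)
  rw [div_lt_iff₀ hpos] at hn
  linarith [hgrow n, h (2 ^ n)]

variable {F : Type*} [Field F] [ValuativeRel F] [TopologicalSpace F]
  [IsNonarchimedeanLocalField F]

theorem exists_addChar_trivial {θ : AddChar F Circle} (hθ : Continuous θ) :
    ∃ k : ℕ, ∀ x : F, nabs x ≤ radius F k → θ x = 1 := by
  have hc : Continuous fun x : F => ‖((θ x : Circle) : ℂ) - 1‖ := by fun_prop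
  have hU : {x : F | ‖((θ x : Circle) : ℂ) - 1‖ < 1 / 2} ∈ nhds (0 : F) :=
    (isOpen_lt hc continuous_const).mem_nhds (by simp)
  obtain ⟨k, -, hk⟩ := exists_nabs_ball_subset hU
  refine ⟨k, fun x hx => circle_eq_one_of_pow_near fun n => ?_⟩
  have hn : nabs (n • x) ≤ radius F k := by
    induction n with
    | zero => simpa using (radius_pos F k).le
    | succ n ih => rw [succ_nsmul]; exact nabs_add_le ih hx
  rw [← AddChar.map_nsmul_eq_pow]
  exact le_of_lt (hk hn)

end AdditiveCharacter

section ShalikaMatrices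

variable {m : ℕ} {K : Type*} [Field K]

/-- The block diagonal matrix `diag(I_m, g, 1)`. -/
noncomputable def diagMid (g : GL (Fin m) K) : GL (Idx m) K := (diagOne g)⁻¹ * diagTwo g

theorem diagTwo_eq (g : GL (Fin m) K) : diagTwo g = diagOne g * diagMid g := by
  rw [diagMid, mul_inv_cancel_left]

theorem diagOne_mul (g h : GL (Fin m) K) : diagOne (g * h) = diagOne g * diagOne h := by
  refine Units.ext ?_
  simp [diagOne, fromBlocks_multiply]

theorem diagTwo_mul (g h : GL (Fin m) K) : diagTwo (g * h) = diagTwo g * diagTwo h := by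
  refine Units.ext ?_
  simp [diagTwo, fromBlocks_multiply]

theorem diagTwo_one : diagTwo (1 : GL (Fin m) K) = 1 := by
  have := diagTwo_mul (1 : GL (Fin m) K) 1
  rw [mul_one] at this
  exact (left_eq_mul.1 this)

theorem unip_mul (z w : Matrix (Fin m) (Fin m) K) (y x : Matrix (Fin m) (Fin 1) K) :
    unip z y * unip w x = unip (z + w) (y + x) := by
  refine Units.ext ?_
  rw [Units.val_mul]
  simp only [unip, fromBlocks_multiply, Matrix.one_mul, Matrix.mul_one, Matrix.mul_zero,
    Matrix.zero_mul, add_zero, zero_add]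
  congr 1
  ext i (j | j) <;> simp [add_comm]

theorem unip_zero : unip (0 : Matrix (Fin m) (Fin m) K) 0 = 1 := by
  have := unip_mul (0 : Matrix (Fin m) (Fin m) K) 0 0 0
  rw [add_zero, add_zero] at this
  exact (left_eq_mul.1 this.symm)

theorem diagMid_val (g : GL (Fin m) K) : (diagMid g : Matrix (Idx m) (Idx m) K) =
    fromBlocks 1 0 0 (fromBlocks (g : Matrix (Fin m) (Fin m) K) 0 0 1) := by
  change fromBlocks ((g⁻¹ : GL (Fin m) K) : Matrix (Fin m) (Fin m) K) 0 0 1 *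
    fromBlocks (g : Matrix (Fin m) (Fin m) K) 0 0
      (fromBlocks (g : Matrix (Fin m) (Fin m) K) 0 0 1) = _
  rw [fromBlocks_multiply, Units.inv_mul]
  simp

theorem diagMid_comm (g h : GL (Fin m) K) : diagMid g * diagOne h = diagOne h * diagMid g := by
  refine Units.ext ?_
  rw [Units.val_mul, Units.val_mul, diagMid_val]
  simp [diagOne, fromBlocks_multiply]

theorem diagOne_mul_unip (g : GL (Fin m) K) (z : Matrix (Fin m) (Fin m) K)
    (y : Matrix (Fin m) (Fin 1) K) :
    diagOne g * unip z y = unip ((g : Matrix (Fin m) (Fin m) K) * z)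
      ((g : Matrix (Fin m) (Fin m) K) * y) * diagOne g := by
  refine Units.ext ?_
  rw [Units.val_mul, Units.val_mul]
  simp only [unip, diagOne, fromBlocks_multiply, Matrix.one_mul, Matrix.mul_one, Matrix.mul_zero,
    Matrix.zero_mul, add_zero, zero_add, Matrix.mul_fromCols]

variable {V : Type*} [AddCommGroup V] [Module ℂ V] {ρ : Representation ℂ (GL (Idx m) K) V}
  {θ : AddChar K Circle} {L : Module.Dual ℂ V}

theorem shalikaHom_unip (hL : L ∈ shalikaHom ρ θ) (z : Matrix (Fin m) (Fin m) K)
    (y : Matrix (Fin m) (Fin 1) K) (v : V) :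
    L (ρ (unip z y) v) = (θ (Matrix.trace z) : ℂ) * L v := by
  have := hL z 1 y v
  rwa [diagTwo_one, mul_one, unip_mul, add_zero, zero_add] at this

theorem shalikaHom_diagTwo (hL : L ∈ shalikaHom ρ θ) (g : GL (Fin m) K) (v : V) :
    L (ρ (diagTwo g) v) = L v := by
  have := hL 0 g 0 v
  simpa [unip_zero] using this

/-- Conjugating the argument of a Shalika function by `h`, only a factor `diag(I_m, h⁻¹, 1)` is
left, and it acts on the vector. -/
theorem shalika_diagOne_mul (hL : L ∈ shalikaHom ρ θ) (h g : GL (Fin m) K) (v : V) :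
    L (ρ (diagOne (h * g)) v) = L (ρ (diagOne g) (ρ (diagMid h⁻¹) v)) := by
  have h1 : diagOne (h * g) = diagTwo h * (diagOne g * diagMid h⁻¹) := by
    rw [← diagMid_comm, ← mul_assoc, diagTwo_eq, diagOne_mul]
    have : diagMid h * diagMid h⁻¹ = (1 : GL (Idx m) K) := by
      refine Units.ext ?_
      rw [Units.val_mul, diagMid_val, diagMid_val]
      simp [fromBlocks_multiply, -Matrix.coe_units_inv]
    rw [mul_assoc (diagOne h), this, mul_one]
  rw [h1, map_mul, Module.End.mul_apply, shalikaHom_diagTwo hL, map_mul, Module.End.mul_apply]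

/-- Elements of the unipotent radical attached to `firstIdx i` are products of a matrix `unip z y`
and a block diagonal unipotent matrix. -/
theorem exists_unip_mul_diagOne {i : Fin m} {u : GL (Idx m) K}
    (hu : u ∈ unipotentRadical K (firstIdx i)) :
    ∃ z y, ∃ h : GL (Fin m) K, u = unip z y * diagOne h ∧
      (∀ j l, i < j → z j l = 0) ∧
      (∀ j l, ¬(j ≤ i ∧ i < l) → (h : Matrix (Fin m) (Fin m) K) j l = (1 : Matrix _ _ K) j l) := by
  have hmem : ∀ j : Fin m, (Sum.inl j : Idx m) ∈ firstIdx i ↔ j ≤ i := by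
    intro j
    constructor
    · rintro ⟨j', hj', h⟩
      rwa [Sum.inl.inj h]
    · intro h
      exact ⟨j, h, rfl⟩
  have hmem' : ∀ k, (Sum.inr k : Idx m) ∉ firstIdx i := by
    rintro k ⟨j, -, h⟩
    exact absurd h (by simp)
  have hblock : ∀ w : GL (Idx m) K, w ∈ unipotentRadical K (firstIdx i) →
      (w : Matrix (Idx m) (Idx m) K) = fromBlocks (toBlocks₁₁ (w : Matrix (Idx m) (Idx m) K))
        (toBlocks₁₂ (w : Matrix (Idx m) (Idx m) K)) 0 1 := by
    intro w hw
    conv_lhs => rw [← fromBlocks_toBlocks (w : Matrix (Idx m) (Idx m) K)]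
    congr 1
    · ext k j
      exact (hw (Sum.inr k) (Sum.inl j) fun h => hmem' k h.1).trans (by simp)
    · ext k j
      refine (hw (Sum.inr k) (Sum.inr j) fun h => hmem' k h.1).trans ?_
      simp [Matrix.one_apply]
  have hinv := inv_mem hu
  have hprod : ∀ w w' : GL (Idx m) K, w ∈ unipotentRadical K (firstIdx i) →
      w' ∈ unipotentRadical K (firstIdx i) → w * w' = 1 →
      toBlocks₁₁ (w : Matrix (Idx m) (Idx m) K) * toBlocks₁₁ (w' : Matrix (Idx m) (Idx m) K) =
        1 := by
    intro w w' hw hw' hww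
    have h1 := congrArg (fun g : GL (Idx m) K => toBlocks₁₁ (g : Matrix (Idx m) (Idx m) K)) hww
    simp only [Units.val_mul, Units.val_one] at h1
    rw [hblock w hw, hblock w' hw', fromBlocks_multiply, toBlocks_fromBlocks₁₁, Matrix.mul_zero,
      add_zero, ← fromBlocks_one, toBlocks_fromBlocks₁₁] at h1
    exact h1
  let h : GL (Fin m) K := ⟨toBlocks₁₁ (u : Matrix (Idx m) (Idx m) K),
    toBlocks₁₁ ((u⁻¹ : GL (Idx m) K) : Matrix (Idx m) (Idx m) K),
    hprod _ _ hu hinv (mul_inv_cancel u), hprod _ _ hinv hu (inv_mul_cancel u)⟩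
  refine ⟨(toBlocks₁₂ (u : Matrix (Idx m) (Idx m) K)).toCols₁,
    (toBlocks₁₂ (u : Matrix (Idx m) (Idx m) K)).toCols₂, h, Units.ext ?_, fun j l hj => ?_,
    fun j l hjl => ?_⟩
  · rw [Units.val_mul, hblock u hu]
    simp only [unip, diagOne, fromBlocks_multiply, fromCols_toCols, Matrix.one_mul, Matrix.mul_one,
      Matrix.mul_zero, Matrix.zero_mul, add_zero, zero_add]
    rfl
  · refine (hu (Sum.inl j) (Sum.inr (Sum.inl l)) fun h' => ?_).trans (by simp)
    exact absurd ((hmem j).1 h'.1) (not_le.2 hj)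
  · refine (hu (Sum.inl j) (Sum.inl l) fun h' => hjl ⟨(hmem j).1 h'.1, ?_⟩).trans ?_
    · exact not_le.1 fun h'' => h'.2 ((hmem l).2 h'')
    · simp [Matrix.one_apply]

theorem diagGL_val (d : Fin m → Kˣ) : (diagGL d : Matrix (Fin m) (Fin m) K) =
    Matrix.diagonal fun i => (d i : K) := rfl

/-- Translating by the central torus of the `i`-th Levi subgroup scales the `i`-th variable of
`mMat`. -/
theorem mMat_update (a : Fin m → Kˣ) (i : Fin m) (t : Kˣ) :
    mMat (Function.update a i (t * a i)) =
      mMat a * (leviCentral (firstIdx i) t : GL (Idx m) K) := by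
  classical
  refine Units.ext ?_
  have h1 : (leviCentral (firstIdx i) t : GL (Idx m) K) =
      diagOne (diagGL fun j : Fin m => if j ≤ i then t else 1) := by
    refine Units.ext ?_
    ext j l
    rw [leviCentral_val]
    rcases j with j | j <;> rcases l with l | l
    · by_cases hjl : j = l
      · subst hjl
        by_cases hj : j ≤ i
        · have : (Sum.inl j : Idx m) ∈ firstIdx i := ⟨j, hj, rfl⟩
          simp [diagOne, diagGL_val, this, hj]
        · have : (Sum.inl j : Idx m) ∉ firstIdx i := by
            rintro ⟨j', hj', h⟩
            exact hj (Sum.inl.inj h ▸ hj')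
          simp [diagOne, diagGL_val, this, hj]
      · simp [diagOne, diagGL_val, hjl]
    · simp [diagOne]
    · simp [diagOne]
    · have : (Sum.inr j : Idx m) ∉ firstIdx i := by
        rintro ⟨j', -, h⟩
        exact absurd h (by simp)
      simp [diagOne, this, Matrix.one_apply]
  rw [h1, mMat, mMat, ← diagOne_mul]
  congr 2
  refine Units.ext ?_
  rw [Units.val_mul, diagGL_val, diagGL_val, diagGL_val, Matrix.diagonal_mul_diagonal]
  congr 1
  funext j
  rw [← Units.val_mul]
  congr 1
  by_cases hj : j ≤ i
  · rw [if_pos hj, Finset.prod_update_of_mem (Finset.mem_Ici.2 hj),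
      ← Finset.mul_prod_erase (Finset.Ici j) a (Finset.mem_Ici.2 hj),
      Finset.sdiff_singleton_eq_erase]
    rw [mul_assoc, mul_comm]
  · rw [if_neg hj, Finset.prod_update_of_notMem (by simpa using hj), mul_one]

end ShalikaMatrices

section SupportVanishing

variable {m : ℕ} {F : Type*} [Field F] [ValuativeRel F] [TopologicalSpace F]
  [IsNonarchimedeanLocalField F]

theorem unip_mem_congrSubgroup {k : ℕ} (hk : 1 ≤ k) {z : Matrix (Fin m) (Fin m) F}
    (hz : ∀ i j, nabs (z i j) ≤ radius F k) : unip z 0 ∈ congrSubgroup F (Idx m) k := by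
  refine mem_congrSubgroup_of_one_le hk fun i j => ?_
  have h0 := (radius_pos F k).le
  rcases i with i | i | i <;> rcases j with j | j | j <;>
    simp [unip, Matrix.one_apply, h0, hz]

theorem diagMid_mem_congrSubgroup {k : ℕ} {h : GL (Fin m) F}
    (hh : h ∈ congrSubgroup F (Fin m) k) : diagMid h ∈ congrSubgroup F (Idx m) k := by
  refine ⟨?_, fun i j => ?_⟩
  · rw [diagMid_val, det_fromBlocks_zero₂₁, det_fromBlocks_zero₂₁]
    simpa using hh.1
  have h0 := (radius_pos F k).le
  have h2 := hh.2
  simp only [Matrix.one_apply] at h2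
  rw [diagMid_val]
  rcases i with i | i | i <;> rcases j with j | j | j <;>
    simp [Matrix.one_apply, h0, h2]

theorem diagOne_mem_congrSubgroup {k : ℕ} {h : GL (Fin m) F}
    (hh : h ∈ congrSubgroup F (Fin m) k) : diagOne h ∈ congrSubgroup F (Idx m) k := by
  refine ⟨?_, fun i j => ?_⟩
  · change nabs (fromBlocks (h : Matrix (Fin m) (Fin m) F) 0 0 1).det = 1
    rw [det_fromBlocks_zero₂₁]
    simpa using hh.1
  have h0 := (radius_pos F k).le
  have h2 := hh.2
  simp only [Matrix.one_apply] at h2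
  rcases i with i | i <;> rcases j with j | j <;>
    simp [diagOne, Matrix.one_apply, h0, h2]

variable {V : Type*} [AddCommGroup V] [Module ℂ V] {ρ : Representation ℂ (GL (Idx m) F) V}
  {θ : AddChar F Circle} {L : Module.Dual ℂ V}

/-- Shalika functions on `diag(g, I_{m+1})` vanish unless `g` has bounded entries: otherwise `v` is
fixed by some `unip z 0` on whose conjugate by `diag(g, I_{m+1})` the character is nontrivial. -/
theorem exists_support_bound (hρ : IsAdmissible ρ) (hθ : θ ≠ 1) (hL : L ∈ shalikaHom ρ θ) (v : V) :
    ∃ n : ℕ, ∀ g : GL (Fin m) F, L (ρ (diagOne g) v) ≠ 0 →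
      ∀ i j, nabs ((g : Matrix (Fin m) (Fin m) F) i j) ≤ resCard F ^ (n : ℤ) := by
  obtain ⟨k, hk, hfix⟩ := hρ.exists_fixed v
  obtain ⟨x₀, hx₀⟩ := AddChar.ne_one_iff.1 hθ
  obtain ⟨n, hn⟩ := exists_le_resCard_zpow F (nabs x₀ / radius F k)
  refine ⟨n, fun g hg i j => ?_⟩
  by_contra hlt
  push Not at hlt
  have hpos : 0 < nabs ((g : Matrix (Fin m) (Fin m) F) i j) :=
    (zpow_pos (resCard_pos F) _).trans hlt
  have hne : (g : Matrix (Fin m) (Fin m) F) i j ≠ 0 := by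
    intro h
    rw [h, nabs_zero] at hpos
    exact lt_irrefl _ hpos
  set c : F := x₀ / (g : Matrix (Fin m) (Fin m) F) i j with hc
  have hcle : nabs c ≤ radius F k := by
    rw [hc, nabs_div, div_le_iff₀ hpos, mul_comm, ← div_le_iff₀ (radius_pos F k)]
    exact hn.trans hlt.le
  have hz : unip (Matrix.single j i c) 0 ∈ congrSubgroup F (Idx m) k := by
    refine unip_mem_congrSubgroup hk fun a b => ?_
    rw [Matrix.single_apply]
    split_ifs
    · exact hcle
    · simpa using (radius_pos F k).le
  have htr : Matrix.trace ((g : Matrix (Fin m) (Fin m) F) * Matrix.single j i c) = x₀ := by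
    rw [Matrix.trace_mul_single, hc]
    simp only [MulOpposite.smul_eq_mul_unop, MulOpposite.unop_op]
    field_simp
  have h1 : L (ρ (diagOne g) v) = (θ x₀ : ℂ) * L (ρ (diagOne g) v) := by
    conv_lhs => rw [← hfix _ hz]
    rw [← Module.End.mul_apply, ← map_mul, diagOne_mul_unip, map_mul, Module.End.mul_apply,
      shalikaHom_unip hL, htr]
  have h2 : ((θ x₀ : ℂ) - 1) * L (ρ (diagOne g) v) = 0 := by
    rw [sub_mul, one_mul, ← h1, sub_self]
  rcases mul_eq_zero.1 h2 with h3 | h3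
  · exact hx₀ (Circle.ext (by simpa using sub_eq_zero.1 h3))
  · exact hg h3

theorem nabs_prod_le {a : Fin m → Fˣ} {C : ℝ} (hC : 1 ≤ C) (ha : ∀ l, nabs (a l : F) ≤ C)
    {s : Finset (Fin m)} {i : Fin m} (hi : i ∈ s) :
    nabs ((∏ l ∈ s, a l : Fˣ) : F) ≤ nabs (a i : F) * C ^ m := by
  rw [Units.coe_prod, nabs_prod, ← Finset.mul_prod_erase s _ hi]
  refine mul_le_mul_of_nonneg_left ?_ (nabs_nonneg _)
  calc ∏ l ∈ s.erase i, nabs (a l : F) ≤ ∏ _l ∈ s.erase i, C :=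
        Finset.prod_le_prod (fun l _ => nabs_nonneg _) fun l _ => ha l
    _ = C ^ (s.erase i).card := by rw [Finset.prod_const]
    _ ≤ C ^ m := pow_le_pow_right₀ hC (by
        calc (s.erase i).card ≤ Finset.univ.card := Finset.card_le_univ _
          _ = m := by simp)

/-- If `w` vanishes in the Jacquet module attached to `firstIdx i`, then its Shalika functions
vanish on `mMat a` for small `a i`, uniformly as long as the `a l` stay bounded. -/
theorem exists_vanishing (hρ : IsAdmissible ρ) (hθ : Continuous θ) (hL : L ∈ shalikaHom ρ θ)
    (i : Fin m) {C : ℝ} (hC : 1 ≤ C) {w : V} (hw : w ∈ jacquetKer ρ (firstIdx i)) :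
    ∃ n : ℕ, ∀ a : Fin m → Fˣ, (∀ l, nabs (a l : F) ≤ C) → nabs (a i : F) ≤ radius F n →
      L (ρ (mMat a) w) = 0 := by
  induction hw using Submodule.span_induction with
  | zero => exact ⟨0, fun a _ _ => by simp⟩
  | add x y _ _ hx hy =>
    obtain ⟨n, hn⟩ := hx
    obtain ⟨n', hn'⟩ := hy
    refine ⟨max n n', fun a ha hi => ?_⟩
    rw [map_add, map_add, hn a ha (hi.trans (radius_anti F (le_max_left _ _))),
      hn' a ha (hi.trans (radius_anti F (le_max_right _ _))), add_zero]
  | smul c x _ hx =>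
    obtain ⟨n, hn⟩ := hx
    exact ⟨n, fun a ha hi => by rw [map_smul, map_smul, hn a ha hi, smul_zero]⟩
  | mem w hw =>
    obtain ⟨u, hu, x, rfl⟩ := hw
    obtain ⟨z, y, h, rfl, hz, hh⟩ := exists_unip_mul_diagOne hu
    obtain ⟨k, hk, hfix⟩ := hρ.exists_fixed x
    obtain ⟨k', hk'⟩ := exists_addChar_trivial hθ
    obtain ⟨M, hM⟩ : ∃ M : ℝ, ∀ j l, nabs (z j l) ≤ M ∧
        nabs ((h : Matrix (Fin m) (Fin m) F) j l) ≤ M := by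
      refine ⟨∑ j, ∑ l, (nabs (z j l) + nabs ((h : Matrix (Fin m) (Fin m) F) j l)), fun j l => ?_⟩
      have h1 : nabs (z j l) + nabs ((h : Matrix (Fin m) (Fin m) F) j l) ≤
          ∑ j, ∑ l, (nabs (z j l) + nabs ((h : Matrix (Fin m) (Fin m) F) j l)) := by
        have hnn : ∀ j l, 0 ≤ nabs (z j l) + nabs ((h : Matrix (Fin m) (Fin m) F) j l) :=
          fun j l => add_nonneg (nabs_nonneg _) (nabs_nonneg _)
        refine le_trans (Finset.single_le_sum
          (f := fun l => nabs (z j l) + nabs ((h : Matrix (Fin m) (Fin m) F) j l))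
          (fun l _ => hnn j l) (Finset.mem_univ l)) ?_
        exact Finset.single_le_sum
          (f := fun j => ∑ l, (nabs (z j l) + nabs ((h : Matrix (Fin m) (Fin m) F) j l)))
          (fun j _ => Finset.sum_nonneg fun l _ => hnn j l) (Finset.mem_univ j)
      constructor
      · linarith [nabs_nonneg ((h : Matrix (Fin m) (Fin m) F) j l)]
      · linarith [nabs_nonneg (z j l)]
    have hM0 : 0 ≤ M := (nabs_nonneg _).trans (hM i i).1
    have hCm : 1 ≤ C ^ m := one_le_pow₀ hC
    have hden : 0 < C ^ m * (M + 1) := by positivity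
    obtain ⟨n, -, hn⟩ := exists_resCard_zpow_le F
      (div_pos (lt_min (radius_pos F k) (radius_pos F k')) hden)
    refine ⟨n, fun a ha hi => ?_⟩
    have hsmall : ∀ (s : Finset (Fin m)) (e : F), i ∈ s → nabs e ≤ M →
        nabs (((∏ l ∈ s, a l : Fˣ) : F) * e) ≤ min (radius F k) (radius F k') := by
      intro s e hs he
      rw [nabs_mul]
      have h1 := nabs_prod_le hC ha hs
      have h2 : nabs (a i : F) * (C ^ m * (M + 1)) ≤ min (radius F k) (radius F k') := by
        rw [← le_div_iff₀ hden]
        exact hi.trans hn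
      have h3 : nabs ((∏ l ∈ s, a l : Fˣ) : F) * nabs e ≤ (nabs (a i : F) * C ^ m) * (M + 1) :=
        mul_le_mul h1 (he.trans (by linarith)) (nabs_nonneg _)
          (mul_nonneg (nabs_nonneg _) (by linarith))
      rw [mul_assoc] at h3
      exact h3.trans h2
    set b : GL (Fin m) F := diagGL fun i => ∏ j ∈ Finset.Ici i, a j with hb
    have hbval : ∀ X : Matrix (Fin m) (Fin m) F, ∀ j l, ((b : Matrix (Fin m) (Fin m) F) * X) j l =
        ((∏ l ∈ Finset.Ici j, a l : Fˣ) : F) * X j l := by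
      intro X j l
      rw [hb, diagGL_val, Matrix.diagonal_mul]
    -- the conjugate of the block diagonal part of `u` is close to `1`
    have hconj : b * h * b⁻¹ ∈ congrSubgroup F (Fin m) k := by
      refine mem_congrSubgroup_of_one_le hk fun j l => ?_
      have hinv : ((b⁻¹ : GL (Fin m) F) : Matrix (Fin m) (Fin m) F) =
          Matrix.diagonal fun i => (((∏ j ∈ Finset.Ici i, a j)⁻¹ : Fˣ) : F) := rfl
      have hent : ((b * h * b⁻¹ : GL (Fin m) F) : Matrix (Fin m) (Fin m) F) j l =
          ((∏ l ∈ Finset.Ici j, a l : Fˣ) : F) * (h : Matrix (Fin m) (Fin m) F) j l *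
            (((∏ j ∈ Finset.Ici l, a j)⁻¹ : Fˣ) : F) := by
        rw [Units.val_mul, hinv, Matrix.mul_diagonal, Units.val_mul, hbval]
      rw [hent]
      by_cases hjl : j ≤ i ∧ i < l
      · have hne : j ≠ l := fun h' => absurd (h' ▸ hjl.1) (not_le.2 hjl.2)
        have hsub : Finset.Ici l ⊆ Finset.Ici j :=
          Finset.Ici_subset_Ici.2 (hjl.1.trans hjl.2.le)
        have hsd : ∏ l ∈ Finset.Ici j, a l =
            (∏ l ∈ Finset.Ici j \ Finset.Ici l, a l) * ∏ j ∈ Finset.Ici l, a j :=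
          (Finset.prod_sdiff hsub).symm
        have himem : i ∈ Finset.Ici j \ Finset.Ici l := by
          rw [Finset.mem_sdiff, Finset.mem_Ici, Finset.mem_Ici]
          exact ⟨hjl.1, not_le.2 hjl.2⟩
        have h1 : ((∏ l ∈ Finset.Ici j, a l : Fˣ) : F) * (h : Matrix (Fin m) (Fin m) F) j l *
            (((∏ j ∈ Finset.Ici l, a j)⁻¹ : Fˣ) : F) =
            ((∏ l ∈ Finset.Ici j \ Finset.Ici l, a l : Fˣ) : F) *
              (h : Matrix (Fin m) (Fin m) F) j l := by
          rw [hsd, mul_right_comm, ← Units.val_mul, mul_inv_cancel_right]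
        rw [h1, Matrix.one_apply_ne hne, sub_zero]
        exact (hsmall _ _ himem (hM j l).2).trans (min_le_left _ _)
      · rw [hh j l hjl]
        by_cases h' : j = l
        · subst h'
          rw [Matrix.one_apply_eq, mul_one, ← Units.val_mul, mul_inv_cancel, Units.val_one,
            sub_self, nabs_zero]
          exact (radius_pos F k).le
        · rw [Matrix.one_apply_ne h', mul_zero, zero_mul, sub_self, nabs_zero]
          exact (radius_pos F k).le
    have htr : θ (Matrix.trace ((b : Matrix (Fin m) (Fin m) F) * z)) = 1 := by
      refine hk' _ ?_
      rw [Matrix.trace]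
      refine nabs_sum_le _ _ (radius_pos F k').le fun j _ => ?_
      rw [Matrix.diag_apply, hbval]
      by_cases hj : j ≤ i
      · exact (hsmall _ _ (Finset.mem_Ici.2 hj) (hM j j).1).trans (min_le_right _ _)
      · rw [hz j j (not_le.1 hj), mul_zero, nabs_zero]
        exact (radius_pos F k').le
    have hmb : mMat a = diagOne b := rfl
    have hfac : diagOne b * (unip z y * diagOne h) =
        unip ((b : Matrix (Fin m) (Fin m) F) * z) ((b : Matrix (Fin m) (Fin m) F) * y) *
          diagOne (b * h * b⁻¹ * b) := by
      rw [← mul_assoc, diagOne_mul_unip, mul_assoc, ← diagOne_mul, inv_mul_cancel_right]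
    rw [map_sub, map_sub, hmb, ← Module.End.mul_apply, ← map_mul, hfac, map_mul,
      Module.End.mul_apply, shalikaHom_unip hL, htr, shalika_diagOne_mul hL,
      hfix _ (diagMid_mem_congrSubgroup (inv_mem hconj))]
    simp

end SupportVanishing

/-! ### Asymptotic expansion in one variable -/

section OneVariable

variable {F : Type*} [Field F] [ValuativeRel F] [TopologicalSpace F]
  [IsNonarchimedeanLocalField F]

omit [ValuativeRel F] [TopologicalSpace F] [IsNonarchimedeanLocalField F] in
theorem sub_one_eq_div (t s : Fˣ) : ((t / s : Fˣ) : F) - 1 = ((t : F) - s) / s := by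
  rw [Units.val_div_eq_div_val, sub_div, div_self s.ne_zero]

/-- Functions of `t` with values in `ℂ` which are products of a character from the set `X`, a power
of the valuation, and a Schwartz function. -/
def expoFun (X : Set (Fˣ →* ℂˣ)) : Set (Fˣ → ℂ) :=
  {h | ∃ χ ∈ X, ∃ (n : ℕ) (φ : F → ℂ), IsLocallyConstant φ ∧ HasCompactSupport φ ∧
    h = fun t : Fˣ => charValPow χ n t * φ t}

/-- The functions on `Fˣ` that are invariant under the units congruent to `1` modulo the `k`-th
power of the maximal ideal and supported where `lo ≤ val t < hi`. -/
noncomputable def annulusFun (F : Type*) [Field F] [ValuativeRel F] [TopologicalSpace F]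
    [IsNonarchimedeanLocalField F] (k : ℕ) (lo hi : ℤ) : Submodule ℂ (Fˣ → ℂ) where
  carrier := {g | (∀ t u : Fˣ, nabs ((u : F) - 1) ≤ radius F k → g (u * t) = g t) ∧
    ∀ t : Fˣ, ¬(lo ≤ val (t : F) ∧ val (t : F) < hi) → g t = 0}
  zero_mem' := by simp
  add_mem' := by
    rintro g h ⟨hg1, hg2⟩ ⟨hh1, hh2⟩
    exact ⟨fun t u hu => by rw [Pi.add_apply, Pi.add_apply, hg1 t u hu, hh1 t u hu],
      fun t ht => by rw [Pi.add_apply, hg2 t ht, hh2 t ht, add_zero]⟩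
  smul_mem' := by
    rintro c g ⟨hg1, hg2⟩
    exact ⟨fun t u hu => by rw [Pi.smul_apply, Pi.smul_apply, hg1 t u hu],
      fun t ht => by rw [Pi.smul_apply, hg2 t ht, smul_zero]⟩

theorem mem_annulusFun {k : ℕ} {lo hi : ℤ} {g : Fˣ → ℂ} : g ∈ annulusFun F k lo hi ↔
    (∀ t u : Fˣ, nabs ((u : F) - 1) ≤ radius F k → g (u * t) = g t) ∧
      ∀ t : Fˣ, ¬(lo ≤ val (t : F) ∧ val (t : F) < hi) → g t = 0 := Iff.rfl

/-- Representatives of the units modulo a congruence subgroup. -/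
theorem exists_unit_reps (F : Type*) [Field F] [ValuativeRel F] [TopologicalSpace F]
    [IsNonarchimedeanLocalField F] (k : ℕ) (hk : 1 ≤ k) :
    ∃ R : Finset Fˣ, (∀ r ∈ R, nabs (r : F) = 1) ∧
      ∀ t : Fˣ, nabs (t : F) = 1 → ∃ r ∈ R, nabs (((t / r : Fˣ) : F) - 1) ≤ radius F k := by
  classical
  obtain ⟨S, hS⟩ := exists_finite_cover (F := F) k
  refine ⟨(S.preimage (fun r : Fˣ => (r : F)) (Units.val_injective.injOn)).filter
    fun r => nabs (r : F) = 1, fun r hr => (Finset.mem_filter.1 hr).2, fun t ht => ?_⟩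
  obtain ⟨s, hs, hts⟩ := hS t ht.le
  have hs1 : nabs s = 1 := by
    rw [← ht]
    refine nabs_eq_of_sub_lt ?_
    rw [ht, ← nabs_neg, neg_sub]
    exact hts.trans_lt (radius_lt_one F hk)
  have hs0 : s ≠ 0 := by
    rintro rfl
    simp at hs1
  refine ⟨Units.mk0 s hs0, ?_, ?_⟩
  · simpa [hs1] using hs
  · rw [sub_one_eq_div, nabs_div, Units.val_mk0, hs1, div_one]
    exact hts

instance (k : ℕ) (lo hi : ℤ) : FiniteDimensional ℂ (annulusFun F k lo hi) := by
  obtain ⟨R, -, hR⟩ := exists_unit_reps F (max k 1) (le_max_right _ _)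
  let ev : annulusFun F k lo hi →ₗ[ℂ] (Finset.Ico lo hi × R → ℂ) :=
    { toFun := fun g p => (g : Fˣ → ℂ) (unif F ^ (p.1 : ℤ) * (p.2 : Fˣ))
      map_add' := fun _ _ => rfl
      map_smul' := fun _ _ => rfl }
  refine FiniteDimensional.of_injective ev ?_
  rw [← LinearMap.ker_eq_bot, LinearMap.ker_eq_bot']
  intro g hg
  refine Subtype.ext (funext fun t => ?_)
  obtain ⟨hg1, hg2⟩ := mem_annulusFun.1 g.2
  by_cases ht : lo ≤ val (t : F) ∧ val (t : F) < hi
  · obtain ⟨r, hr, hle⟩ := hR (t / unif F ^ val (t : F)) (by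
      rw [nabs_units_eq_one_iff, val_units_div, val_unif_zpow, sub_self])
    have h1 := congrFun hg (⟨val (t : F), Finset.mem_Ico.2 ht⟩, ⟨r, hr⟩)
    have h2 := hg1 (unif F ^ val (t : F) * r) (t / unif F ^ val (t : F) / r)
      (hle.trans (radius_anti F (le_max_left _ _)))
    have h3 : t / unif F ^ val (t : F) / r * (unif F ^ val (t : F) * r) = t := by
      rw [div_div, div_mul_cancel]
    rw [h3] at h2
    rw [h2]
    exact h1
  · exact hg2 t ht

/-- Functions supported in an annulus are products of any smooth character with a Schwartz
function vanishing near `0`. -/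
theorem annulusFun_subset_expoFun {X : Set (Fˣ →* ℂˣ)} {χ : Fˣ →* ℂˣ} (hχ : χ ∈ X) {k₀ : ℕ}
    (hsm : ∀ t : Fˣ, nabs ((t : F) - 1) ≤ radius F k₀ → χ t = 1) {k : ℕ} {lo hi : ℤ}
    {g : Fˣ → ℂ} (hg : g ∈ annulusFun F k lo hi) : g ∈ expoFun X := by
  classical
  obtain ⟨hg1, hg2⟩ := mem_annulusFun.1 hg
  let φ : F → ℂ := fun x => if hx : x = 0 then 0 else
    ((χ (Units.mk0 x hx))⁻¹ : ℂˣ) * g (Units.mk0 x hx)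
  have hφu : ∀ t : Fˣ, φ t = ((χ t)⁻¹ : ℂˣ) * g t := fun t => by
    simp only [φ, dif_neg t.ne_zero, Units.mk0_val]
  have hφ0 : φ 0 = 0 := dif_pos rfl
  refine ⟨χ, hχ, 0, φ, ?_, ?_, ?_⟩
  · rw [IsLocallyConstant.iff_eventually_eq]
    intro x
    by_cases hx : x = 0
    · subst hx
      filter_upwards [nabs_ball_mem_nhds (F := F) (zpow_pos (resCard_pos F) (-hi))] with y hy
      by_cases hy0 : y = 0
      · rw [hy0]
      · obtain ⟨t, rfl⟩ : ∃ t : Fˣ, (t : F) = y := ⟨Units.mk0 y hy0, rfl⟩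
        have hv : hi ≤ val (t : F) := nabs_units_le_iff.1 hy
        rw [hφu, hφ0, hg2 t fun h => absurd h.2 (not_lt.2 hv), mul_zero]
    · obtain ⟨s, rfl⟩ : ∃ t : Fˣ, (t : F) = x := ⟨Units.mk0 x hx, rfl⟩
      have hpos : 0 < radius F (max (max k k₀) 1) * nabs (s : F) :=
        mul_pos (radius_pos F _) (nabs_units_pos s)
      filter_upwards [(isOpen_nabs_sub_le (s : F) hpos).mem_nhds (by simpa using hpos.le)] with y hy
      have hys : nabs y = nabs (s : F) := by
        refine nabs_eq_of_sub_lt (lt_of_le_of_lt hy ?_)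
        exact mul_lt_of_lt_one_left (nabs_units_pos s) (radius_lt_one F (le_max_right _ _))
      have hy0 : y ≠ 0 := by
        rintro rfl
        rw [nabs_zero] at hys
        exact (nabs_units_pos s).ne hys
      obtain ⟨t, rfl⟩ : ∃ t : Fˣ, (t : F) = y := ⟨Units.mk0 y hy0, rfl⟩
      have hle : nabs (((t / s : Fˣ) : F) - 1) ≤ radius F (max (max k k₀) 1) := by
        rw [sub_one_eq_div, nabs_div, div_le_iff₀ (nabs_units_pos s)]
        exact hy
      have hgt := hg1 s (t / s) (hle.trans (radius_anti F (by omega)))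
      have hχt := hsm (t / s) (hle.trans (radius_anti F (by omega)))
      rw [map_div, div_eq_one] at hχt
      rw [div_mul_cancel] at hgt
      rw [hφu, hφu, hgt, hχt]
  · refine HasCompactSupport.intro (isCompact_nabs_le (F := F) (-lo)) fun x hx => ?_
    by_cases hx0 : x = 0
    · rw [hx0, hφ0]
    · obtain ⟨t, rfl⟩ : ∃ t : Fˣ, (t : F) = x := ⟨Units.mk0 x hx0, rfl⟩
      have hv : ¬ lo ≤ val (t : F) := fun h => hx (nabs_units_le_iff.2 h)
      rw [hφu, hg2 t fun h => hv h.1, mul_zero]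
  · funext t
    rw [hφu, charValPow, pow_zero, mul_one, ← mul_assoc, ← Units.val_mul, mul_inv_cancel,
      Units.val_one, one_mul]

/-- Translation by `ϖ ^ n` followed by restriction to `n ≤ val t`. -/
noncomputable def shiftCut (n : ℤ) : (Fˣ → ℂ) →ₗ[ℂ] (Fˣ → ℂ) where
  toFun f t := if n ≤ val (t : F) then f (t / unif F ^ n) else 0
  map_add' f g := by
    funext t
    simp only [Pi.add_apply]
    split_ifs <;> simp
  map_smul' c f := by
    funext t
    simp only [Pi.smul_apply, RingHom.id_apply]
    split_ifs <;> simp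

theorem shiftCut_apply (n : ℤ) (f : Fˣ → ℂ) (t : Fˣ) :
    shiftCut n f t = if n ≤ val (t : F) then f (t / unif F ^ n) else 0 := rfl

/-- The binomial expansion of `(val t - n) ^ j`, with the indicator function of `n ≤ val t` as
Schwartz function. -/
theorem shiftCut_charValPow_mem {X : Set (Fˣ →* ℂˣ)} {χ : Fˣ →* ℂˣ} (hχ : χ ∈ X) (n : ℤ) (j : ℕ) :
    shiftCut n (charValPow χ j) ∈ Submodule.span ℂ (expoFun X) := by
  classical
  let φ : F → ℂ := Set.indicator {x : F | nabs x ≤ resCard F ^ (-n)} 1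
  have hclopen : IsClopen {x : F | nabs x ≤ resCard F ^ (-n)} :=
    ⟨(isCompact_nabs_le (F := F) (-n)).isClosed, by
      simpa using isOpen_nabs_sub_le (0 : F) (zpow_pos (resCard_pos F) (-n))⟩
  have hφ : IsLocallyConstant φ := by
    rw [IsLocallyConstant.iff_eventually_eq]
    intro x
    by_cases hx : x ∈ {x : F | nabs x ≤ resCard F ^ (-n)}
    · filter_upwards [hclopen.isOpen.mem_nhds hx] with y hy
      exact (Set.indicator_of_mem (s := {x : F | nabs x ≤ resCard F ^ (-n)}) hy
        (1 : F → ℂ)).trans (Set.indicator_of_mem hx (1 : F → ℂ)).symm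
    · filter_upwards [hclopen.compl.isOpen.mem_nhds hx] with y hy
      exact (Set.indicator_of_notMem (s := {x : F | nabs x ≤ resCard F ^ (-n)}) hy
        (1 : F → ℂ)).trans (Set.indicator_of_notMem hx (1 : F → ℂ)).symm
  have hφc : HasCompactSupport φ :=
    HasCompactSupport.intro (isCompact_nabs_le (F := F) (-n)) fun x hx =>
      Set.indicator_of_notMem hx _
  have hsum : shiftCut n (charValPow χ j) = ∑ c ∈ Finset.range (j + 1),
      ((((χ (unif F ^ n))⁻¹ : ℂˣ) : ℂ) * (-(n : ℂ)) ^ (j - c) * (j.choose c : ℂ)) •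
        fun t : Fˣ => charValPow χ c t * φ t := by
    funext t
    rw [Finset.sum_apply, shiftCut_apply]
    by_cases ht : n ≤ val (t : F)
    · have hmem : (t : F) ∈ {x : F | nabs x ≤ resCard F ^ (-n)} := nabs_units_le_iff.2 ht
      have hone : φ t = 1 := Set.indicator_of_mem hmem _
      rw [if_pos ht, charValPow, val_units_div, val_unif_zpow, Int.cast_sub, sub_eq_add_neg,
        add_pow, map_div, Finset.mul_sum]
      refine Finset.sum_congr rfl fun c _ => ?_
      rw [Pi.smul_apply, smul_eq_mul, hone, charValPow, div_eq_mul_inv, Units.val_mul]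
      ring
    · have hmem : (t : F) ∉ {x : F | nabs x ≤ resCard F ^ (-n)} := fun h =>
        ht (nabs_units_le_iff.1 h)
      have hzero : φ t = 0 := Set.indicator_of_notMem hmem _
      rw [if_neg ht]
      refine (Finset.sum_eq_zero fun c _ => ?_).symm
      rw [Pi.smul_apply, hzero, mul_zero, smul_zero]
  rw [hsum]
  exact Submodule.sum_mem _ fun c _ => Submodule.smul_mem _ _
    (Submodule.subset_span ⟨χ, hχ, c, φ, hφ, hφc, rfl⟩)

variable {E : Type*} [AddCommGroup E] [Module ℂ E] {A : Representation ℂ Fˣ E}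

variable (A) in
/-- The function attached to a linear form `l`: the matrix coefficient of `l` and `w`, moved by
`shiftCut`. -/
noncomputable def tailFun (w : E) (n : ℤ) : Module.Dual ℂ E →ₗ[ℂ] (Fˣ → ℂ) :=
  shiftCut n ∘ₗ LinearMap.pi fun t => LinearMap.applyₗ (A t w)

theorem tailFun_apply (w : E) (n : ℤ) (l : Module.Dual ℂ E) (t : Fˣ) :
    tailFun A w n l t = if n ≤ val (t : F) then l (A (t / unif F ^ n) w) else 0 := rfl

theorem tailFun_mem [FiniteDimensional ℂ E] {X : Set (Fˣ →* ℂˣ)} {k : ℕ}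
    (hk : ∀ t : Fˣ, nabs ((t : F) - 1) ≤ radius F k → A t = 1) (hX : eigenCharacters A ⊆ X)
    (w : E) (n : ℤ) (l : Module.Dual ℂ E) : tailFun A w n l ∈ Submodule.span ℂ (expoFun X) := by
  obtain ⟨f, hf, hfl⟩ := exists_matrixCoeff_eq hk l w
  have h1 : tailFun A w n l = shiftCut n f := by
    funext t
    rw [tailFun_apply, shiftCut_apply]
    split_ifs with ht
    · refine hfl _ ?_
      rw [nabs_units_le_one_iff, val_units_div, val_unif_zpow]
      omega
    · rfl
  rw [h1]
  have h2 : Submodule.span ℂ {h : Fˣ → ℂ | ∃ χ ∈ eigenCharacters A, ∃ n : ℕ, h = charValPow χ n} ≤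
      (Submodule.span ℂ (expoFun X)).comap (shiftCut n) := by
    rw [Submodule.span_le]
    rintro _ ⟨χ, hχ, j, rfl⟩
    exact shiftCut_charValPow_mem (hX hχ) n j
  exact h2 hf

end OneVariable

/-! ### Asymptotic expansion of Shalika functions -/

section ShalikaExpansion

variable {F : Type*} [Field F] [ValuativeRel F] [TopologicalSpace F]
  [IsNonarchimedeanLocalField F] {m : ℕ} {V : Type*} [AddCommGroup V] [Module ℂ V]
  {ρ : Representation ℂ (GL (Idx m) F) V} {θ : AddChar F Circle} {L : Module.Dual ℂ V}

/-- The characters allowed in the expansion: the central exponents, or the trivial character if the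
Jacquet module vanishes. -/
def allowedChars {ι : Type*} [Fintype ι] [DecidableEq ι] (ρ : Representation ℂ (GL ι F) V)
    (A : Set ι) : Set (Fˣ →* ℂˣ) :=
  {χ | χ ∈ centralExponents ρ A ∨ (Subsingleton (JacquetModule ρ A) ∧ χ = 1)}

/-- There is always an allowed smooth character. -/
theorem exists_smooth_allowedChar {ι : Type*} [Fintype ι] [DecidableEq ι]
    {ρ : Representation ℂ (GL ι F) V} (hρ : IsAdmissible ρ) (A : Set ι) :
    ∃ χ ∈ allowedChars ρ A, ∃ k : ℕ, ∀ t : Fˣ, nabs ((t : F) - 1) ≤ radius F k → χ t = 1 := by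
  by_cases hJ : Subsingleton (JacquetModule ρ A)
  · exact ⟨1, Or.inr ⟨hJ, rfl⟩, 0, fun t _ => rfl⟩
  rw [not_subsingleton_iff_nontrivial] at hJ
  obtain ⟨x, hx⟩ := exists_ne (0 : JacquetModule ρ A)
  obtain ⟨v, rfl⟩ := Submodule.Quotient.mk_surjective _ x
  obtain ⟨k, hk, hfix⟩ := hρ.exists_fixed v
  have := finiteDimensional_jacquetFixed (A := A) hρ hk
  have hne : (⊤ : Submodule ℂ (jacquetFixed ρ A k)) ≠ ⊥ := by
    rw [Submodule.ne_bot_iff]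
    exact ⟨⟨_, mk_mem_jacquetFixed hfix⟩, trivial, fun h => hx (congrArg Subtype.val h)⟩
  obtain ⟨χ, y, -, hy0, hy⟩ := exists_eigenvector_mem (A := torusFixed ρ A k) ⊤ hne
    fun _ _ _ => trivial
  refine ⟨χ, Or.inl (eigenCharacters_subset_centralExponents
    (eigenCharacters_torusFixed_subset k ⟨y, hy0, hy⟩)), k, fun t ht => ?_⟩
  have h1 := hy t
  rw [torusFixed_apply_eq hk ht, Module.End.one_apply] at h1
  refine Units.ext (smul_left_injective ℂ hy0 ?_)
  simpa using h1.symm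

/-- `exists_vanishing`, uniformly for all vectors in the range of a linear map. -/
theorem exists_vanishing_range {E : Type*} [AddCommGroup E] [Module ℂ E] [FiniteDimensional ℂ E]
    (hρ : IsAdmissible ρ) (hθ : Continuous θ) (hL : L ∈ shalikaHom ρ θ) (i : Fin m) {C : ℝ}
    (hC : 1 ≤ C) (D : E →ₗ[ℂ] V) (hD : ∀ x, D x ∈ jacquetKer ρ (firstIdx i)) :
    ∃ n : ℕ, ∀ a : Fin m → Fˣ, (∀ l, nabs (a l : F) ≤ C) → nabs (a i : F) ≤ radius F n →
      ∀ x, L (ρ (mMat a) (D x)) = 0 := by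
  let b := Module.finBasis ℂ E
  choose n hn using fun j => exists_vanishing hρ hθ hL i hC (hD (b j))
  refine ⟨Finset.univ.sup n, fun a ha hai x => ?_⟩
  have h1 : (L ∘ₗ ρ (mMat a)) ∘ₗ D = 0 := b.ext fun j =>
    hn j a ha (hai.trans (radius_anti F (Finset.le_sup (Finset.mem_univ j))))
  exact LinearMap.congr_fun h1 x

/-- For small `a i`, scaling the `i`-th variable by integers `t` turns Shalika functions into
matrix coefficients of the central torus on the Jacquet module. Modulo vectors which vanish in the
Jacquet module it suffices to scale by a uniformizer, by finitely many units, and by units close to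
`1`, because the relation can be iterated. -/
theorem exists_torus_matrixCoeff (hρ : IsAdmissible ρ) (hθ : Continuous θ)
    (hL : L ∈ shalikaHom ρ θ) (i : Fin m) {C : ℝ} (hC : 1 ≤ C) {k : ℕ} (hk : 1 ≤ k) {v : V}
    (hv : ∀ g ∈ congrSubgroup F (Idx m) k, ρ g v = v) :
    ∃ n : ℕ, ∀ a : Fin m → Fˣ, (∀ l, nabs (a l : F) ≤ C) → nabs (a i : F) ≤ radius F n →
      ∃ l : Module.Dual ℂ (jacquetFixed ρ (firstIdx i) k), ∀ t : Fˣ, nabs (t : F) ≤ 1 →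
        L (ρ (mMat (Function.update a i (t * a i))) v) =
          l (torusFixed ρ (firstIdx i) k t ⟨_, mk_mem_jacquetFixed hv⟩) := by
  classical
  have := finiteDimensional_jacquetFixed (A := firstIdx i) hρ hk
  set A := torusFixed ρ (firstIdx i) k with hA
  set w : jacquetFixed ρ (firstIdx i) k := ⟨_, mk_mem_jacquetFixed hv⟩ with hw
  -- a linear section of the projection to the Jacquet module
  obtain ⟨σ, hσ⟩ := (jacquetKer ρ (firstIdx i)).mkQ.exists_rightInverse_of_surjective
    (LinearMap.range_eq_top.2 (Submodule.mkQ_surjective _))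
  let s : jacquetFixed ρ (firstIdx i) k →ₗ[ℂ] V := σ ∘ₗ Submodule.subtype _
  have hs : ∀ x, (Submodule.Quotient.mk (s x) : JacquetModule ρ (firstIdx i)) = x := fun x =>
    LinearMap.congr_fun hσ (x : JacquetModule ρ (firstIdx i))
  obtain ⟨k', hk', hfix⟩ : ∃ k' : ℕ, k ≤ k' ∧ ∀ g ∈ congrSubgroup F (Idx m) k', ∀ x,
      ρ g (s x) = s x := by
    let b := Module.finBasis ℂ (jacquetFixed ρ (firstIdx i) k)
    obtain ⟨k', -, h⟩ := hρ.exists_fixed_finset Finset.univ fun j => s (b j)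
    refine ⟨max k k', le_max_left _ _, fun g hg x => ?_⟩
    have h1 : ρ g ∘ₗ s = s := b.ext fun j =>
      h j (Finset.mem_univ j) g (congrSubgroup_anti (le_max_right _ _) hg)
    exact LinearMap.congr_fun h1 x
  have hk'1 : 1 ≤ k' := hk.trans hk'
  let z : Fˣ → GL (Idx m) F := fun t => (leviCentral (firstIdx i) t : levi F (firstIdx i))
  let D : Fˣ → jacquetFixed ρ (firstIdx i) k →ₗ[ℂ] V := fun r => ρ (z r) ∘ₗ s - s ∘ₗ A r
  have hD : ∀ r x, D r x ∈ jacquetKer ρ (firstIdx i) := by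
    intro r x
    change ρ (z r) (s x) - s (A r x) ∈ _
    rw [← Submodule.Quotient.eq, hs]
    change jacquetRep ρ (firstIdx i) (leviCentral (firstIdx i) r) (Submodule.Quotient.mk (s x)) = _
    rw [hs]
    rfl
  choose N hN using fun r => exists_vanishing_range hρ hθ hL i hC (D r) (hD r)
  have hv0 : v - s w ∈ jacquetKer ρ (firstIdx i) := by
    rw [← Submodule.Quotient.eq, hs]
  obtain ⟨n₀, hn₀⟩ := exists_vanishing hρ hθ hL i hC hv0
  obtain ⟨R, hR1, hR⟩ := exists_unit_reps F k' hk'1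
  set n : ℕ := max n₀ ((insert (unif F) R).sup N) with hn
  let Adm : (Fin m → Fˣ) → Prop := fun a =>
    (∀ l, nabs (a l : F) ≤ C) ∧ nabs (a i : F) ≤ radius F n
  have hAdm : ∀ a (t : Fˣ), nabs (t : F) ≤ 1 → Adm a → Adm (Function.update a i (t * a i)) := by
    rintro a t ht ⟨h1, h2⟩
    have h3 : nabs ((t * a i : Fˣ) : F) ≤ nabs (a i : F) := by
      rw [Units.val_mul, nabs_mul]
      exact mul_le_of_le_one_left (nabs_nonneg _) ht
    refine ⟨fun l => ?_, ?_⟩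
    · by_cases hl : l = i
      · subst hl
        rw [Function.update_self]
        exact h3.trans (h1 l)
      · rw [Function.update_of_ne hl]
        exact h1 l
    · rw [Function.update_self]
      exact h3.trans h2
  let Good : Fˣ → Prop := fun t => ∀ a, Adm a → ∀ x,
    L (ρ (mMat (Function.update a i (t * a i))) (s x)) = L (ρ (mMat a) (s (A t x)))
  have hmul : ∀ t t' : Fˣ, nabs (t' : F) ≤ 1 → Good t → Good t' → Good (t * t') := by
    intro t t' ht' h h' a ha x
    have h1 := h _ (hAdm a t' ht' ha) x
    rw [Function.update_self, Function.update_idem, h' a ha, ← mul_assoc, ← Module.End.mul_apply,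
      ← map_mul, mul_comm t' t] at h1
    exact h1
  have hrep : ∀ r ∈ insert (unif F) R, Good r := by
    intro r hr a ha x
    have hle : N r ≤ n := (Finset.le_sup hr).trans (le_max_right _ _)
    have h1 := hN r a ha.1 (ha.2.trans (radius_anti F hle)) x
    rw [mMat_update, map_mul, Module.End.mul_apply]
    rw [← sub_eq_zero, ← map_sub, ← map_sub]
    exact h1
  have hclose : ∀ u : Fˣ, nabs ((u : F) - 1) ≤ radius F k' → Good u := by
    intro u hu a ha x
    rw [mMat_update, map_mul, Module.End.mul_apply, hfix _ (leviCentral_mem_congrSubgroup hk'1 hu),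
      hA, torusFixed_apply_eq hk (hu.trans (radius_anti F hk')), Module.End.one_apply]
  have hgood : ∀ t : Fˣ, nabs (t : F) ≤ 1 → Good t := by
    intro t ht
    obtain ⟨e, he⟩ := Int.eq_ofNat_of_zero_le (nabs_units_le_one_iff.1 ht)
    have hpow : ∀ e : ℕ, Good (unif F ^ e) := by
      intro e
      induction e with
      | zero => exact hclose _ (by simpa using (radius_pos F k').le)
      | succ e ih =>
        rw [pow_succ]
        exact hmul _ _ nabs_unif_lt_one.le ih (hrep _ (Finset.mem_insert_self _ _))
    have hu : nabs ((t / unif F ^ e : Fˣ) : F) = 1 := by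
      rw [nabs_units_eq_one_iff, val_units_div, ← zpow_natCast, val_unif_zpow, he]
      simp
    obtain ⟨r, hr, hrt⟩ := hR _ hu
    have h1 := hmul _ _ (hR1 r hr).le (hclose _ hrt) (hrep r (Finset.mem_insert_of_mem hr))
    rw [div_mul_cancel] at h1
    have h2 := hmul _ _ hu.le (hpow e) h1
    rwa [mul_div_cancel] at h2
  refine ⟨n, fun a ha hai => ⟨(L ∘ₗ ρ (mMat a)) ∘ₗ s, fun t ht => ?_⟩⟩
  have hadm := hAdm a t ht ⟨ha, hai⟩
  have h1 := hn₀ _ hadm.1 (hadm.2.trans (radius_anti F (le_max_left _ _)))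
  rw [map_sub, map_sub, sub_eq_zero] at h1
  rw [h1, hgood t ht a ⟨ha, hai⟩]
  rfl

/-- The slices of a Shalika function, cut off outside a polydisc, lie in a finite dimensional
space of functions with the required expansion. -/
theorem exists_slice_space (hρ : IsAdmissible ρ) (hθ : Continuous θ) (hL : L ∈ shalikaHom ρ θ)
    (v : V) {N : ℕ} (i : Fin m) :
    ∃ B : Submodule ℂ (Fˣ → ℂ), FiniteDimensional ℂ B ∧
      B ≤ Submodule.span ℂ (expoFun (allowedChars ρ (firstIdx i))) ∧
      ∀ a : Fin m → Fˣ, (∀ l ≠ i, nabs (a l : F) ≤ resCard F ^ (N : ℤ)) →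
        (fun t : Fˣ => open Classical in if nabs (t : F) ≤ resCard F ^ (N : ℤ) then
          L (ρ (mMat (Function.update a i t)) v) else 0) ∈ B := by
  classical
  obtain ⟨k, hk, hfix⟩ := hρ.exists_fixed v
  have hfin := finiteDimensional_jacquetFixed (A := firstIdx i) hρ hk
  have hC : 1 ≤ resCard F ^ (N : ℤ) := one_le_zpow₀ (one_lt_resCard F).le (Int.natCast_nonneg N)
  obtain ⟨n, hn⟩ := exists_torus_matrixCoeff hρ hθ hL i hC hk hfix
  obtain ⟨χ, hχ, k₀, hsm⟩ := exists_smooth_allowedChar hρ (firstIdx i)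
  set A := torusFixed ρ (firstIdx i) k with hA
  set w : jacquetFixed ρ (firstIdx i) k := ⟨_, mk_mem_jacquetFixed hfix⟩ with hw
  refine ⟨annulusFun F k (-N) n ⊔ LinearMap.range (tailFun A w n), inferInstance,
    sup_le (fun g hg => Submodule.subset_span (annulusFun_subset_expoFun hχ hsm hg)) ?_,
    fun a ha => ?_⟩
  · rintro _ ⟨l, rfl⟩
    exact tailFun_mem (fun t ht => torusFixed_apply_eq hk ht)
      (((eigenCharacters_torusFixed_subset k).trans eigenCharacters_subset_centralExponents).trans
        fun _ h => Or.inl h) w n l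
  -- the part of the slice with `n ≤ val t` is a matrix coefficient, the rest lives on an annulus
  set a' : Fin m → Fˣ := Function.update a i (unif F ^ (n : ℤ)) with ha'
  have hn1 : radius F n ≤ resCard F ^ (N : ℤ) := (radius_le_one F n).trans hC
  have ha'i : a' i = unif F ^ (n : ℤ) := Function.update_self _ _ _
  obtain ⟨l, hl⟩ := hn a' (fun j => by
      by_cases hj : j = i
      · rw [hj, ha'i, nabs_unif_zpow]; exact hn1
      · rw [ha', Function.update_of_ne hj]; exact ha j hj)
    (by rw [ha'i, nabs_unif_zpow]; exact le_rfl)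
  set g : Fˣ → ℂ := fun t => if nabs (t : F) ≤ resCard F ^ (N : ℤ) then
    L (ρ (mMat (Function.update a i t)) v) else 0 with hg
  have hle_iff : ∀ t : Fˣ, nabs (t : F) ≤ resCard F ^ (N : ℤ) ↔ -(N : ℤ) ≤ val (t : F) := by
    intro t
    rw [← nabs_units_le_iff, neg_neg]
  have htail : ∀ t : Fˣ, (n : ℤ) ≤ val (t : F) → g t = l (A (t / unif F ^ (n : ℤ)) w) := by
    intro t ht
    rw [hg]
    have h1 := hl (t / unif F ^ (n : ℤ)) (by
      rw [nabs_units_le_one_iff, val_units_div, val_unif_zpow]; omega)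
    rw [ha'i, div_mul_cancel, ha', Function.update_idem] at h1
    simp only
    rw [if_pos ((hle_iff t).2 (by omega)), h1]
  have hmid : (fun t : Fˣ => if val (t : F) < n then g t else 0) ∈ annulusFun F k (-N) n := by
    rw [mem_annulusFun]
    refine ⟨fun t u hu => ?_, fun t ht => ?_⟩
    · have hu1 : nabs (u : F) = 1 := by
        rcases Nat.eq_zero_or_pos k with h | h
        · omega
        · exact nabs_eq_one_of_sub_lt (hu.trans_lt (radius_lt_one F hk))
      have hval : val ((u * t : Fˣ) : F) = val (t : F) := by
        rw [val_units_mul, nabs_units_eq_one_iff.1 hu1, zero_add]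
      have hup : mMat (Function.update a i (u * t)) = mMat (Function.update a i t) *
          (leviCentral (firstIdx i) u : GL (Idx m) F) := by
        rw [← mMat_update, Function.update_self, Function.update_idem]
      simp only [hg, hval, hle_iff]
      rw [hup, map_mul, Module.End.mul_apply, hfix _ (leviCentral_mem_congrSubgroup hk hu)]
    · simp only [hg, hle_iff]
      split_ifs with h1 h2
      · exact absurd ⟨h2, h1⟩ ht
      · rfl
      · rfl
  have hsum : g = (fun t : Fˣ => if val (t : F) < n then g t else 0) + tailFun A w n l := by
    funext t
    rw [Pi.add_apply, tailFun_apply]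
    split_ifs with h1 h2 h2
    · omega
    · rw [add_zero]
    · rw [zero_add, htail t h2]
    · omega
  rw [hsum]
  exact Submodule.add_mem_sup hmid ⟨l, rfl⟩

theorem isLocallyConstant_prod {α : Type*} [TopologicalSpace α] {κ : Type*} (s : Finset κ)
    {f : κ → α → ℂ} (hf : ∀ i, IsLocallyConstant (f i)) :
    IsLocallyConstant fun x => ∏ i ∈ s, f i x := by
  classical
  induction s using Finset.induction_on with
  | empty => exact IsLocallyConstant.const (1 : ℂ)
  | insert i s hi ih =>
    simp only [Finset.prod_insert hi]
    exact (hf i).mul ih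

/-- The expansion of Shalika functions on the diagonal torus. -/
theorem exists_shalika_expansion (hρ : IsAdmissible ρ) (hθ : Continuous θ) (hθ1 : θ ≠ 1)
    (hL : L ∈ shalikaHom ρ θ) (v : V) :
    ∃ (N : ℕ) (χ : Fin N → Fin m → (Fˣ →* ℂˣ)) (k : Fin N → Fin m → ℕ)
      (φ : Fin N → (Fin m → F) → ℂ), (∀ l i, χ l i ∈ allowedChars ρ (firstIdx i)) ∧
      (∀ l, IsSchwartz (φ l)) ∧
      ∀ a : Fin m → Fˣ, (∀ i : Fin m, (i : ℕ) + 1 < m → nabs (a i : F) ≤ 1) →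
        shalikaFun ρ L v (mMat a) =
          ∑ l, (∏ i, (χ l i (a i) : ℂ) * (val (a i : F) : ℂ) ^ k l i) *
            φ l (fun i => (a i : F)) := by
  classical
  obtain ⟨N, hN⟩ := exists_support_bound hρ hθ1 hL v
  have hC : 1 ≤ resCard F ^ (N : ℤ) := one_le_zpow₀ (one_lt_resCard F).le (Int.natCast_nonneg N)
  choose B hfin hB hslice using fun i => exists_slice_space hρ hθ hL v (N := N) i
  let f : (Fin m → Fˣ) → ℂ := fun a =>
    if ∀ l, nabs (a l : F) ≤ resCard F ^ (N : ℤ) then L (ρ (mMat a) v) else 0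
  have hfB : ∀ a i, (fun t => f (Function.update a i t)) ∈ B i := by
    intro a i
    have hiff : ∀ t : Fˣ, (∀ l, nabs (Function.update a i t l : F) ≤ resCard F ^ (N : ℤ)) ↔
        (∀ l ≠ i, nabs (a l : F) ≤ resCard F ^ (N : ℤ)) ∧ nabs (t : F) ≤ resCard F ^ (N : ℤ) := by
      intro t
      constructor
      · intro h
        refine ⟨fun l hl => ?_, ?_⟩
        · have := h l
          rwa [Function.update_of_ne hl] at this
        · have := h i
          rwa [Function.update_self] at this
      · rintro ⟨h1, h2⟩ l
        by_cases hl : l = i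
        · subst hl
          rwa [Function.update_self]
        · rw [Function.update_of_ne hl]
          exact h1 l hl
    by_cases ha : ∀ l ≠ i, nabs (a l : F) ≤ resCard F ^ (N : ℤ)
    · have := hslice i a ha
      convert this using 2 with t
      exact if_congr ((hiff t).trans (and_iff_right ha)) rfl rfl
    · have : (fun t => f (Function.update a i t)) = 0 := by
        funext t
        simp only [f, hiff, ha, false_and, if_false, Pi.zero_apply]
      rw [this]
      exact zero_mem _
  have h1 := mem_span_prod_of_slices f B hfB
  have h2 : f ∈ Submodule.span ℂ {g : (Fin m → Fˣ) → ℂ | ∃ h : Fin m → Fˣ → ℂ,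
      (∀ i, h i ∈ expoFun (allowedChars ρ (firstIdx i))) ∧ g = fun a => ∏ i, h i (a i)} := by
    refine Submodule.span_le.2 ?_ h1
    rintro _ ⟨h, hh, rfl⟩
    exact prod_mem_span_prod _ h fun i => hB i (hh i)
  obtain ⟨M, c, g, hsum⟩ := Submodule.mem_span_set'.1 h2
  choose h hh hg using fun l => (g l).2
  choose χ hχ k φ hφ hφc hhφ using hh
  refine ⟨M, χ, k, fun l x => c l * ∏ i, φ l i (x i), hχ, fun l => ⟨?_, ?_⟩, fun a ha => ?_⟩
  · exact (IsLocallyConstant.const (c l)).mul (isLocallyConstant_prod _ fun i =>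
      (hφ l i).comp_continuous (continuous_apply i))
  · refine HasCompactSupport.intro (isCompact_univ_pi fun i => hφc l i) fun x hx => ?_
    simp only [Set.mem_univ_pi, not_forall] at hx
    obtain ⟨i, hi⟩ := hx
    have h3 : φ l i (x i) = 0 := image_eq_zero_of_notMem_tsupport hi
    change c l * ∏ i, φ l i (x i) = 0
    rw [Finset.prod_eq_zero (Finset.mem_univ i) h3, mul_zero]
  · have hfa : shalikaFun ρ L v (mMat a) = f a := by
      change L (ρ (mMat a) v) = f a
      by_cases h0 : L (ρ (mMat a) v) = 0
      · simp only [f, h0, ite_self]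
      · refine (if_pos fun l => ?_).symm
        by_cases hl : (l : ℕ) + 1 < m
        · exact (ha l hl).trans hC
        -- the last variable is an entry of `mMat a`, hence bounded on the support
        · have h3 := hN _ h0 l l
          have h4 : Finset.Ici l = {l} := by
            ext j
            simp only [Finset.mem_Ici, Finset.mem_singleton]
            constructor
            · intro hj
              have h5 : (l : ℕ) ≤ j := hj
              exact Fin.ext (by omega)
            · rintro rfl
              exact le_rfl
          rwa [diagGL_val, Matrix.diagonal_apply_eq, h4, Finset.prod_singleton] at h3
    rw [hfa, ← hsum, Finset.sum_apply]
    refine Finset.sum_congr rfl fun l _ => ?_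
    rw [Pi.smul_apply, hg l, smul_eq_mul]
    simp only [hhφ, charValPow]
    rw [Finset.prod_mul_distrib]
    ring

end ShalikaExpansion

/-! ### The Cartan decomposition -/

section Cartan

variable {F : Type*} [Field F] [ValuativeRel F] [TopologicalSpace F]
  [IsNonarchimedeanLocalField F]

section General

variable {ι : Type*} [Fintype ι] [DecidableEq ι]

theorem exists_one_sub_mem_congrSubgroup {N : Matrix ι ι F} (hN : N * N = 0)
    (hint : ∀ i j, nabs (N i j) ≤ 1) :
    ∃ k ∈ congrSubgroup F ι 0, (k : Matrix ι ι F) = 1 - N := by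
  let k : GL ι F := ⟨1 - N, 1 + N, by rw [sub_mul, mul_add, mul_add, hN]; simp,
    by rw [add_mul, mul_sub, mul_sub, hN]; simp⟩
  exact ⟨k, mem_congrSubgroup_zero_of_inv
    (fun i j => nabs_sub_le (nabs_one_apply_le i j) (hint i j))
    (fun i j => nabs_add_le (nabs_one_apply_le i j) (hint i j)), rfl⟩

/-- Row and column reduction over the ring of integers, clearing the rows and columns indexed
by `s`. The next pivot is an entry of maximal absolute value among the remaining ones. -/
theorem exists_reduce (g : GL ι F) (s : Finset ι) :
    ∃ k₁ ∈ congrSubgroup F ι 0, ∃ k₂ ∈ congrSubgroup F ι 0, ∀ i j, i ≠ j → i ∈ s ∨ j ∈ s →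
      ((k₁ * g * k₂ : GL ι F) : Matrix ι ι F) i j = 0 := by
  induction s using Finset.induction_on with
  | empty => exact ⟨1, one_mem _, 1, one_mem _, by simp⟩
  | insert p s hp ih =>
    obtain ⟨k₁, hk₁, k₂, hk₂, hX⟩ := ih
    -- move a maximal entry to the diagonal position `(p, p)`
    obtain ⟨⟨a, b⟩, hab, hmax⟩ := Finset.exists_max_image (sᶜ ×ˢ sᶜ)
      (fun x => nabs (((k₁ * g * k₂ : GL ι F) : Matrix ι ι F) x.1 x.2))
      ⟨(p, p), by simp [hp]⟩
    simp only [Finset.mem_product, Finset.mem_compl] at hab hmax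
    obtain ⟨P, hP, hPval⟩ := exists_perm_matrix (F := F) (Equiv.swap p b)
    obtain ⟨Q, hQ, hQval⟩ := exists_perm_matrix (F := F) (Equiv.swap p a)
    set X : Matrix ι ι F := ((k₁ * g * k₂ : GL ι F) : Matrix ι ι F) with hXdef
    set Y : Matrix ι ι F := ((Q⁻¹ * (k₁ * g * k₂) * P : GL ι F) : Matrix ι ι F) with hYdef
    have hQinv : ((Q⁻¹ : GL ι F) : Matrix ι ι F) =
        (1 : Matrix ι ι F).submatrix (Equiv.swap p a) id := by
      refine (eq_comm.1 ?_)
      rw [← Units.mul_eq_one_iff_eq_inv, hQval]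
      ext i j
      simp [Matrix.mul_apply, Matrix.one_apply]
    have hY : ∀ i j, Y i j = X (Equiv.swap p a i) (Equiv.swap p b j) := by
      intro i j
      rw [hYdef, Units.val_mul, Units.val_mul, ← hXdef, hPval, hQinv]
      simp [Matrix.mul_apply, Matrix.one_apply]
    have hfix : ∀ c ∉ s, ∀ i ∈ s, Equiv.swap p c i = i := fun c hc i hi =>
      Equiv.swap_apply_of_ne_of_ne (fun h => hp (h ▸ hi)) fun h => hc (h ▸ hi)
    have hnot : ∀ c ∉ s, ∀ i ∉ s, Equiv.swap p c i ∉ s := fun c hc i hi h =>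
      hi (by rw [← Equiv.swap_apply_self p c i, hfix c hc _ h]; exact h)
    have hYs : ∀ i j, i ≠ j → i ∈ s ∨ j ∈ s → Y i j = 0 := by
      intro i j hij h
      rw [hY]
      rcases h with h | h
      · refine hX _ _ (fun h' => hij ?_) (Or.inl ((hfix a hab.1 i h).symm ▸ h))
        rw [hfix a hab.1 i h] at h'
        rw [← Equiv.swap_apply_self p b j, ← h', hfix b hab.2 i h]
      · refine hX _ _ (fun h' => hij ?_) (Or.inr ((hfix b hab.2 j h).symm ▸ h))
        rw [hfix b hab.2 j h] at h'
        rw [← Equiv.swap_apply_self p a i, h', hfix a hab.1 j h]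
    have hYmax : ∀ i j, i ∉ s → j ∉ s → nabs (Y i j) ≤ nabs (Y p p) := by
      intro i j hi hj
      rw [hY, hY, Equiv.swap_apply_left, Equiv.swap_apply_left]
      exact hmax (_, _) ⟨hnot a hab.1 i hi, hnot b hab.2 j hj⟩
    -- clear the row and the column of the pivot
    let c : ι → F := fun i => if i ∈ s ∨ i = p then 0 else Y i p / Y p p
    let r : ι → F := fun j => if j ∈ s ∨ j = p then 0 else Y p j / Y p p
    have hcp : c p = 0 := if_pos (Or.inr rfl)
    have hrp : r p = 0 := if_pos (Or.inr rfl)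
    have hquot : ∀ x y : F, nabs x ≤ nabs y → nabs (x / y) ≤ 1 := fun x y h => by
      rw [nabs_div]; exact div_le_one_of_le₀ h (nabs_nonneg _)
    have hc1 : ∀ i, nabs (c i) ≤ 1 := by
      intro i
      by_cases hi : i ∈ s ∨ i = p
      · simp [c, hi]
      · simp only [c, hi, if_false]
        exact hquot _ _ (hYmax _ _ (fun h => hi (Or.inl h)) hp)
    have hr1 : ∀ i, nabs (r i) ≤ 1 := by
      intro i
      by_cases hi : i ∈ s ∨ i = p
      · simp [r, hi]
      · simp only [r, hi, if_false]
        exact hquot _ _ (hYmax _ _ hp (fun h => hi (Or.inl h)))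
    have hint : ∀ x y : ι → F, (∀ i, nabs (x i) ≤ 1) → (∀ i, nabs (y i) ≤ 1) →
        ∀ i j, nabs (vecMulVec x y i j) ≤ 1 := fun x y hx hy i j => by
      rw [vecMulVec_apply, nabs_mul]
      exact mul_le_one₀ (hx i) (nabs_nonneg _) (hy j)
    have he1 : ∀ i, nabs ((Pi.single p 1 : ι → F) i) ≤ 1 := by
      intro i
      rw [Pi.single_apply]
      split_ifs <;> simp
    obtain ⟨l₁, hl₁, hl₁v⟩ := exists_one_sub_mem_congrSubgroup
      (N := vecMulVec c (Pi.single p 1))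
      (by rw [vecMulVec_mul_vecMulVec]; simp [hcp]) (hint _ _ hc1 he1)
    obtain ⟨l₂, hl₂, hl₂v⟩ := exists_one_sub_mem_congrSubgroup
      (N := vecMulVec (Pi.single p 1) r)
      (by rw [vecMulVec_mul_vecMulVec]; simp [hrp]) (hint _ _ he1 hr1)
    refine ⟨l₁ * Q⁻¹ * k₁, mul_mem (mul_mem hl₁ (inv_mem hQ)) hk₁, k₂ * P * l₂,
      mul_mem (mul_mem hk₂ hP) hl₂, fun i j hij h => ?_⟩
    have hassoc : l₁ * Q⁻¹ * k₁ * g * (k₂ * P * l₂) = l₁ * (Q⁻¹ * (k₁ * g * k₂) * P) * l₂ := by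
      simp only [mul_assoc]
    have hent : ((l₁ * (Q⁻¹ * (k₁ * g * k₂) * P) * l₂ : GL ι F) : Matrix ι ι F) i j =
        Y i j - c i * Y p j - (Y i p - c i * Y p p) * r j := by
      rw [Units.val_mul, Units.val_mul, ← hYdef, hl₁v, hl₂v, mul_sub, mul_one, sub_mul, one_mul,
        sub_mul, Matrix.sub_apply, Matrix.sub_apply, Matrix.sub_apply, vecMulVec_mul, mul_vecMulVec,
        vecMulVec_mul, vecMul_vecMulVec]
      simp [vecMulVec_apply]
      ring
    rw [hassoc, hent]
    by_cases hi : i ∈ s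
    · have hip : i ≠ p := fun h' => hp (h' ▸ hi)
      have hci : c i = 0 := if_pos (Or.inl hi)
      rw [hYs i j hij (Or.inl hi), hYs i p hip (Or.inl hi), hci]
      ring
    by_cases hj : j ∈ s
    · have hjp : p ≠ j := fun h' => hp (h'.symm ▸ hj)
      have hrj : r j = 0 := if_pos (Or.inl hj)
      rw [hYs i j hij (Or.inr hj), hYs p j hjp (Or.inr hj), hrj]
      ring
    have hpiv : ∀ x, nabs x ≤ nabs (Y p p) → x / Y p p * Y p p = x := by
      intro x hx
      by_cases h0 : Y p p = 0
      · rw [h0, nabs_zero] at hx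
        rw [h0, mul_zero, nabs_eq_zero.1 (le_antisymm hx (nabs_nonneg _))]
      · rw [div_mul_cancel₀ _ h0]
    simp only [Finset.mem_insert, hi, hj, or_false] at h
    rcases h with rfl | rfl
    · have hrj : r j = Y i j / Y i i := if_neg (by simp [hj, hij.symm])
      have h1 := hpiv _ (hYmax i j hi hj)
      rw [hcp, hrj, zero_mul, zero_mul, sub_zero, sub_zero, mul_comm, h1, sub_self]
    · have hci : c i = Y i j / Y j j := if_neg (by simp [hi, hij])
      have h1 := hpiv _ (hYmax i j hi hj)
      rw [hrp, hci, h1, sub_self, mul_zero, sub_zero]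

omit [ValuativeRel F] [TopologicalSpace F] [IsNonarchimedeanLocalField F] in
theorem diagGL_mul_diagGL (x y : ι → Fˣ) : diagGL x * diagGL y = diagGL fun i => x i * y i := by
  refine Units.ext ?_
  rw [Units.val_mul]
  exact Matrix.diagonal_mul_diagonal _ _

/-- The Cartan decomposition, without any ordering of the exponents: the unit parts of the diagonal
entries are absorbed by the compact factor. -/
theorem exists_diagonal (g : GL ι F) :
    ∃ k₁ ∈ congrSubgroup F ι 0, ∃ k₂ ∈ congrSubgroup F ι 0, ∃ e : ι → ℤ,
      g = k₁ * diagGL (fun i => unif F ^ e i) * k₂ := by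
  obtain ⟨k₁, hk₁, k₂, hk₂, h⟩ := exists_reduce g Finset.univ
  set X := k₁ * g * k₂ with hX
  have hdiag : (X : Matrix ι ι F) = Matrix.diagonal fun i => (X : Matrix ι ι F) i i := by
    ext i j
    by_cases hij : i = j
    · subst hij; rw [Matrix.diagonal_apply_eq]
    · rw [Matrix.diagonal_apply_ne _ hij, h i j hij (Or.inl (Finset.mem_univ _))]
  have hne : ∀ i, (X : Matrix ι ι F) i i ≠ 0 := by
    have hdet : (X : Matrix ι ι F).det ≠ 0 :=
      ((Matrix.isUnit_iff_isUnit_det _).1 X.isUnit).ne_zero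
    rw [hdiag, Matrix.det_diagonal] at hdet
    exact fun i => Finset.prod_ne_zero_iff.1 hdet i (Finset.mem_univ i)
  let x : ι → Fˣ := fun i => Units.mk0 _ (hne i)
  have hXx : X = diagGL x := Units.ext hdiag
  let e : ι → ℤ := fun i => val (x i : F)
  have hu : ∀ i, nabs ((x i / unif F ^ e i : Fˣ) : F) = 1 := fun i => by
    rw [nabs_units_eq_one_iff, val_units_div, val_unif_zpow, sub_self]
  have hint : ∀ y : ι → Fˣ, (∀ i, nabs (y i : F) = 1) → ∀ i j,
      nabs ((diagGL y : Matrix ι ι F) i j) ≤ 1 := by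
    intro y hy i j
    change nabs (Matrix.diagonal (fun i => (y i : F)) i j) ≤ 1
    by_cases hij : i = j
    · subst hij; rw [Matrix.diagonal_apply_eq, hy]
    · rw [Matrix.diagonal_apply_ne _ hij, nabs_zero]; exact zero_le_one
  have hU : diagGL (fun i => x i / unif F ^ e i) ∈ congrSubgroup F ι 0 :=
    mem_congrSubgroup_zero_of_inv (hint _ hu)
      (hint (fun i => (x i / unif F ^ e i)⁻¹) fun i => by
        rw [Units.val_inv_eq_inv_val, nabs_inv, hu, inv_one])
  refine ⟨k₁⁻¹, inv_mem hk₁, diagGL (fun i => x i / unif F ^ e i) * k₂⁻¹,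
    mul_mem hU (inv_mem hk₂), e, ?_⟩
  have h1 : diagGL (fun i => unif F ^ e i) * diagGL (fun i => x i / unif F ^ e i) = X := by
    rw [diagGL_mul_diagGL, hXx]
    congr 1
    funext i
    rw [mul_div_cancel]
  rw [mul_assoc, ← mul_assoc (diagGL _), h1, hX]
  group

theorem exists_diagonal_perm (σ : Equiv.Perm ι) (x : ι → Fˣ) :
    ∃ k ∈ congrSubgroup F ι 0, diagGL x = k * diagGL (fun i => x (σ i)) * k⁻¹ := by
  obtain ⟨k, hk, hval⟩ := exists_perm_matrix (F := F) σ
  refine ⟨k, hk, ?_⟩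
  rw [eq_mul_inv_iff_mul_eq]
  refine Units.ext ?_
  rw [Units.val_mul, Units.val_mul, hval]
  change Matrix.diagonal (fun i => (x i : F)) * _ = _ * Matrix.diagonal fun i => (x (σ i) : F)
  ext i j
  rw [Matrix.diagonal_mul, Matrix.mul_diagonal]
  simp only [Matrix.submatrix_apply, id_eq, Matrix.one_apply]
  split_ifs with h
  · rw [h, mul_one, one_mul]
  · rw [mul_zero, zero_mul]

end General

variable {m : ℕ}

theorem sum_Ici_eq_of_telescope (e n : Fin m → ℤ)
    (hlast : ∀ i : Fin m, (i : ℕ) + 1 = m → n i = e i)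
    (hstep : ∀ i j : Fin m, (i : ℕ) + 1 = j → n i = e i - e j) (i : Fin m) :
    ∑ j ∈ Finset.Ici i, n j = e i := by
  obtain ⟨d, hd⟩ : ∃ d : ℕ, (i : ℕ) + 1 + d = m := ⟨m - (i + 1), by omega⟩
  induction d generalizing i with
  | zero =>
    have h4 : Finset.Ici i = {i} := by
      ext j
      simp only [Finset.mem_Ici, Finset.mem_singleton, Fin.le_def, Fin.ext_iff]
      omega
    rw [h4, Finset.sum_singleton, hlast i (by omega)]
  | succ d ih =>
    let i' : Fin m := ⟨i + 1, by omega⟩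
    have h4 : Finset.Ici i = insert i (Finset.Ici i') := by
      ext j
      simp only [Finset.mem_Ici, Finset.mem_insert, Fin.le_def, Fin.ext_iff, i']
      omega
    rw [h4, Finset.sum_insert (by simp [i', Fin.le_def]), ih i' (by simp only [i']; omega),
      hstep i i' rfl, sub_add_cancel]

/-- The Cartan decomposition, with the exponents of the diagonal matrix in decreasing order and
written as partial sums. -/
theorem exists_cartan (g : GL (Fin m) F) :
    ∃ k₁ ∈ congrSubgroup F (Fin m) 0, ∃ k₂ ∈ congrSubgroup F (Fin m) 0, ∃ n : Fin m → ℤ,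
      (∀ i : Fin m, (i : ℕ) + 1 < m → 0 ≤ n i) ∧
      g = k₁ * diagGL (fun i => ∏ j ∈ Finset.Ici i, unif F ^ n j) * k₂ := by
  obtain ⟨k₁, hk₁, k₂, hk₂, e, rfl⟩ := exists_diagonal g
  let σ := Tuple.sort fun i => -e i
  have hmono : Antitone fun i => e (σ i) := fun i j hij => by
    have := Tuple.monotone_sort (fun i => -e i) hij
    simpa using this
  obtain ⟨k, hk, hkσ⟩ := exists_diagonal_perm σ fun i => unif F ^ e i
  let n : Fin m → ℤ := fun i => if h : (i : ℕ) + 1 < m then e (σ i) - e (σ ⟨i + 1, h⟩) else e (σ i)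
  refine ⟨k₁ * k, mul_mem hk₁ hk, k⁻¹ * k₂, mul_mem (inv_mem hk) hk₂, n, fun i hi => ?_, ?_⟩
  · simp only [n, dif_pos hi]
    exact sub_nonneg.2 (hmono (Fin.le_def.2 (Nat.le_succ _)))
  · have h1 : (fun i => ∏ j ∈ Finset.Ici i, unif F ^ n j) = fun i => unif F ^ e (σ i) := by
      funext i
      rw [← sum_Ici_eq_of_telescope (fun i => e (σ i)) n
        (fun i hi => dif_neg (by omega)) (fun i j hij => ?_) i]
      · exact (map_sum (zpowersHom Fˣ (unif F)).toAdditiveRight n (Finset.Ici i)).symm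
      · have hi : (i : ℕ) + 1 < m := hij ▸ j.2
        obtain rfl : j = ⟨i + 1, hi⟩ := Fin.ext hij.symm
        exact dif_pos hi
    rw [h1, hkσ]
    simp only [mul_assoc]

end Cartan

/-! ### Growth of Shalika functions -/

section Growth

/-- A polynomial factor is absorbed by increasing the base of an exponential, on half-lines. -/
theorem zpow_mul_abs_pow_le {c Q : ℝ} (hc : 0 < c) (hQ : Real.exp 1 * c ≤ Q) (N : ℕ) (k : ℕ) :
    ∃ C : ℝ, 0 ≤ C ∧ ∀ n : ℤ, -(N : ℤ) ≤ n → c ^ n * |(n : ℝ)| ^ k ≤ C * Q ^ n := by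
  have hQ0 : 0 < Q := (mul_pos (Real.exp_pos 1) hc).trans_le hQ
  set q : ℝ := Q / c with hq
  have hq0 : 0 < q := div_pos hQ0 hc
  have hqe : Real.exp 1 ≤ q := by rwa [hq, le_div_iff₀ hc]
  refine ⟨k.factorial * Real.exp 1 ^ N * q ^ N, by positivity, fun n hn => ?_⟩
  obtain ⟨j, hj⟩ := Int.eq_ofNat_of_zero_le (show 0 ≤ n + N by omega)
  have habs : |(n : ℝ)| ≤ j + N := by
    rw [abs_le]
    have h1 : (n : ℝ) + N = j := by exact_mod_cast hj
    have hj0 : (0 : ℝ) ≤ j := Nat.cast_nonneg j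
    have hN0 : (0 : ℝ) ≤ N := Nat.cast_nonneg N
    constructor <;> linarith
  have h2 : |(n : ℝ)| ^ k ≤ k.factorial * Real.exp 1 ^ (j + N) := by
    have h3 := Real.pow_div_factorial_le_exp (j + N : ℝ) (by positivity) k
    rw [div_le_iff₀ (by positivity)] at h3
    calc |(n : ℝ)| ^ k ≤ (j + N : ℝ) ^ k := pow_le_pow_left₀ (abs_nonneg _) habs k
      _ ≤ _ := h3
      _ = k.factorial * Real.exp 1 ^ (j + N) := by
        rw [← Real.exp_nat_mul, mul_comm, Nat.cast_add, mul_one]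
  have h4 : Q ^ n = c ^ n * (q ^ j / q ^ N) := by
    have h5 : q ^ j / q ^ N = q ^ n := by
      rw [show n = (j : ℤ) - N by omega, zpow_sub₀ hq0.ne', zpow_natCast, zpow_natCast]
    rw [h5, ← mul_zpow, hq, mul_div_cancel₀ _ hc.ne']
  rw [h4]
  calc c ^ n * |(n : ℝ)| ^ k ≤ c ^ n * (k.factorial * Real.exp 1 ^ (j + N)) :=
        mul_le_mul_of_nonneg_left h2 (zpow_pos hc n).le
    _ ≤ c ^ n * (k.factorial * (q ^ j * Real.exp 1 ^ N)) := by
        rw [pow_add]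
        gcongr
    _ = _ := by
        field_simp

variable {F : Type*} [Field F] [ValuativeRel F] [TopologicalSpace F]
  [IsNonarchimedeanLocalField F] {m : ℕ} {V : Type*} [AddCommGroup V] [Module ℂ V]

theorem finite_allowedChars {ι : Type*} [Fintype ι] [DecidableEq ι]
    {ρ : Representation ℂ (GL ι F) V} (hρ : IsAdmissible ρ)
    (hlen : IsFiniteLength ℂ[GL ι F] ρ.asModule) (A : Set ι) : (allowedChars ρ A).Finite :=
  ((finite_centralExponents hρ hlen).union (Set.finite_singleton 1)).subset fun _ h =>
    h.imp id fun h' => h'.2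

theorem det_diagGL_prod (n : Fin m → ℤ) :
    val (diagGL (fun i => ∏ j ∈ Finset.Ici i, unif F ^ n j) : Matrix (Fin m) (Fin m) F).det =
      ∑ i, ∑ j ∈ Finset.Ici i, n j := by
  have h1 : ∀ i : Fin m, ∏ j ∈ Finset.Ici i, unif F ^ n j = unif F ^ ∑ j ∈ Finset.Ici i, n j :=
    fun i => (map_sum (zpowersHom Fˣ (unif F)).toAdditiveRight n (Finset.Ici i)).symm
  have h2 : ∏ i, unif F ^ ∑ j ∈ Finset.Ici i, n j = unif F ^ ∑ i, ∑ j ∈ Finset.Ici i, n j :=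
    (map_sum (zpowersHom Fˣ (unif F)).toAdditiveRight _ Finset.univ).symm
  rw [diagGL_val, Matrix.det_diagonal, ← Units.coe_prod]
  simp only [h1]
  rw [h2, val_unif_zpow]

theorem val_eq_of_nabs_eq {x y : F} (hx : x ≠ 0) (hy : y ≠ 0) (h : nabs x = nabs y) :
    val x = val y := by
  rw [nabs_of_ne_zero hx, nabs_of_ne_zero hy] at h
  have := zpow_right_injective₀ (resCard_pos F) (one_lt_resCard F).ne' h
  linarith

omit [ValuativeRel F] [TopologicalSpace F] [IsNonarchimedeanLocalField F] in
theorem det_ne_zero_GL (g : GL (Fin m) F) : (g : Matrix (Fin m) (Fin m) F).det ≠ 0 :=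
  ((Matrix.isUnit_iff_isUnit_det _).1 g.isUnit).ne_zero

/-- Growth of Shalika functions on the dominant part of the diagonal torus. The base `Q` of the
exponential bound depends only on the exponents of the representation. -/
theorem exists_torus_bound {ρ : Representation ℂ (GL (Idx m) F) V} (hρ : IsAdmissible ρ)
    (hlen : IsFiniteLength ℂ[GL (Idx m) F] ρ.asModule) :
    ∃ Q : ℝ, 1 ≤ Q ∧ ∀ (θ : AddChar F Circle), Continuous θ → θ ≠ 1 → ∀ L ∈ shalikaHom ρ θ,
      ∀ v : V, ∃ C : ℝ, 0 ≤ C ∧ ∀ n : Fin m → ℤ, (∀ i : Fin m, (i : ℕ) + 1 < m → 0 ≤ n i) →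
        ‖L (ρ (mMat fun i => unif F ^ n i) v)‖ ≤ C * Q ^ ∑ i, ∑ j ∈ Finset.Ici i, n j := by
  obtain ⟨Q, hQ1, hQ⟩ : ∃ Q : ℝ, 1 ≤ Q ∧ ∀ i : Fin m, ∀ χ ∈ allowedChars ρ (firstIdx i),
      Real.exp 1 * ‖(χ (unif F) : ℂ)‖ ≤ Q := by
    have hfin : (⋃ i : Fin m, allowedChars ρ (firstIdx i)).Finite :=
      Set.finite_iUnion fun i => finite_allowedChars hρ hlen _
    obtain ⟨Q, hQ⟩ := (hfin.image fun χ => Real.exp 1 * ‖(χ (unif F) : ℂ)‖).bddAbove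
    exact ⟨max 1 Q, le_max_left _ _, fun i χ hχ =>
      (hQ ⟨χ, Set.mem_iUnion.2 ⟨i, hχ⟩, rfl⟩).trans (le_max_right _ _)⟩
  have hQ0 : 0 < Q := zero_lt_one.trans_le hQ1
  refine ⟨Q, hQ1, fun θ hθ hθ1 L hL v => ?_⟩
  obtain ⟨c, hc⟩ := exists_support_bound hρ hθ1 hL v
  obtain ⟨M, χ, k, φ, hχ, hφ, hexp⟩ := exists_shalika_expansion hρ hθ hθ1 hL v
  choose D hD0 hD using fun l i => zpow_mul_abs_pow_le (c := ‖(χ l i (unif F) : ℂ)‖)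
    (norm_pos_iff.2 (Units.ne_zero _)) (hQ i _ (hχ l i)) c (k l i)
  choose B hB using fun l =>
    (hφ l).2.exists_bound_of_continuous (hφ l).1.continuous
  have hB0 : ∀ l, 0 ≤ B l := fun l => (norm_nonneg _).trans (hB l 0)
  set C₀ : ℝ := ∑ l, (∏ i, D l i) * B l with hC₀
  have hC₀0 : 0 ≤ C₀ := Finset.sum_nonneg fun l _ =>
    mul_nonneg (Finset.prod_nonneg fun i _ => hD0 l i) (hB0 l)
  refine ⟨C₀ * Q ^ (m * c), mul_nonneg hC₀0 (by positivity), fun n hn => ?_⟩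
  by_cases h0 : L (ρ (mMat fun i => unif F ^ n i) v) = 0
  · rw [h0, norm_zero]
    have : 0 < Q ^ ∑ i, ∑ j ∈ Finset.Ici i, n j := zpow_pos hQ0 _
    positivity
  -- the partial sums of the exponents are bounded below on the support
  have hpart : ∀ i : Fin m, -(c : ℤ) ≤ ∑ j ∈ Finset.Ici i, n j := by
    intro i
    have h1 : ∏ j ∈ Finset.Ici i, unif F ^ n j = unif F ^ ∑ j ∈ Finset.Ici i, n j :=
      (map_sum (zpowersHom Fˣ (unif F)).toAdditiveRight n (Finset.Ici i)).symm
    have h2 := hc _ h0 i i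
    rw [diagGL_val, Matrix.diagonal_apply_eq, h1, nabs_unif_zpow,
      zpow_le_zpow_iff_right₀ (one_lt_resCard F)] at h2
    omega
  have hlow : ∀ i : Fin m, -(c : ℤ) ≤ n i := by
    intro i
    by_cases hi : (i : ℕ) + 1 < m
    · have := hn i hi
      omega
    · have h4 : Finset.Ici i = {i} := by
        ext j
        simp only [Finset.mem_Ici, Finset.mem_singleton, Fin.le_def, Fin.ext_iff]
        omega
      have := hpart i
      rwa [h4, Finset.sum_singleton] at this
  have hterm : ‖L (ρ (mMat fun i => unif F ^ n i) v)‖ ≤ C₀ * Q ^ ∑ i, n i := by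
    have h1 := hexp (fun i => unif F ^ n i) (fun i hi => by
      rw [nabs_units_le_one_iff, val_unif_zpow]; exact hn i hi)
    change L (ρ (mMat fun i => unif F ^ n i) v) = _ at h1
    rw [h1, hC₀, Finset.sum_mul]
    refine (norm_sum_le _ _).trans (Finset.sum_le_sum fun l _ => ?_)
    rw [norm_mul, norm_prod]
    have h2 : ∏ i, ‖((χ l i (unif F ^ n i) : ℂˣ) : ℂ) *
        (val ((unif F ^ n i : Fˣ) : F) : ℂ) ^ k l i‖ ≤ ∏ i, (D l i * Q ^ n i) := by
      refine Finset.prod_le_prod (fun i _ => norm_nonneg _) fun i _ => ?_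
      rw [norm_mul, map_zpow, Units.val_zpow_eq_zpow_val, norm_zpow, val_unif_zpow, norm_pow,
        Complex.norm_intCast]
      exact hD l i (n i) (hlow i)
    rw [Finset.prod_mul_distrib] at h2
    have h3 : ∏ i, Q ^ n i = Q ^ ∑ i, n i := by
      have := map_sum (zpowersHom ℝˣ (Units.mk0 Q hQ0.ne')).toAdditiveRight n Finset.univ
      have h5 := congrArg (fun u : Additive ℝˣ => ((Additive.toMul u : ℝˣ) : ℝ)) this
      change ((Units.mk0 Q hQ0.ne' ^ ∑ i, n i : ℝˣ) : ℝ) =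
        ((∏ i, Units.mk0 Q hQ0.ne' ^ n i : ℝˣ) : ℝ) at h5
      simpa using h5.symm
    rw [h3] at h2
    calc _ ≤ ((∏ i, D l i) * Q ^ ∑ i, n i) * B l :=
          mul_le_mul h2 (hB l _) (norm_nonneg _)
            (mul_nonneg (Finset.prod_nonneg fun i _ => hD0 l i) (zpow_pos hQ0 _).le)
      _ = _ := by ring
  refine hterm.trans ?_
  rw [mul_assoc, ← zpow_natCast, ← zpow_add₀ hQ0.ne']
  refine mul_le_mul_of_nonneg_left (zpow_le_zpow_right₀ hQ1 ?_) hC₀0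
  rcases m with _ | m
  · simp
  have hz : Finset.Ici (0 : Fin (m + 1)) = Finset.univ := by
    ext j
    simp
  have h5 : (∑ j ∈ Finset.Ici (0 : Fin (m + 1)), n j) + c ≤
      ∑ i, ((∑ j ∈ Finset.Ici i, n j) + (c : ℤ)) :=
    Finset.single_le_sum (f := fun i => (∑ j ∈ Finset.Ici i, n j) + (c : ℤ))
      (fun i _ => by have := hpart i; omega) (Finset.mem_univ 0)
  rw [hz, Finset.sum_add_distrib, Finset.sum_const, Finset.card_univ, Fintype.card_fin,
    nsmul_eq_mul] at h5
  push_cast at h5 ⊢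
  have hc0 : (0 : ℤ) ≤ c := Int.natCast_nonneg c
  linarith

/-- Growth of Shalika functions on `diag(g, I_{m+1})`: by the Cartan decomposition the estimate
reduces to the diagonal torus, with finitely many vectors. -/
theorem exists_shalika_bound {ρ : Representation ℂ (GL (Idx m) F) V} (hρ : IsAdmissible ρ)
    (hlen : IsFiniteLength ℂ[GL (Idx m) F] ρ.asModule) :
    ∃ Q : ℝ, 1 ≤ Q ∧ ∀ (θ : AddChar F Circle), Continuous θ → θ ≠ 1 → ∀ L ∈ shalikaHom ρ θ,
      ∀ v : V, ∃ C : ℝ, 0 ≤ C ∧ ∀ g : GL (Fin m) F,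
        ‖L (ρ (diagOne g) v)‖ ≤ C * Q ^ val (g : Matrix (Fin m) (Fin m) F).det := by
  classical
  obtain ⟨Q, hQ1, hQ⟩ := exists_torus_bound hρ hlen
  have hQ0 : 0 < Q := zero_lt_one.trans_le hQ1
  refine ⟨Q, hQ1, fun θ hθ hθ1 L hL v => ?_⟩
  choose C hC0 hC using hQ θ hθ hθ1 L hL
  have hfin := hρ.finite_orbit v (le_refl (congrSubgroup F (Idx m) 0))
  refine ⟨∑ w ∈ hfin.toFinset, C w, Finset.sum_nonneg fun w _ => hC0 w, fun g => ?_⟩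
  obtain ⟨k₁, hk₁, k₂, hk₂, n, hn, rfl⟩ := exists_cartan g
  set w := ρ (diagOne k₂ * diagMid k₁⁻¹) v with hw
  have hwmem : w ∈ hfin.toFinset := by
    rw [Set.Finite.mem_toFinset]
    exact ⟨_, mul_mem (diagOne_mem_congrSubgroup hk₂)
      (diagMid_mem_congrSubgroup (inv_mem hk₁)), rfl⟩
  have hval : val ((k₁ * diagGL (fun i => ∏ j ∈ Finset.Ici i, unif F ^ n j) * k₂ :
      GL (Fin m) F) : Matrix (Fin m) (Fin m) F).det = ∑ i, ∑ j ∈ Finset.Ici i, n j := by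
    rw [← det_diagGL_prod (F := F)]
    refine val_eq_of_nabs_eq (det_ne_zero_GL _) (det_ne_zero_GL _) ?_
    rw [Units.val_mul, Units.val_mul, Matrix.det_mul, Matrix.det_mul, nabs_mul, nabs_mul, hk₁.1,
      hk₂.1, one_mul, mul_one]
  have hL' : L (ρ (diagOne (k₁ * diagGL (fun i => ∏ j ∈ Finset.Ici i, unif F ^ n j) * k₂)) v) =
      L (ρ (mMat fun i => unif F ^ n i) w) := by
    rw [mul_assoc, shalika_diagOne_mul hL, diagOne_mul, map_mul, Module.End.mul_apply, hw, map_mul,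
      Module.End.mul_apply]
    rfl
  rw [hL', hval]
  refine (hC w n hn).trans (mul_le_mul_of_nonneg_right ?_ (zpow_pos hQ0 _).le)
  exact Finset.single_le_sum (f := C) (fun w _ => hC0 w) hwmem

end Growth

/-! ### Volumes of determinantal level sets -/

section Volume

variable {F : Type*} [Field F] [ValuativeRel F] [TopologicalSpace F]
  [IsNonarchimedeanLocalField F]

/-- The ring of integers is covered by exponentially many balls of radius `radius F k`. -/
theorem exists_card_cover_le (F : Type*) [Field F] [ValuativeRel F] [TopologicalSpace F]
    [IsNonarchimedeanLocalField F] : ∃ c : ℕ, ∀ k : ℕ, ∃ S : Finset F, S.card ≤ c ^ k ∧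
      ∀ x : F, nabs x ≤ 1 → ∃ s ∈ S, nabs (x - s) ≤ radius F k := by
  classical
  obtain ⟨T, hT⟩ := exists_finite_cover (F := F) 1
  refine ⟨T.card, fun k => ?_⟩
  induction k with
  | zero => exact ⟨{0}, by simp, fun x hx => ⟨0, by simp, by rwa [sub_zero, radius_zero]⟩⟩
  | succ k ih =>
    obtain ⟨S, hcard, hS⟩ := ih
    refine ⟨(S ×ˢ T).image fun p => p.1 + ((unif F ^ (k : ℤ) : Fˣ) : F) * p.2, ?_, fun x hx => ?_⟩
    · refine Finset.card_image_le.trans ?_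
      rw [Finset.card_product, pow_succ]
      exact Nat.mul_le_mul_right _ hcard
    · obtain ⟨s, hs, hxs⟩ := hS x hx
      have hu : nabs ((unif F ^ (k : ℤ) : Fˣ) : F) = radius F k := nabs_unif_zpow _
      obtain ⟨t, ht, hxt⟩ := hT ((x - s) / ((unif F ^ (k : ℤ) : Fˣ) : F)) (by
        rw [nabs_div, hu]
        exact div_le_one_of_le₀ hxs (radius_pos F k).le)
      refine ⟨_, Finset.mem_image_of_mem _ (Finset.mk_mem_product hs ht), ?_⟩
      have h1 : x - (s + ((unif F ^ (k : ℤ) : Fˣ) : F) * t) = ((unif F ^ (k : ℤ) : Fˣ) : F) *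
          ((x - s) / ((unif F ^ (k : ℤ) : Fˣ) : F) - t) := by
        rw [mul_sub, mul_div_cancel₀ _ (Units.ne_zero _)]
        ring
      have h2 : radius F (k + 1) = radius F k * radius F 1 := by
        unfold radius
        rw [← zpow_add₀ (resCard_pos F).ne']
        congr 1
        push_cast
        ring
      rw [h1, nabs_mul, hu, h2]
      exact mul_le_mul_of_nonneg_left hxt (radius_pos F k).le

variable {ι : Type*} [Fintype ι] [DecidableEq ι]

/-- The invertible matrices with integral entries and determinant of valuation `e`. -/
def integralLevel (F ι : Type*) [Field F] [ValuativeRel F] [TopologicalSpace F]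
    [IsNonarchimedeanLocalField F] [Fintype ι] [DecidableEq ι] (e : ℕ) : Set (GL ι F) :=
  {g | (∀ i j, nabs ((g : Matrix ι ι F) i j) ≤ 1) ∧ nabs (g : Matrix ι ι F).det = radius F e}

theorem isOpen_integralLevel (e : ℕ) : IsOpen (integralLevel F ι e) := by
  have h1 : Continuous fun g : GL ι F => (g : Matrix ι ι F).det :=
    Continuous.matrix_det Units.continuous_val
  have h2 : ∀ i j, Continuous fun g : GL ι F => (g : Matrix ι ι F) i j :=
    fun i j => Continuous.matrix_elem Units.continuous_val i j
  have h3 : integralLevel F ι e = (⋂ i, ⋂ j, {g : GL ι F | nabs ((g : Matrix ι ι F) i j) ≤ 1}) ∩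
      {g : GL ι F | nabs (g : Matrix ι ι F).det = radius F e} := by
    ext g
    simp [integralLevel]
  rw [h3]
  refine IsOpen.inter (isOpen_iInter_of_finite fun i => isOpen_iInter_of_finite fun j => ?_)
    ((isOpen_nabs_eq (radius_pos F e).ne').preimage h1)
  have := isOpen_nabs_sub_le (0 : F) one_pos
  simp only [sub_zero] at this
  exact this.preimage (h2 i j)

/-- Integral matrices with determinant of valuation `e` which are congruent modulo the
`e + 1`-st power of the maximal ideal differ by an element of the first congruence subgroup. -/
theorem inv_mul_mem_of_congr {e : ℕ} {x g : GL ι F} (hx : x ∈ integralLevel F ι e)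
    (hxg : ∀ i j, nabs ((g : Matrix ι ι F) i j - (x : Matrix ι ι F) i j) ≤ radius F (e + 1)) :
    x⁻¹ * g ∈ congrSubgroup F ι 1 := by
  refine mem_congrSubgroup_of_one_le le_rfl fun i j => ?_
  have hinv : ∀ i j, nabs (((x⁻¹ : GL ι F) : Matrix ι ι F) i j) ≤ (radius F e)⁻¹ := by
    intro i j
    rw [Matrix.coe_units_inv, Matrix.inv_def, Matrix.smul_apply, smul_eq_mul, nabs_mul,
      Ring.inverse_eq_inv', nabs_inv, hx.2, Matrix.adjugate_apply]
    refine mul_le_of_le_one_right (inv_nonneg.2 (radius_pos F e).le)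
      (nabs_det_le_one fun a b => ?_)
    by_cases hb : a = j
    · subst hb
      rw [Matrix.updateRow_self, Pi.single_apply]
      split_ifs <;> simp
    · rw [Matrix.updateRow_ne hb]
      exact hx.1 a b
  have h1 : ((x⁻¹ * g : GL ι F) : Matrix ι ι F) - 1 =
      ((x⁻¹ : GL ι F) : Matrix ι ι F) * ((g : Matrix ι ι F) - (x : Matrix ι ι F)) := by
    rw [mul_sub, Units.inv_mul, Units.val_mul]
  rw [← Matrix.sub_apply, h1]
  refine (nabs_mul_apply_le (inv_nonneg.2 (radius_pos F e).le) (radius_pos F (e + 1)).le hinv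
    hxg i j).trans (le_of_eq ?_)
  unfold radius
  rw [← _root_.zpow_neg, ← zpow_add₀ (resCard_pos F).ne']
  congr 1
  push_cast
  ring

/-- The volume of the determinantal level sets grows at most exponentially. -/
theorem exists_measure_integralLevel_le (F ι : Type*) [Field F] [ValuativeRel F]
    [TopologicalSpace F] [IsNonarchimedeanLocalField F] [Fintype ι] [DecidableEq ι]
    [MeasurableSpace (GL ι F)] [BorelSpace (GL ι F)] :
    ∃ c : ℕ, ∀ (μ : Measure (GL ι F)) [μ.IsHaarMeasure] (e : ℕ),
      μ (integralLevel F ι e) ≤ (c : ENNReal) ^ (e + 1) *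
        μ (congrSubgroup F ι 1 : Set (GL ι F)) := by
  classical
  obtain ⟨c, hc⟩ := exists_card_cover_le F
  refine ⟨c ^ (Fintype.card ι * Fintype.card ι), fun μ _ e => ?_⟩
  obtain ⟨S, hcard, hS⟩ := hc (e + 1)
  let piece : (ι → ι → S) → Set (GL ι F) := fun P => {g | g ∈ integralLevel F ι e ∧
    ∀ i j, nabs ((g : Matrix ι ι F) i j - P i j) ≤ radius F (e + 1)}
  have hcover : integralLevel F ι e ⊆ ⋃ P, piece P := by
    intro g hg
    choose s hs hgs using fun i j => hS _ (hg.1 i j)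
    exact Set.mem_iUnion.2 ⟨fun i j => ⟨s i j, hs i j⟩, hg, hgs⟩
  have hpiece : ∀ P, μ (piece P) ≤ μ (congrSubgroup F ι 1 : Set (GL ι F)) := by
    intro P
    by_cases hP : (piece P).Nonempty
    · obtain ⟨x, hx⟩ := hP
      rw [← measure_preimage_mul μ x⁻¹ (congrSubgroup F ι 1 : Set (GL ι F))]
      refine measure_mono fun g hg => inv_mul_mem_of_congr hx.1 fun i j => ?_
      have := nabs_sub_le (hg.2 i j) (hx.2 i j)
      rwa [sub_sub_sub_cancel_right] at this
    · rw [Set.not_nonempty_iff_eq_empty.1 hP, measure_empty]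
      exact zero_le
  calc μ (integralLevel F ι e) ≤ μ (⋃ P, piece P) := measure_mono hcover
    _ ≤ ∑ P, μ (piece P) := measure_iUnion_fintype_le μ piece
    _ ≤ ∑ _P : ι → ι → S, μ (congrSubgroup F ι 1 : Set (GL ι F)) :=
        Finset.sum_le_sum fun P _ => hpiece P
    _ ≤ _ := by
        rw [Finset.sum_const, nsmul_eq_mul, Finset.card_univ, Fintype.card_fun, Fintype.card_fun,
          Fintype.card_coe, ← pow_mul]
        refine mul_le_mul_left ?_ _
        have h1 : S.card ^ (Fintype.card ι * Fintype.card ι) ≤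
            (c ^ (Fintype.card ι * Fintype.card ι)) ^ (e + 1) := by
          refine (Nat.pow_le_pow_left hcard _).trans (le_of_eq ?_)
          rw [← pow_mul, ← pow_mul, mul_comm]
        exact_mod_cast h1

/-- A function on a topological group that is right invariant under an open subgroup is
continuous. -/
theorem continuous_of_right_invariant {G X : Type*} [Group G] [TopologicalSpace G]
    [IsTopologicalGroup G] [TopologicalSpace X] {f : G → X} (U : Subgroup G)
    (hU : IsOpen (U : Set G)) (hf : ∀ g, ∀ u ∈ U, f (g * u) = f g) : Continuous f := by
  refine IsLocallyConstant.continuous ((IsLocallyConstant.iff_eventually_eq f).2 fun x => ?_)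
  have h1 : (fun y => x⁻¹ * y) ⁻¹' (U : Set G) ∈ nhds x :=
    (hU.preimage (continuous_const_mul x⁻¹)).mem_nhds (by simp)
  filter_upwards [h1] with y hy
  have := hf x _ hy
  rwa [mul_inv_cancel_left] at this

end Volume

/-! ### Convergence of the integral -/

section Convergence

variable {F : Type*} [Field F] [ValuativeRel F] [TopologicalSpace F]
  [IsNonarchimedeanLocalField F]

/-- Zeta integrals converge absolutely in a right half plane depending only on the base `Q` of an
exponential bound: the level sets of the determinant on the support of `S` have volumes that grow
at most exponentially. -/
theorem exists_integrable_of_bound {m : ℕ} [MeasurableSpace (GL (Fin m) F)]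
    [BorelSpace (GL (Fin m) F)] {Q : ℝ} (hQ : 1 ≤ Q) :
    ∃ r : ℝ, ∀ (S : GL (Fin m) F → ℂ) (k : ℕ),
      (∀ g, ∀ h ∈ congrSubgroup F (Fin m) k, S (g * h) = S g) →
      (∃ N : ℕ, ∀ g, S g ≠ 0 → ∀ i j,
        nabs ((g : Matrix (Fin m) (Fin m) F) i j) ≤ resCard F ^ (N : ℤ)) →
      (∃ C : ℝ, 0 ≤ C ∧ ∀ g, ‖S g‖ ≤ C * Q ^ val (g : Matrix (Fin m) (Fin m) F).det) →
      ∀ s : ℂ, r < s.re → ∀ (μ : Measure (GL (Fin m) F)) [μ.IsHaarMeasure],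
        Integrable (fun g => S g *
          ((nabs (Matrix.det (g : Matrix (Fin m) (Fin m) F)) : ℝ) : ℂ) ^ s) μ := by
  have hQ0 : 0 < Q := zero_lt_one.trans_le hQ
  have hq0 := resCard_pos F
  obtain ⟨c, hc⟩ := exists_measure_integralLevel_le F (Fin m)
  obtain ⟨r, hr⟩ := exists_le_resCard_zpow F (c * Q)
  refine ⟨r, fun S k hinv ⟨N, hN⟩ ⟨C, hC0, hC⟩ s hs μ _ => ?_⟩
  set f : GL (Fin m) F → ℂ := fun g => S g *
    ((nabs (Matrix.det (g : Matrix (Fin m) (Fin m) F)) : ℝ) : ℂ) ^ s with hf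
  have hcont : Continuous f := by
    refine continuous_of_right_invariant (congrSubgroup F (Fin m) k) (isOpen_congrSubgroup k)
      fun g h hh => ?_
    simp only [hf]
    rw [hinv g h hh, Units.val_mul, Matrix.det_mul, nabs_mul, hh.1, mul_one]
  -- the base of the geometric series that dominates the integral
  set x : ℝ := Q * resCard F ^ (-s.re) with hx
  have hx0 : 0 < x := mul_pos hQ0 (Real.rpow_pos_of_pos hq0 _)
  have hcx : c * x < 1 := by
    have h1 : c * Q < resCard F ^ s.re := by
      refine hr.trans_lt ?_
      rw [← Real.rpow_intCast]
      exact Real.rpow_lt_rpow_of_exponent_lt (one_lt_resCard F) (by simpa using hs)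
    rw [hx, Real.rpow_neg hq0.le, ← mul_assoc, ← div_eq_mul_inv,
      div_lt_one (Real.rpow_pos_of_pos hq0 _)]
    exact h1
  have hfx : ∀ g : GL (Fin m) F,
      ‖f g‖ ≤ C * x ^ val (g : Matrix (Fin m) (Fin m) F).det := by
    intro g
    have hdet := det_ne_zero_GL g
    rw [hf, norm_mul, Complex.norm_cpow_eq_rpow_re_of_pos (nabs_pos hdet), nabs_of_ne_zero hdet,
      hx, mul_zpow, ← mul_assoc]
    refine mul_le_mul (hC g) (le_of_eq ?_) (Real.rpow_nonneg (zpow_pos hq0 _).le _)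
      (mul_nonneg hC0 (zpow_pos hQ0 _).le)
    rw [← Real.rpow_intCast, ← Real.rpow_intCast, ← Real.rpow_mul hq0.le, ← Real.rpow_mul hq0.le]
    congr 1
    push_cast
    ring
  -- scaling by `z` moves the support of `f` into the integral matrices
  let z : GL (Fin m) F := diagGL fun _ => unif F ^ (N : ℤ)
  have hzent : ∀ (g : GL (Fin m) F) i j,
      nabs (((z * g : GL (Fin m) F) : Matrix (Fin m) (Fin m) F) i j) =
      resCard F ^ (-(N : ℤ)) * nabs ((g : Matrix (Fin m) (Fin m) F) i j) := by
    intro g i j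
    rw [Units.val_mul, diagGL_val, Matrix.diagonal_mul, nabs_mul, nabs_unif_zpow]
  have hzdet : ∀ g : GL (Fin m) F, val ((z * g : GL (Fin m) F) : Matrix (Fin m) (Fin m) F).det =
      (m : ℤ) * N + val (g : Matrix (Fin m) (Fin m) F).det := by
    intro g
    rw [Units.val_mul, Matrix.det_mul, val_mul (det_ne_zero_GL _) (det_ne_zero_GL _), diagGL_val,
      Matrix.det_diagonal, Finset.prod_const, Finset.card_univ, Fintype.card_fin,
      ← Units.val_pow_eq_pow_val, ← zpow_natCast, ← _root_.zpow_mul, val_unif_zpow,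
      mul_comm (N : ℤ)]
  have hsupp : ∀ g, f g ≠ 0 → ∃ e : ℕ, z * g ∈ integralLevel F (Fin m) e ∧
      (e : ℤ) = (m : ℤ) * N + val (g : Matrix (Fin m) (Fin m) F).det := by
    intro g hg
    have hS : S g ≠ 0 := fun h => hg (by simp [hf, h])
    have hent : ∀ i j, nabs (((z * g : GL (Fin m) F) : Matrix (Fin m) (Fin m) F) i j) ≤ 1 := by
      intro i j
      rw [hzent, _root_.zpow_neg, inv_mul_le_iff₀ (zpow_pos hq0 _), mul_one]
      exact hN g hS i j
    have hdet := det_ne_zero_GL (z * g)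
    have hnn : 0 ≤ val ((z * g : GL (Fin m) F) : Matrix (Fin m) (Fin m) F).det := by
      have h1 := nabs_det_le_one hent
      exact nabs_units_le_one_iff (a := Units.mk0 _ hdet).1 h1
    obtain ⟨e, he⟩ := Int.eq_ofNat_of_zero_le hnn
    refine ⟨e, ⟨hent, ?_⟩, ?_⟩
    · rw [nabs_of_ne_zero hdet, he]
      rfl
    · rw [← hzdet, he]
  refine ⟨hcont.aestronglyMeasurable, ?_⟩
  set C' : ℝ := C * x ^ (-((m : ℤ) * N)) with hC'
  have hC'0 : 0 ≤ C' := mul_nonneg hC0 (zpow_pos hx0 _).le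
  let E : ℕ → Set (GL (Fin m) F) := fun e => (fun g => z * g) ⁻¹' integralLevel F (Fin m) e
  have hEmeas : ∀ e, MeasurableSet (E e) := fun e =>
    ((isOpen_integralLevel e).preimage (continuous_const_mul z)).measurableSet
  have hdom : ∀ g, ‖f g‖ₑ ≤
      ∑' e, (E e).indicator (fun _ => ENNReal.ofReal (C' * x ^ e)) g := by
    intro g
    by_cases hg : f g = 0
    · simp [hg]
    obtain ⟨e, he, hed⟩ := hsupp g hg
    refine le_trans ?_ (ENNReal.le_tsum e)
    rw [Set.indicator_of_mem (show g ∈ E e from he), ← ofReal_norm]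
    refine ENNReal.ofReal_le_ofReal ((hfx g).trans (le_of_eq ?_))
    rw [hC', mul_assoc, ← zpow_natCast, ← zpow_add₀ hx0.ne', hed]
    congr 2
    ring
  have hK : μ (congrSubgroup F (Fin m) 1 : Set (GL (Fin m) F)) < ⊤ :=
    (isCompact_congrSubgroup 1).measure_lt_top
  have hle : ∫⁻ g, ‖f g‖ₑ ∂μ ≤ (∑' e : ℕ, ENNReal.ofReal (C' * c * (c * x) ^ e)) *
      μ (congrSubgroup F (Fin m) 1 : Set (GL (Fin m) F)) := by
    calc ∫⁻ g, ‖f g‖ₑ ∂μ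
        ≤ ∫⁻ g, ∑' e, (E e).indicator (fun _ => ENNReal.ofReal (C' * x ^ e)) g ∂μ :=
          lintegral_mono hdom
      _ = ∑' e, ENNReal.ofReal (C' * x ^ e) * μ (integralLevel F (Fin m) e) := by
          rw [lintegral_tsum fun e => (measurable_const.indicator (hEmeas e)).aemeasurable]
          refine tsum_congr fun e => ?_
          rw [lintegral_indicator_const (hEmeas e), measure_preimage_mul]
      _ ≤ ∑' e, ENNReal.ofReal (C' * c * (c * x) ^ e) *
            μ (congrSubgroup F (Fin m) 1 : Set (GL (Fin m) F)) := by
          refine ENNReal.tsum_le_tsum fun e => ?_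
          refine (mul_le_mul_right (hc μ e) _).trans (le_of_eq ?_)
          rw [← mul_assoc]
          congr 1
          rw [← ENNReal.ofReal_natCast, ← ENNReal.ofReal_pow (Nat.cast_nonneg c),
            ← ENNReal.ofReal_mul (mul_nonneg hC'0 (pow_nonneg hx0.le _))]
          congr 1
          ring
      _ = _ := ENNReal.tsum_mul_right
  refine lt_of_le_of_lt hle (ENNReal.mul_lt_top ?_ hK)
  have hsum : Summable fun e : ℕ => C' * c * (c * x) ^ e :=
    (summable_geometric_of_lt_one (mul_nonneg (Nat.cast_nonneg c) hx0.le) hcx).mul_left _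
  exact hsum.tsum_ofReal_lt_top

end Convergence

end ShalikaPeriod

theorem mainTheorem4 {F : Type*} [Field F] [ValuativeRel F] [TopologicalSpace F]
    [IsNonarchimedeanLocalField F] (m : ℕ)
    [MeasurableSpace (GL (Fin m) F)] [BorelSpace (GL (Fin m) F)]
    {V : Type*} [AddCommGroup V] [Module ℂ V]
    (ρ : Representation ℂ (GL (ShalikaPeriod.Idx m) F) V)
    (hadm : ShalikaPeriod.IsAdmissible ρ)
    (hlen : IsFiniteLength ℂ[GL (ShalikaPeriod.Idx m) F] ρ.asModule) :
    -- the sets of exponents are finite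
    (∀ i : Fin m,
      (ShalikaPeriod.centralExponents ρ (ShalikaPeriod.firstIdx i)).Finite) ∧
    -- the expansion of `S_{L,v}(m(a))`
    (∀ θ : AddChar F Circle, Continuous θ → θ ≠ 1 →
      ∀ L ∈ ShalikaPeriod.shalikaHom ρ θ, ∀ v : V,
        ∃ (N : ℕ) (χ : Fin N → Fin m → (Fˣ →* ℂˣ)) (k : Fin N → Fin m → ℕ)
          (φ : Fin N → (Fin m → F) → ℂ),
          (∀ l i, χ l i ∈ ShalikaPeriod.centralExponents ρ (ShalikaPeriod.firstIdx i) ∨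
            (Subsingleton (ShalikaPeriod.JacquetModule ρ (ShalikaPeriod.firstIdx i)) ∧
              χ l i = 1)) ∧
          (∀ l, ShalikaPeriod.IsSchwartz (φ l)) ∧
          ∀ a : Fin m → Fˣ,
            (∀ i : Fin m, (i : ℕ) + 1 < m → ShalikaPeriod.nabs (a i : F) ≤ 1) →
            ShalikaPeriod.shalikaFun ρ L v (ShalikaPeriod.mMat a) =
              ∑ l, (∏ i, (χ l i (a i) : ℂ) * (ShalikaPeriod.val (a i : F) : ℂ) ^ k l i) *
                φ l (fun i => (a i : F))) ∧
    -- absolute convergence of `I(S_{L,v}, s)` in a right half plane depending only on `ρ`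
    ∃ r : ℝ, ∀ θ : AddChar F Circle, Continuous θ → θ ≠ 1 →
      ∀ L ∈ ShalikaPeriod.shalikaHom ρ θ, ∀ v : V, ∀ s : ℂ, r < s.re →
        ∀ (μ : Measure (GL (Fin m) F)) [μ.IsHaarMeasure],
          Integrable (fun g : GL (Fin m) F =>
            ShalikaPeriod.shalikaFun ρ L v (ShalikaPeriod.diagOne g) *
              ((ShalikaPeriod.nabs (Matrix.det (g : Matrix (Fin m) (Fin m) F)) : ℝ) : ℂ) ^ s)
            μ := by
  refine ⟨fun i => ShalikaPeriod.finite_centralExponents hadm hlen,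
    fun θ hθ hθ1 L hL v => ShalikaPeriod.exists_shalika_expansion hadm hθ hθ1 hL v, ?_⟩
  obtain ⟨Q, hQ1, hQ⟩ := ShalikaPeriod.exists_shalika_bound hadm hlen
  obtain ⟨r, hr⟩ := ShalikaPeriod.exists_integrable_of_bound (F := F) (m := m) hQ1
  refine ⟨r, fun θ hθ hθ1 L hL v s hs μ _ => ?_⟩
  obtain ⟨k, -, hfix⟩ := hadm.exists_fixed v
  refine hr _ k (fun g h hh => ?_) (ShalikaPeriod.exists_support_bound hadm hθ1 hL v)
    (hQ θ hθ hθ1 L hL v) s hs μ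
  rw [ShalikaPeriod.diagOne_mul, map_mul, Module.End.mul_apply,
    hfix _ (ShalikaPeriod.diagOne_mem_congrSubgroup hh)]
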